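/- Let $M$ be a set with a pseudo-metric $r:M\times M\to[0,\pi/2]$ and a symmetric function $\theta:M\times M\to[0,\pi]$ with $\theta(x,x)=0$, such that $$\delta(x,y):=\arccos(\cos r(x,y)\,\cos\theta(x,y))$$ is a metric on $M$ (this is automatic if $\theta$ is also a pseudo-metric and $r(x,y)=\theta(x,y)=0$ only for $x=y$). Let $\mu$ be a $\sigma$-finite Borel measure on $(M,\delta)$. A family $\{h_t\}_{t>0}$ of measurable functions on $M\times M$ is called a heat kernel on $(M,\delta,\mu)$ if, for $\mu$-almost all $x,y\in M$ and all $s,t>0$: (i) $h_t(x,y)\ge 0$; (ii) $h_t(x,y)=h_t(y,x)$; (iii) $\int_M h_t(x,y)\,d\mu(y)=1$; (iv) $h_{s+t}(x,y)=\int_M h_s(x,z)h_t(z,y)\,d\mu(z)$; and (v) for every $f\in L^2(M,\mu)$, $\int_M h_t(\cdot,y)f(y)\,d\mu(y)\to f$ in $L^2(M,\mu)$ as $t\to0^+$. For $k\ge 0$ and $n\in\mathbb Z$ let $$\Phi_{k,n}(r)=(2k+|n|+1)(\cos r)^{|n|}P_k^{0,|n|}(\cos 2r),\qquad P_k^{0,m}(x)=\frac{(-1)^k}{2^kk!(1+x)^m}\frac{d^k}{dx^k}\Big((1+x)^m(1-x^2)^k\Big)$$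 (the Jacobi polynomials). Assume that $p_t(x,y)=p(t,r(x,y),\theta(x,y))$ is a heat kernel on $(M,\delta,\mu)$, where $$p(t,r,\theta)=\sum_{n\in\mathbb Z}\sum_{k\ge0}e^{-(4k(k+|n|+1)+2|n|)t}\,e^{in\theta}\,\Phi_{k,n}(r).$$ For $t>0$ let $$q(t,x)=\frac{\sqrt\pi\,e^t}{4t^{3/2}}\frac1{\sqrt{1-x^2}}\sum_{k\in\mathbb Z}(\arccos x+2k\pi)\,e^{-(\arccos x+2k\pi)^2/(4t)},\qquad -1<x<1,$$ extended continuously to $x=\pm1$ (the profile of the Riemannian heat kernel of the unit sphere $S^3$), and let $q_t(x,y)=q(t,\cos\delta(x,y))$ for $x,y\in M$. Then for all $t>0$ and all $x,y\in M$ $$q_t(x,y)=\sum_{n\in\mathbb Z}\sum_{k\ge0}e^{\lambda'_{k,n}t}\,e^{in\theta(x,y)}\,\Phi_{k,n}(r(x,y)),\qquad \lambda'_{k,n}=-(4k(k+|n|+1)+2|n|+n^2),$$ with absolute convergence, and $\{q_t\}_{t>0}$ is a heat kernel on $(M,\delta,\mu)$, i.e. it satisfies (i)-(v). -/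

import Mathlib

open Real Set Filter Topology MeasureTheory Polynomial

noncomputable section

namespace HeatRigidity

/-- Pseudo-metrics on a set, as non-negative real functions of two points. -/
structure IsPseudoMetric {M : Type*} (r : M → M → ℝ) : Prop where
  nonneg : ∀ x y, 0 ≤ r x y
  self : ∀ x, r x x = 0
  symm : ∀ x y, r x y = r y x
  triangle : ∀ x y z, r x z ≤ r x y + r y z

/-- The function `δ = arccos (cos r · cos θ)` of the two real quantities `r` and `θ`. -/
def delta (r θ : ℝ) : ℝ := arccos (cos r * cos θ)

/-- (Abstract, conservative) heat kernels on a measure space.  Only the restriction of `p` to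
times `t > 0` matters. -/
structure IsHeatKernel {X : Type*} [MeasurableSpace X] (μ : Measure X) (p : ℝ → X → X → ℝ) :
    Prop where
  measurable : ∀ t, 0 < t → Measurable (fun z : X × X => p t z.1 z.2)
  /-- (i) positivity -/
  nonneg : ∀ᵐ z ∂(μ.prod μ), ∀ t, 0 < t → 0 ≤ p t z.1 z.2
  /-- (ii) symmetry -/
  symm : ∀ᵐ z ∂(μ.prod μ), ∀ t, 0 < t → p t z.1 z.2 = p t z.2 z.1
  /-- (iii) stochastic completeness -/
  conservative : ∀ᵐ x ∂μ, ∀ t, 0 < t →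
    Integrable (fun y => p t x y) μ ∧ ∫ y, p t x y ∂μ = 1
  /-- (iv) the Chapman–Kolmogorov equations -/
  semigroup : ∀ᵐ z ∂(μ.prod μ), ∀ s t, 0 < s → 0 < t →
    Integrable (fun w => p s z.1 w * p t w z.2) μ ∧
      p (s + t) z.1 z.2 = ∫ w, p s z.1 w * p t w z.2 ∂μ
  /-- (v) approximation of the identity in `L²` -/
  approx : ∀ f : X → ℝ, MemLp f 2 μ →
    Tendsto (fun t => eLpNorm (fun x => (∫ y, p t x y * f y ∂μ) - f x) 2 μ) (𝓝[>] 0) (𝓝 0)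

/-- The Jacobi polynomial `P_k^{0,n}`, by Rodrigues' formula
`(-1)^k / (2^k k! (1+x)^n) · d^k/dx^k ((1+x)^n (1-x²)^k)`.  The division by `(1+X)^n` is exact, see
`jacobi_rodrigues`; carrying it out in `ℝ[X]` makes the value at `x = -1` the right one. -/
def jacobi (k n : ℕ) : ℝ[X] :=
  C ((-1) ^ k / (2 ^ k * (k.factorial : ℝ))) *
    (derivative^[k] ((1 + X) ^ n * (1 - X ^ 2) ^ k) /ₘ (1 + X) ^ n)

theorem jacobi_rodrigues (k n : ℕ) :
    (1 + X) ^ n * jacobi k n = C ((-1) ^ k / (2 ^ k * (k.factorial : ℝ))) *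
      derivative^[k] ((1 + X : ℝ[X]) ^ n * (1 - X ^ 2) ^ k) := by
  have hm : ((1 + X : ℝ[X]) ^ n).Monic := by
    have : (1 + X : ℝ[X]).Monic := by
      rw [add_comm]; exact monic_X_add_C (1 : ℝ)
    exact this.pow n
  have hd : (1 + X : ℝ[X]) ^ n ∣ derivative^[k] ((1 + X : ℝ[X]) ^ n * (1 - X ^ 2) ^ k) := by
    have h1 : (1 + X : ℝ[X]) ^ (n + k) ∣ (1 + X : ℝ[X]) ^ n * (1 - X ^ 2) ^ k := by
      refine ⟨(1 - X) ^ k, ?_⟩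
      rw [show (1 - X ^ 2 : ℝ[X]) = (1 + X) * (1 - X) by ring, mul_pow, pow_add]
      ring
    simpa using pow_sub_dvd_iterate_derivative_of_pow_dvd k h1
  obtain ⟨g, hg⟩ := hd
  rw [jacobi, hg, mul_divByMonic_cancel_left _ hm]
  ring

/-- `Φ_{k,n}(r) = (2k+|n|+1) (cos r)^{|n|} P_k^{0,|n|}(cos 2r)`. -/
def phi (k : ℕ) (n : ℤ) (r : ℝ) : ℝ :=
  (2 * k + n.natAbs + 1) * cos r ^ n.natAbs * (jacobi k n.natAbs).eval (cos (2 * r))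

/-- `λ_{k,n} = -(4k(k+|n|+1) + 2|n|)`. -/
def subEigenvalue (k : ℕ) (n : ℤ) : ℝ :=
  -(4 * k * (k + n.natAbs + 1) + 2 * n.natAbs)

/-- `λ'_{k,n} = -(4k(k+|n|+1) + 2|n| + n²)`. -/
def riemEigenvalue (k : ℕ) (n : ℤ) : ℝ :=
  -(4 * k * (k + n.natAbs + 1) + 2 * n.natAbs + (n : ℝ) ^ 2)

/-- The profile of the subelliptic heat kernel of `SU(2)`,
`p(t,r,θ) = ∑_n ∑_k (2k+|n|+1) e^{λ_{k,n} t} e^{inθ} (cos r)^{|n|} P_k^{0,|n|}(cos 2r)`.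
The series is real, because the terms for `n` and `-n` are conjugate. -/
def subellipticProfile (t r θ : ℝ) : ℝ :=
  (∑' n : ℤ, ∑' k : ℕ, (rexp (subEigenvalue k n * t) : ℂ) *
    Complex.exp (Complex.I * n * θ) * (phi k n r : ℂ)).re

/-- The profile of the Riemannian heat kernel of the unit sphere `S³` (for the normalized volume),
`q(t,x) = √π e^t / (4 t^{3/2}) · (1-x²)^{-1/2} · ∑_{k ∈ ℤ} (arccos x + 2kπ) e^{-(arccos x + 2kπ)²/4t}`
for `-1 < x < 1`, extended continuously to `x = 1` and `x = -1`. -/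
def riemProfile (t : ℝ) : ℝ → ℝ :=
  extendFrom (Ioo (-1 : ℝ) 1) fun x =>
    √π * rexp t / (4 * t ^ (3 / 2 : ℝ)) * (1 / √(1 - x ^ 2)) *
      ∑' k : ℤ, (arccos x + 2 * k * π) * rexp (-(arccos x + 2 * k * π) ^ 2 / (4 * t))

/-- `q_t(x,y) = q(t, cos δ(x,y))`. -/
def riemKernel {M : Type*} (r θ : M → M → ℝ) (t : ℝ) (x y : M) : ℝ :=
  riemProfile t (cos (delta (r x y) (θ x y)))

/-- If `r ≤ π/2` and `θ ≤ π` are pseudo-metrics, then `δ` satisfies the triangle inequality. -/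
theorem delta_triangle {M : Type*} {r θ : M → M → ℝ} (hr : IsPseudoMetric r)
    (hθ : IsPseudoMetric θ) (hr_le : ∀ x y, r x y ≤ π / 2) (hθ_le : ∀ x y, θ x y ≤ π)
    (x y z : M) :
    delta (r x z) (θ x z) ≤ delta (r x y) (θ x y) + delta (r y z) (θ y z) := by
  -- three sides of a spherical triangle
  have gram : ∀ a b c : ℝ, 0 ≤ a → 0 ≤ b → 0 ≤ c → a ≤ π → b ≤ π → c ≤ π → c ≤ a + b →
      a ≤ b + c → b ≤ a + c → a + b + c ≤ 2 * π →
      (cos c - cos a * cos b) ^ 2 ≤ (1 - cos a ^ 2) * (1 - cos b ^ 2) := by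
    intro a b c ha hb hc ha' hb' hc' h1 h2 h3 h4
    have e1 : cos (a + b) ≤ cos c := by
      rcases le_total (a + b) π with h | h
      · exact cos_le_cos_of_nonneg_of_le_pi hc h h1
      · rw [show cos (a + b) = cos (2 * π - (a + b)) by rw [cos_two_pi_sub]]
        exact cos_le_cos_of_nonneg_of_le_pi hc (by linarith) (by linarith)
    have e2 : cos c ≤ cos (a - b) := by
      rw [← cos_abs (a - b)]
      exact cos_le_cos_of_nonneg_of_le_pi (abs_nonneg _) hc' (abs_le.2 ⟨by linarith, by linarith⟩)
    rw [cos_add] at e1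
    rw [cos_sub] at e2
    rw [← sin_sq, ← sin_sq, ← mul_pow]
    exact sq_le_sq' (by linarith) (by linarith)
  -- Schur product of two such triples
  have schur : ∀ a b c a' b' c' : ℝ, a ^ 2 ≤ 1 → b ^ 2 ≤ 1 → a' ^ 2 ≤ 1 → b' ^ 2 ≤ 1 →
      (c - a * b) ^ 2 ≤ (1 - a ^ 2) * (1 - b ^ 2) →
      (c' - a' * b') ^ 2 ≤ (1 - a' ^ 2) * (1 - b' ^ 2) →
      arccos (c * c') ≤ arccos (a * a') + arccos (b * b') := by
    intro a b c a' b' c' ha hb ha' hb' h h'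
    obtain ⟨s, hs, hs2⟩ : ∃ s, 0 ≤ s ∧ s ^ 2 = 1 - a ^ 2 :=
      ⟨√(1 - a ^ 2), sqrt_nonneg _, sq_sqrt (by linarith)⟩
    obtain ⟨u, hu, hu2⟩ : ∃ s, 0 ≤ s ∧ s ^ 2 = 1 - b ^ 2 :=
      ⟨√(1 - b ^ 2), sqrt_nonneg _, sq_sqrt (by linarith)⟩
    obtain ⟨s', hs', hs2'⟩ : ∃ s, 0 ≤ s ∧ s ^ 2 = 1 - a' ^ 2 :=
      ⟨√(1 - a' ^ 2), sqrt_nonneg _, sq_sqrt (by linarith)⟩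
    obtain ⟨u', hu', hu2'⟩ : ∃ s, 0 ≤ s ∧ s ^ 2 = 1 - b' ^ 2 :=
      ⟨√(1 - b' ^ 2), sqrt_nonneg _, sq_sqrt (by linarith)⟩
    have d1 : |c - a * b| ≤ s * u := by
      apply abs_le_of_sq_le_sq _ (by positivity)
      rw [mul_pow, hs2, hu2]; exact h
    have d2 : |c' - a' * b'| ≤ s' * u' := by
      apply abs_le_of_sq_le_sq _ (by positivity)
      rw [mul_pow, hs2', hu2']; exact h'
    have key : |c * c' - a * a' * (b * b')| ≤
        (s * s') * (u * u') + (s * |a'|) * (u * |b'|) + (|a| * s') * (|b| * u') := by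
      have : c * c' - a * a' * (b * b') = (c - a * b) * (c' - a' * b') +
          (c - a * b) * (a' * b') + (a * b) * (c' - a' * b') := by ring
      rw [this]
      refine (abs_add_three _ _ _).trans ?_
      simp only [abs_mul]
      have k1 : |c - a * b| * |c' - a' * b'| ≤ (s * u) * (s' * u') := by gcongr
      have k2 : |c - a * b| * (|a'| * |b'|) ≤ (s * u) * (|a'| * |b'|) := by gcongr
      have k3 : (|a| * |b|) * |c' - a' * b'| ≤ (|a| * |b|) * (s' * u') := by gcongr
      calc _ ≤ (s * u) * (s' * u') + (s * u) * (|a'| * |b'|) + (|a| * |b|) * (s' * u') :=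
            add_le_add (add_le_add k1 k2) k3
        _ = _ := by ring
    have cs : ((s * s') * (u * u') + (s * |a'|) * (u * |b'|) + (|a| * s') * (|b| * u')) ^ 2 ≤
        (1 - (a * a') ^ 2) * (1 - (b * b') ^ 2) := by
      have f1 : 1 - (a * a') ^ 2 = (s * s') ^ 2 + (s * |a'|) ^ 2 + (|a| * s') ^ 2 := by
        simp only [mul_pow, sq_abs, hs2, hs2']; ring
      have f2 : 1 - (b * b') ^ 2 = (u * u') ^ 2 + (u * |b'|) ^ 2 + (|b| * u') ^ 2 := by
        simp only [mul_pow, sq_abs, hu2, hu2']; ring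
      rw [f1, f2]
      generalize s * s' = p1
      generalize s * |a'| = p2
      generalize |a| * s' = p3
      generalize u * u' = q1
      generalize u * |b'| = q2
      generalize |b| * u' = q3
      linarith [sq_nonneg (p1 * q2 - p2 * q1), sq_nonneg (p1 * q3 - p3 * q1),
        sq_nonneg (p2 * q3 - p3 * q2)]
    have hA : (a * a') ^ 2 ≤ 1 := by
      rw [mul_pow]; exact mul_le_one₀ ha (sq_nonneg _) ha'
    have hB : (b * b') ^ 2 ≤ 1 := by
      rw [mul_pow]; exact mul_le_one₀ hb (sq_nonneg _) hb'
    have hA' := abs_le.1 ((sq_le_one_iff_abs_le_one (a * a')).1 hA)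
    have hB' := abs_le.1 ((sq_le_one_iff_abs_le_one (b * b')).1 hB)
    rcases le_total π (arccos (a * a') + arccos (b * b')) with hπ | hπ
    · exact (arccos_le_pi _).trans hπ
    · have hcos : cos (arccos (a * a') + arccos (b * b')) ≤ c * c' := by
        rw [cos_add, cos_arccos hA'.1 hA'.2, cos_arccos hB'.1 hB'.2, sin_arccos, sin_arccos,
          ← sqrt_mul (by linarith)]
        have := (key.trans (le_abs_self _)).trans (abs_le_sqrt cs)
        have := (abs_le.1 this).1
        linarith
      calc arccos (c * c') ≤ arccos (cos (arccos (a * a') + arccos (b * b'))) :=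
            arccos_le_arccos hcos
        _ = _ := arccos_cos (add_nonneg (arccos_nonneg _) (arccos_nonneg _)) hπ
  have hpi := pi_pos
  have sq1 : ∀ t : ℝ, cos t ^ 2 ≤ 1 := cos_sq_le_one
  have G := gram (r x y) (r y z) (r x z) (hr.nonneg _ _) (hr.nonneg _ _) (hr.nonneg _ _)
    (by linarith [hr_le x y]) (by linarith [hr_le y z]) (by linarith [hr_le x z])
    (hr.triangle x y z) (by have := hr.triangle x z y; rw [hr.symm z y] at this; linarith)
    (by have := hr.triangle y x z; rw [hr.symm y x] at this; linarith)
    (by linarith [hr_le x y, hr_le y z, hr_le x z])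
  have t1 := hθ.triangle x y z
  have t2 := hθ.triangle x z y
  have t3 := hθ.triangle y x z
  rw [hθ.symm z y] at t2
  rw [hθ.symm y x] at t3
  have n1 := hθ.nonneg x y
  have n2 := hθ.nonneg y z
  have n3 := hθ.nonneg x z
  have l1 := hθ_le x y
  have l2 := hθ_le y z
  have l3 := hθ_le x z
  unfold delta
  rcases le_total (θ x y + θ y z + θ x z) (2 * π) with h | h
  · exact schur _ _ _ _ _ _ (sq1 _) (sq1 _) (sq1 _) (sq1 _) G
      (gram _ _ _ n1 n2 n3 l1 l2 l3 t1 (by linarith) (by linarith) h)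
  · have := schur _ _ _ _ _ _ (sq1 _) (sq1 _) (sq1 _) (sq1 _) G
      (gram (2 * π - θ y z - θ x z) (θ y z) (θ x z) (by linarith) n2 n3 (by linarith) l2 l3
        (by linarith) (by linarith) (by linarith) (by linarith))
    refine this.trans (add_le_add_left (arccos_le_arccos ?_) _)
    exact mul_le_mul_of_nonneg_left
      (cos_le_cos_of_nonneg_of_le_pi (by linarith) l1 (by linarith))
      (cos_nonneg_of_mem_Icc ⟨by linarith [hr.nonneg x y], hr_le x y⟩)

end HeatRigidity

end

/-!
Put `ζ = cos r · e^{iθ}` (`zeta`), a point of the closed unit disc with `Re ζ = cos δ`. The modes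
`e^{inθ} Φ_{k,n}(r)` are the weighted disc polynomials `(i + j + 1) D_{i,j}(ζ)`, where `n = j - i`
and `k = min i j` (`exp_mul_phi`). For fixed `m = i + j` the `D_{i,j}(ζ)` add up to the Chebyshev
polynomial `U_m(Re ζ)` (`sum_disc_eq_chebyshev`), and `λ'_{k,n} = -m(m + 2)` depends on `m` only.
The double series is therefore the zonal expansion `∑ (m + 1) e^{-m(m+2)t} U_m(cos δ)` of the heat
kernel of `S³`, and the functional equation of the theta function identifies it with the closed
formula for `q` (`hasSum_sin_theta`, `riemProfile_eq`).

That `q_t` is a heat kernel has to be deduced from the same property of `p_t` alone, since nothing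
else is known about the measure space. As `t → ∞` the kernel `p_t` tends to `1` uniformly, so a
nonzero `μ` is a probability measure (`measure_univ_eq_one`). Collecting the modes with equal
eigenvalue gives `p_t = ∑ e^{-2Nt} ψ_N`, and the Chapman–Kolmogorov equation together with the
uniqueness of exponential series makes the `ψ_N` idempotent and mutually orthogonal kernels
(`IsDiscHeat.psi_comp`). The trace of `ψ_N` is not available directly, because the diagonal may be
a null set. It is replaced by concentration: `p_t` decays off the diagonal as `t → 0`, by a
maximum principle on the disc and an estimate of the moments of `1 - Re ζ` (`disc_heat_nonneg`,
`heatAtOne_defect_pow_le`, `exists_one_sub_re_pow_mul_heatDisc_le`), whence `∫∫ p_t h(ζ) → h(1)`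
for continuous `h` (`IsDiscHeat.tendsto_integral_heat`) and `∫∫ ψ_N² = ψ_N(1)`
(`IsDiscHeat.integral_psi_mul_psi`). These relations determine all moments of the law of
`(Re ζ, |Im ζ|)` under `μ ⊗ μ`: they are those of the uniform measure of the disc
(`corr_eq_corrStd`). In particular the `U_m(Re ζ)` are orthonormal
(`IsDiscHeat.integral_chebyshevU`).

Now `ψ_1 = 4 Re ζ` is the kernel of a projection of rank `4`, so that `Re ζ(x, y) = ⟨f(x), f(y)⟩`
for almost all `(x, y)` with a map `f : M → S³` (`IsDiscHeat.exists_sphere_map`). The kernel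
`∑_{j ≤ M} (j + 1) U_j(Re ζ)` is a polynomial of degree `M` in the coordinates of `f`, and on `S³`
such polynomials form a space of dimension at most `∑ (j + 1)²`, which is also the trace and the
squared Hilbert–Schmidt norm of the kernel. Hence the kernel is the projection onto these
polynomials (`zonal_comp`), and the `(m + 1) U_m(Re ζ)` are idempotent and mutually orthogonal
(`chebyshevU_comp`), which yields the conservation and semigroup properties of `q_t`. Its
non-negativity follows from a maximum principle for zonal functions on `[-1, 1]`
(`sphere_heat_nonneg`) and polynomial approximation (`IsSphereKernel.ae_heat_nonneg`).

For the strong continuity, integration against `q_t` is a contraction of `L²` by Jensen's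
inequality, so it suffices to treat a dense set of functions. The functions
`∫ p_s(·, y) f(y) dμ(y)` are dense because `p` is a heat kernel, and the triangle inequalities for
`r` and `δ` make them uniformly continuous, since `p_s` depends continuously on `r` and `δ`
(`IsDiscHeat.isHeatKernel_heatSphere`, `isHeatKernel_riemKernel`).
-/

noncomputable section

namespace HeatRigidity

open scoped ComplexConjugate

/-! ### Disc polynomials -/

/-- The disc (Zernike) polynomials `D_{i,j}(z, w)`, for two elements `z`, `w` of a commutative ring,
normalized by `D_{i,j}(1, 1) = 1`.  In the geometric situation `w` is the conjugate of `z`. -/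
def disc {R : Type*} [CommRing R] (z w : R) : ℕ → ℕ → R
  | 0, 0 => 1
  | 0, j + 1 => z * disc z w 0 j
  | i + 1, 0 => w * disc z w i 0
  | i + 1, j + 1 => z * disc z w (i + 1) j + w * disc z w i (j + 1) - disc z w i j
termination_by i j => i + j

section Algebra

variable {R : Type*} [CommRing R] (z w : R)

@[simp] theorem disc_zero_zero : disc z w 0 0 = 1 := by rw [disc]

theorem disc_zero_succ (j : ℕ) : disc z w 0 (j + 1) = z * disc z w 0 j := by rw [disc]

theorem disc_succ_zero (i : ℕ) : disc z w (i + 1) 0 = w * disc z w i 0 := by rw [disc]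

theorem disc_succ_succ (i j : ℕ) : disc z w (i + 1) (j + 1) =
    z * disc z w (i + 1) j + w * disc z w i (j + 1) - disc z w i j := by rw [disc]

/-- Two arrays with the same values on the axes and the same three-term recursion agree. -/
theorem disc_unique {f : ℕ → ℕ → R} (h00 : f 0 0 = 1) (h0 : ∀ j, f 0 (j + 1) = z * f 0 j)
    (h1 : ∀ i, f (i + 1) 0 = w * f i 0)
    (h2 : ∀ i j, f (i + 1) (j + 1) = z * f (i + 1) j + w * f i (j + 1) - f i j) (i j : ℕ) :
    f i j = disc z w i j := by
  induction i generalizing j with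
  | zero =>
    induction j with
    | zero => simp [h00]
    | succ j ih => rw [h0, disc_zero_succ, ih]
  | succ i ihi =>
    induction j with
    | zero => rw [h1, disc_succ_zero, ihi]
    | succ j ihj => rw [h2, disc_succ_succ, ihj, ihi, ihi]

theorem map_disc {S : Type*} [CommRing S] (f : R →+* S) (i j : ℕ) :
    f (disc z w i j) = disc (f z) (f w) i j :=
  disc_unique (f z) (f w) (f := fun i j => f (disc z w i j)) (by simp)
    (fun j => by simp [disc_zero_succ]) (fun i => by simp [disc_succ_zero])
    (fun i j => by simp [disc_succ_succ]) i j

theorem disc_swap (i j : ℕ) : disc z w i j = disc w z j i :=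
  (disc_unique z w (f := fun i j => disc w z j i) (by simp)
    (fun j => by simp [disc_succ_zero]) (fun i => by simp [disc_zero_succ])
    (fun i j => by simp only [disc_succ_succ]; ring) i j).symm

theorem disc_one_one (i j : ℕ) : disc (1 : R) 1 i j = 1 :=
  (disc_unique (1 : R) 1 (f := fun _ _ => 1) rfl (by simp) (by simp) (by simp) i j).symm

theorem disc_zero_left (j : ℕ) : disc z w 0 j = z ^ j := by
  induction j with
  | zero => simp
  | succ j ih => rw [disc_zero_succ, ih, pow_succ']

theorem disc_zero_right (i : ℕ) : disc z w i 0 = w ^ i := by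
  rw [disc_swap, disc_zero_left]

/-- Rotating the variable. -/
theorem disc_smul (a b : R) (hab : a * b = 1) (i j : ℕ) :
    disc (a * z) (b * w) i j = a ^ j * b ^ i * disc z w i j :=
  (disc_unique (a * z) (b * w) (f := fun i j => a ^ j * b ^ i * disc z w i j) (by simp)
    (fun j => by rw [disc_zero_succ]; ring) (fun i => by rw [disc_succ_zero]; ring)
    (fun i j => by
      simp only [disc_succ_succ]
      linear_combination (-a ^ j * b ^ i * disc z w i j) * hab) i j).symm

/-- Multiplication by `z` in the basis of disc polynomials; for `i = 0` the last term vanishes. -/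
theorem mul_disc (i j : ℕ) : ((i + j + 1 : ℕ) : R) * (z * disc z w i j) =
    (j + 1 : ℕ) * disc z w i (j + 1) + (i : R) * disc z w (i - 1) j := by
  -- the defect of the formula satisfies the three-term recursion and vanishes on the axes
  have h0 : ∀ j : ℕ, ((0 + j + 1 : ℕ) : R) * (z * disc z w 0 j) =
      (j + 1 : ℕ) * disc z w 0 (j + 1) + ((0 : ℕ) : R) * disc z w (0 - 1) j := by
    intro j; rw [disc_zero_succ]; push_cast; ring
  have h1 : ∀ i : ℕ, disc z w (i + 1) 1 = (i + 2) * z * w ^ (i + 1) - (i + 1) * w ^ i := by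
    intro i
    induction i with
    | zero =>
      rw [disc_succ_succ, disc_zero_succ, disc_succ_zero]; simp; ring
    | succ i ih =>
      rw [disc_succ_succ, ih, disc_zero_right, disc_zero_right]; push_cast; ring
  induction i generalizing j with
  | zero => exact h0 j
  | succ i ihi =>
    induction j with
    | zero =>
      rw [h1, disc_zero_right, Nat.add_sub_cancel, disc_zero_right]; push_cast; ring
    | succ j ihj =>
      have e1 := disc_succ_succ z w i j
      have e2 := disc_succ_succ z w i (j + 1)
      have e3 := ihi (j + 1)
      have e4 := ihi j
      rw [Nat.add_sub_cancel] at ihj ⊢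
      rcases i with _ | i
      · simp only [Nat.zero_sub, disc_zero_succ, Nat.cast_add, Nat.cast_one, Nat.cast_zero] at *
        linear_combination (2 * z + (j : R) * z + z) * e1 - (j + 2) * e2 + z * ihj + w * e3 - e4
          - z * e1
      · have e5 := disc_succ_succ z w i j
        rw [Nat.add_sub_cancel] at e3 e4
        push_cast at *
        linear_combination (z * ((i : R) + 1 + j + 2)) * e1 - (j + 2) * e2 + z * ihj + w * e3 - e4
          - (i + 1) * e5

theorem mul_disc' (i j : ℕ) : ((i + j + 1 : ℕ) : R) * (w * disc z w i j) =
    (i + 1 : ℕ) * disc z w (i + 1) j + (j : R) * disc z w i (j - 1) := by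
  rw [disc_swap z w i j, disc_swap z w (i + 1) j, disc_swap z w i (j - 1), ← mul_disc w z j i,
    add_comm i j]

/-- The generating coefficients `C(n,s) z^{n-s}`. -/
theorem choose_mul_pow_succ (n s : ℕ) : ((n + 1).choose (s + 1) : R) * z ^ (n + 1 - (s + 1)) =
    z * ((n.choose (s + 1) : R) * z ^ (n - (s + 1))) + (n.choose s : R) * z ^ (n - s) := by
  rw [Nat.choose_succ_succ]
  rcases lt_or_ge s n with h | h
  · obtain ⟨d, rfl⟩ := Nat.exists_eq_add_of_lt h
    rw [show s + d + 1 + 1 - (s + 1) = d + 1 by omega, show s + d + 1 - (s + 1) = d by omega,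
      show s + d + 1 - s = d + 1 by omega]
    push_cast; ring
  · rw [Nat.choose_eq_zero_of_lt (Nat.lt_succ_of_le h)]
    simp

/-- The closed form of the disc polynomials. -/
theorem disc_eq_sum (N i j : ℕ) (hi : i < N) : disc z w i j =
    ∑ s ∈ Finset.range N, (-(1 - z * w)) ^ s * ((i.choose s : R) * w ^ (i - s)) *
      ((j.choose s : R) * z ^ (j - s)) := by
  -- extending the range of summation makes the recursion uniform in `i` and `j`
  have key : ∀ M, i < M → ∑ s ∈ Finset.range M, (-(1 - z * w)) ^ s *
      ((i.choose s : R) * w ^ (i - s)) * ((j.choose s : R) * z ^ (j - s)) =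
      ∑ s ∈ Finset.range (i + 1), (-(1 - z * w)) ^ s * ((i.choose s : R) * w ^ (i - s)) *
      ((j.choose s : R) * z ^ (j - s)) := by
    intro M hM
    symm
    apply Finset.sum_subset (Finset.range_subset_range.2 hM)
    intro s _ hs
    rw [Finset.mem_range, not_lt] at hs
    rw [Nat.choose_eq_zero_of_lt (show i < s by omega)]; simp
  rw [key N hi]
  let f : ℕ → ℕ → R := fun i j => ∑ s ∈ Finset.range (i + 1), (-(1 - z * w)) ^ s *
    ((i.choose s : R) * w ^ (i - s)) * ((j.choose s : R) * z ^ (j - s))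
  symm
  apply disc_unique z w (f := f)
  · simp [f]
  · intro j; simp [f, pow_succ']
  · intro i
    have h : ∀ i, f i 0 = w ^ i := by
      intro i
      simp only [f]
      rw [Finset.sum_range_succ']
      simp
    rw [h, h, pow_succ']
  · intro i j
    simp only [f]
    have big : ∀ j, ∑ s ∈ Finset.range (i + 1), (-(1 - z * w)) ^ s * ((i.choose s : R) *
        w ^ (i - s)) * ((j.choose s : R) * z ^ (j - s)) = ∑ s ∈ Finset.range (i + 2),
        (-(1 - z * w)) ^ s * ((i.choose s : R) * w ^ (i - s)) *
          ((j.choose s : R) * z ^ (j - s)) := by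
      intro j
      rw [Finset.sum_range_succ _ (i + 1), Nat.choose_eq_zero_of_lt (Nat.lt_succ_self i)]; simp
    rw [big (j + 1), Finset.sum_range_succ', Finset.sum_range_succ' _ (i + 1),
      Finset.sum_range_succ' _ (i + 1)]
    simp only [choose_mul_pow_succ]
    have h0 := big j
    rw [Finset.sum_range_succ' _ (i + 1)] at h0
    have h1 : ∑ s ∈ Finset.range (i + 1), (-(1 - z * w)) ^ (s + 1) *
        ((w * ((i.choose (s + 1) : R) * w ^ (i - (s + 1))) + (i.choose s : R) * w ^ (i - s)) *
        (z * ((j.choose (s + 1) : R) * z ^ (j - (s + 1))) + (j.choose s : R) * z ^ (j - s))) =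
        z * ∑ s ∈ Finset.range (i + 1), (-(1 - z * w)) ^ (s + 1) *
        ((w * ((i.choose (s + 1) : R) * w ^ (i - (s + 1))) + (i.choose s : R) * w ^ (i - s)) *
        ((j.choose (s + 1) : R) * z ^ (j - (s + 1)))) +
        w * ∑ s ∈ Finset.range (i + 1), (-(1 - z * w)) ^ (s + 1) *
        (((i.choose (s + 1) : R) * w ^ (i - (s + 1))) *
        (z * ((j.choose (s + 1) : R) * z ^ (j - (s + 1))) + (j.choose s : R) * z ^ (j - s)))
        - z * w * ∑ s ∈ Finset.range (i + 1), (-(1 - z * w)) ^ (s + 1) *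
          ((i.choose (s + 1) : R) * w ^ (i - (s + 1))) *
          ((j.choose (s + 1) : R) * z ^ (j - (s + 1)))
        - (1 - z * w) * ∑ s ∈ Finset.range (i + 1), (-(1 - z * w)) ^ s *
          ((i.choose s : R) * w ^ (i - s)) * ((j.choose s : R) * z ^ (j - s)) := by
      simp only [Finset.mul_sum, ← Finset.sum_add_distrib, ← Finset.sum_sub_distrib]
      apply Finset.sum_congr rfl; intro s _; ring
    simp only [← mul_assoc] at h1 ⊢
    simp only [← mul_assoc] at h0
    simp only [Nat.choose_zero_right, Nat.cast_one, one_mul, mul_one, pow_zero, Nat.sub_zero,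
      pow_succ (_ : R) i, pow_succ (_ : R) j] at *
    linear_combination h1 + (z * w) * h0

end Algebra

/-! ### Disc polynomials of fixed total degree -/

section Chebyshev

/-- The disc polynomials of total degree `m` add up to a Chebyshev polynomial of the second kind:
both sides satisfy the recursion `a (m + 2) = 2u · a (m + 1) - a m`. -/
theorem sum_disc_eq_chebyshev {R : Type*} [CommRing R] {z w u : R} (h : z + w = 2 * u) (m : ℕ) :
    ∑ p ∈ Finset.HasAntidiagonal.antidiagonal m, disc z w p.1 p.2 = (Chebyshev.U R m).eval u := by
  induction m using Nat.twoStepInduction with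
  | zero => simp
  | one =>
    have e : Finset.HasAntidiagonal.antidiagonal 1 = {(0, 1), (1, 0)} := rfl
    rw [e, Finset.sum_pair (by simp), disc_zero_succ, disc_succ_zero]
    simp [← h]
  | more m ih0 ih1 =>
    push_cast
    rw [Chebyshev.U_add_two, eval_sub, eval_mul, ← ih0]
    push_cast at ih1
    rw [← ih1, eval_mul, eval_X, eval_ofNat, ← h]
    -- separate the two axes, on which the recursion has only one term
    have s1 : ∑ p ∈ Finset.HasAntidiagonal.antidiagonal (m + 2), disc z w p.1 p.2 =
        disc z w 0 (m + 2) +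
        (∑ p ∈ Finset.HasAntidiagonal.antidiagonal m, disc z w (p.1 + 1) (p.2 + 1) +
          disc z w (m + 2) 0) := by
      rw [Finset.Nat.sum_antidiagonal_succ, Finset.Nat.sum_antidiagonal_succ',
        add_comm (disc z w ((m + 1, 0).1 + 1, (m + 1, 0).2).1 _)]
    have s2 : ∑ p ∈ Finset.HasAntidiagonal.antidiagonal (m + 1), disc z w p.1 p.2 =
        disc z w 0 (m + 1) +
        ∑ p ∈ Finset.HasAntidiagonal.antidiagonal m, disc z w (p.1 + 1) p.2 := by
      rw [Finset.Nat.sum_antidiagonal_succ]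
    have s3 : ∑ p ∈ Finset.HasAntidiagonal.antidiagonal (m + 1), disc z w p.1 p.2 =
        ∑ p ∈ Finset.HasAntidiagonal.antidiagonal m, disc z w p.1 (p.2 + 1) +
          disc z w (m + 1) 0 := by
      rw [Finset.Nat.sum_antidiagonal_succ', add_comm]
    rw [add_mul, s1]
    nth_rewrite 1 [s2]
    rw [s3, disc_zero_succ _ _ (m + 1), disc_succ_zero _ _ (m + 1)]
    simp only [disc_succ_succ, Finset.sum_sub_distrib, Finset.sum_add_distrib, Finset.mul_sum,
      mul_add]
    ring

theorem abs_chebyshevU_le {x : ℝ} (hx : |x| ≤ 1) (m : ℕ) :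
    |(Chebyshev.U ℝ m).eval x| ≤ m + 1 := by
  induction m with
  | zero => simp
  | succ m ih =>
    push_cast
    rw [Chebyshev.U_eq_X_mul_U_add_T, eval_add, eval_mul, eval_X]
    calc |x * eval x (Chebyshev.U ℝ m) + eval x (Chebyshev.T ℝ (m + 1))|
        ≤ |x| * |eval x (Chebyshev.U ℝ m)| + |eval x (Chebyshev.T ℝ (m + 1))| := by
          rw [← abs_mul]; exact abs_add_le _ _
      _ ≤ 1 * (m + 1) + 1 := by
          gcongr
          exact Chebyshev.abs_eval_T_real_le_one _ hx
      _ = m + 1 + 1 := by ring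

end Chebyshev

/-! ### Disc polynomials on the complex unit disc -/

section Complex

/-- The real part of the disc polynomial at the point `ζ` of the complex plane. -/
def discRe (ζ : ℂ) (i j : ℕ) : ℝ := (disc ζ (conj ζ) i j).re

theorem conj_disc (ζ : ℂ) (i j : ℕ) : conj (disc ζ (conj ζ) i j) = disc ζ (conj ζ) j i := by
  rw [map_disc, Complex.conj_conj, disc_swap]

theorem discRe_swap (ζ : ℂ) (i j : ℕ) : discRe ζ i j = discRe ζ j i := by
  rw [discRe, discRe, ← conj_disc, Complex.conj_re]

theorem discRe_one (i j : ℕ) : discRe 1 i j = 1 := by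
  rw [discRe, map_one, disc_one_one, Complex.one_re]

@[simp] theorem discRe_zero_zero (ζ : ℂ) : discRe ζ 0 0 = 1 := by simp [discRe]

theorem discRe_zero_left (ζ : ℂ) (j : ℕ) : discRe ζ 0 j = (ζ ^ j).re := by
  rw [discRe, disc_zero_left]

theorem sum_discRe (ζ : ℂ) (m : ℕ) :
    ∑ p ∈ Finset.HasAntidiagonal.antidiagonal m, discRe ζ p.1 p.2 =
      (Chebyshev.U ℝ m).eval ζ.re := by
  have h := sum_disc_eq_chebyshev (z := ζ) (w := conj ζ) (u := (ζ.re : ℂ))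
    (by rw [Complex.add_conj]; push_cast; ring) m
  have h2 := congrArg Complex.re h
  rw [Complex.re_sum] at h2
  rw [show ∑ p ∈ Finset.HasAntidiagonal.antidiagonal m, discRe ζ p.1 p.2 =
    ∑ p ∈ Finset.HasAntidiagonal.antidiagonal m, (disc ζ (conj ζ) p.1 p.2).re from rfl, h2]
  have e : Chebyshev.U ℂ m = (Chebyshev.U ℝ m).map Complex.ofRealHom := by
    rw [Chebyshev.map_U]
  rw [e, show (ζ.re : ℂ) = Complex.ofRealHom ζ.re from rfl, eval_map, eval₂_hom]
  rfl

/-- In polar coordinates, the bidegree `(i, j)` carries the Fourier mode `j - i`. -/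
theorem disc_polar (ρ φ : ℝ) (i j : ℕ) :
    disc (ρ * Complex.exp (φ * Complex.I)) (conj (ρ * Complex.exp (φ * Complex.I))) i j =
      Complex.exp (((j : ℤ) - i : ℤ) * (φ * Complex.I)) * disc (ρ : ℂ) ρ i j := by
  have hc : conj (ρ * Complex.exp (φ * Complex.I)) = Complex.exp (-(φ * Complex.I)) * ρ := by
    rw [map_mul, Complex.conj_ofReal, ← Complex.exp_conj]; simp [mul_comm]
  rw [hc, mul_comm, disc_smul _ _ _ _ (by rw [← Complex.exp_add]; simp), ← Complex.exp_nat_mul,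
    ← Complex.exp_nat_mul, ← Complex.exp_add]
  congr 2
  push_cast; ring

theorem integral_exp_int (n : ℤ) : ∫ φ in (0 : ℝ)..2 * π, Complex.exp (n * (φ * Complex.I)) =
    if n = 0 then (2 * π : ℂ) else 0 := by
  split_ifs with h
  · simp [h]
  · have hc : (n * Complex.I : ℂ) ≠ 0 := mul_ne_zero (by exact_mod_cast h) Complex.I_ne_zero
    have e : ∀ φ : ℝ, Complex.exp (n * (φ * Complex.I)) = Complex.exp ((n * Complex.I) * φ) := by
      intro φ; congr 1; ring
    simp_rw [e]
    rw [integral_exp_mul_complex hc]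
    have : Complex.exp (n * Complex.I * ((2 * π : ℝ) : ℂ)) = 1 := by
      rw [Complex.exp_eq_one_iff]; exact ⟨n, by push_cast; ring⟩
    rw [this]; simp

/-- The disc polynomial `D_{i,j}` is a Fourier coefficient of the Chebyshev polynomial
`U_{i+j}(ρ cos φ)`, hence it is bounded by `i + j + 1` on the unit disc. -/
theorem norm_disc_le {ζ : ℂ} (hζ : ‖ζ‖ ≤ 1) (i j : ℕ) : ‖disc ζ (conj ζ) i j‖ ≤ i + j + 1 := by
  set ρ : ℝ := ‖ζ‖
  have hpolar : ζ = ρ * Complex.exp (Complex.arg ζ * Complex.I) :=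
    (Complex.norm_mul_exp_arg_mul_I ζ).symm
  rw [hpolar, disc_polar, norm_mul]
  have h1 : ‖Complex.exp (((j : ℤ) - i : ℤ) * (ζ.arg * Complex.I))‖ = 1 := by
    rw [show (((j : ℤ) - i : ℤ) : ℂ) * (ζ.arg * Complex.I) =
      ((((j : ℤ) - i : ℤ) * ζ.arg : ℝ) : ℂ) * Complex.I by push_cast; ring]
    exact Complex.norm_exp_ofReal_mul_I _
  rw [h1, one_mul]
  set a : ℕ × ℕ → ℂ := fun p => disc (ρ : ℂ) ρ p.1 p.2
  have hU : ∀ φ : ℝ, ∑ p ∈ Finset.HasAntidiagonal.antidiagonal (i + j),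
      Complex.exp (((p.2 : ℤ) - p.1 : ℤ) * (φ * Complex.I)) * a p =
      (Chebyshev.U ℂ (i + j : ℕ)).eval ((ρ * cos φ : ℝ) : ℂ) := by
    intro φ
    rw [← sum_disc_eq_chebyshev (z := ρ * Complex.exp (φ * Complex.I))
      (w := conj (ρ * Complex.exp (φ * Complex.I)))]
    · exact Finset.sum_congr rfl fun p _ => (disc_polar ρ φ p.1 p.2).symm
    · rw [Complex.add_conj]
      rw [Complex.re_ofReal_mul, Complex.exp_ofReal_mul_I_re]
      push_cast; ring
  have hint : ∫ φ in (0 : ℝ)..2 * π, (Chebyshev.U ℂ (i + j : ℕ)).eval ((ρ * cos φ : ℝ) : ℂ) *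
      Complex.exp (((i : ℤ) - j : ℤ) * (φ * Complex.I)) = 2 * π * a (i, j) := by
    simp_rw [← hU, Finset.sum_mul]
    rw [intervalIntegral.integral_finsetSum]
    · have : ∀ p ∈ Finset.HasAntidiagonal.antidiagonal (i + j), ∫ φ in (0 : ℝ)..2 * π,
          Complex.exp (((p.2 : ℤ) - p.1 : ℤ) * (φ * Complex.I)) * a p *
          Complex.exp (((i : ℤ) - j : ℤ) * (φ * Complex.I)) =
          if p = (i, j) then 2 * π * a p else 0 := by
        intro p hp
        have e : ∀ φ : ℝ, Complex.exp (((p.2 : ℤ) - p.1 : ℤ) * (φ * Complex.I)) * a p *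
          Complex.exp (((i : ℤ) - j : ℤ) * (φ * Complex.I)) =
          Complex.exp (((p.2 : ℤ) - p.1 + (i - j) : ℤ) * (φ * Complex.I)) * a p := by
          intro φ
          rw [mul_right_comm, ← Complex.exp_add]; congr 2; push_cast; ring
        simp_rw [e]
        rw [intervalIntegral.integral_mul_const, integral_exp_int]
        rw [Finset.HasAntidiagonal.mem_antidiagonal] at hp
        have : ((p.2 : ℤ) - p.1 + (i - j) = 0) ↔ p = (i, j) := by
          rw [Prod.ext_iff]; simp only; omega
        simp only [this]
        split_ifs <;> simp
      rw [Finset.sum_congr rfl this, Finset.sum_ite_eq']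
      simp
    · intro p _
      apply Continuous.intervalIntegrable
      fun_prop
  have hb : ‖2 * π * a (i, j)‖ ≤ (i + j + 1) * |2 * π - 0| := by
    rw [← hint]
    apply intervalIntegral.norm_integral_le_of_norm_le_const
    intro φ _
    rw [norm_mul, show (((i : ℤ) - j : ℤ) : ℂ) * (φ * Complex.I) =
      ((((i : ℤ) - j : ℤ) * φ : ℝ) : ℂ) * Complex.I by push_cast; ring,
      Complex.norm_exp_ofReal_mul_I, mul_one]
    have e : Chebyshev.U ℂ (i + j : ℕ) = (Chebyshev.U ℝ (i + j : ℕ)).map Complex.ofRealHom := by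
      rw [Chebyshev.map_U]
    rw [e, show ((ρ * cos φ : ℝ) : ℂ) = Complex.ofRealHom (ρ * cos φ) from rfl, eval_map,
      eval₂_hom, Complex.ofRealHom_eq_coe, Complex.norm_real]
    have := abs_chebyshevU_le (x := ρ * cos φ) (by
      rw [abs_mul, abs_of_nonneg (norm_nonneg ζ)]
      exact mul_le_one₀ hζ (abs_nonneg _) (abs_cos_le_one φ)) (i + j)
    push_cast at this
    simpa using this
  rw [norm_mul, norm_mul, Complex.norm_real, Complex.norm_ofNat, Real.norm_eq_abs, sub_zero,
    abs_mul, abs_two, mul_comm] at hb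
  exact le_of_mul_le_mul_right hb (by positivity)

theorem abs_discRe_le {ζ : ℂ} (hζ : ‖ζ‖ ≤ 1) (i j : ℕ) : |discRe ζ i j| ≤ i + j + 1 :=
  (Complex.abs_re_le_norm _).trans (norm_disc_le hζ i j)

@[fun_prop] theorem continuous_disc {X : Type*} [TopologicalSpace X] {f g : X → ℂ}
    (hf : Continuous f) (hg : Continuous g) (i j : ℕ) :
    Continuous fun x => disc (f x) (g x) i j := by
  have : ∀ x, disc (f x) (g x) i j = ∑ s ∈ Finset.range (i + 1), (-(1 - f x * g x)) ^ s *
      ((i.choose s : ℂ) * g x ^ (i - s)) * ((j.choose s : ℂ) * f x ^ (j - s)) :=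
    fun x => disc_eq_sum _ _ (i + 1) i j (Nat.lt_succ_self i)
  simp_rw [this]
  fun_prop

theorem continuous_discRe (i j : ℕ) : Continuous fun ζ => discRe ζ i j := by
  unfold discRe
  exact Complex.continuous_re.comp (continuous_disc continuous_id Complex.continuous_conj i j)

end Complex

/-! ### Jacobi polynomials and the Fourier–Jacobi modes -/

section Jacobi

/-- The Rodrigues formula expanded by the Leibniz rule; the division by `(1 + x)^n` is exact. -/
theorem jacobi_eq_sum (k n : ℕ) : jacobi k n = ∑ s ∈ Finset.range (k + 1),
    C ((-1) ^ s * (k.choose s : ℝ) * ((k + n).choose s : ℝ) / 2 ^ k) *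
      ((1 - X) ^ s * (1 + X) ^ (k - s)) := by
  have hm : ((1 + X : ℝ[X]) ^ n).Monic := by
    have : (1 + X : ℝ[X]).Monic := by
      rw [add_comm]; exact monic_X_add_C (1 : ℝ)
    exact this.pow n
  apply mul_left_cancel₀ hm.ne_zero
  rw [jacobi_rodrigues]
  have e1 : (1 + X : ℝ[X]) ^ n * (1 - X ^ 2) ^ k =
      C ((-1) ^ k) * ((X + C (-1)) ^ k * (X + C 1) ^ (k + n)) := by
    rw [show (1 - X ^ 2 : ℝ[X]) = C (-1) * ((X + C (-1)) * (X + C 1)) by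
      simp only [map_neg, map_one]; ring, mul_pow, mul_pow, pow_add, C_pow]
    simp only [map_neg, map_one]; ring
  rw [e1, iterate_derivative_C_mul, iterate_derivative_mul, Finset.mul_sum, Finset.mul_sum,
    Finset.mul_sum]
  apply Finset.sum_congr rfl
  intro s hs
  have hs' : s ≤ k := Nat.lt_succ_iff.1 (Finset.mem_range.1 hs)
  rw [iterate_derivative_X_add_pow, iterate_derivative_X_add_pow]
  rw [show k - (k - s) = s by omega, show k + n - s = n + (k - s) by omega, pow_add]
  have f1 : (k.descFactorial (k - s) : ℝ) * s.factorial = k.factorial := by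
    have := Nat.factorial_mul_descFactorial (n := k) (k := k - s) (Nat.sub_le _ _)
    rw [show k - (k - s) = s by omega] at this
    rw [mul_comm]; exact_mod_cast this
  have f2 : ((k + n).descFactorial s : ℝ) = s.factorial * (k + n).choose s := by
    exact_mod_cast Nat.descFactorial_eq_factorial_mul_choose (k + n) s
  have f3 : ((-1 : ℝ)) ^ k * (-1) ^ k = 1 := by rw [← mul_pow]; simp
  simp only [nsmul_eq_mul]
  rw [show (X + C (-1) : ℝ[X]) = C (-1) * (1 - X) by simp only [map_neg, map_one]; ring,
    mul_pow, ← C_pow, show (X + C 1 : ℝ[X]) = 1 + X by rw [map_one]; ring]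
  simp only [← C_eq_natCast]
  have key : (-1) ^ k / (2 ^ k * (k.factorial : ℝ)) * ((-1) ^ k * ((k.choose s : ℝ) *
      ((k.descFactorial (k - s) : ℝ) * (-1) ^ s * ((k + n).descFactorial s : ℝ)))) =
      (-1) ^ s * (k.choose s : ℝ) * ((k + n).choose s : ℝ) / 2 ^ k := by
    rw [f2, ← f1]
    have h1 : (k.descFactorial (k - s) : ℝ) ≠ 0 := by
      intro h0; rw [h0, zero_mul] at f1; exact k.factorial_ne_zero (by exact_mod_cast f1.symm)
    have h2 : (s.factorial : ℝ) ≠ 0 := by exact_mod_cast s.factorial_ne_zero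
    field_simp
    linear_combination ((k.choose s : ℝ) * ((k + n).choose s : ℝ)) * f3
  rw [← key]
  simp only [map_mul, map_natCast]
  ring

/-- In the coordinate `x = cos r` the Jacobi polynomials `P_k^{0,n}(cos 2r)` are the disc
polynomials of bidegree `(k, k + n)`. -/
theorem disc_eq_jacobi (k n : ℕ) (x : ℝ) :
    disc x x k (k + n) = x ^ n * (jacobi k n).eval (2 * x ^ 2 - 1) := by
  rw [disc_eq_sum x x (k + 1) k (k + n) (Nat.lt_succ_self k), jacobi_eq_sum, eval_finsetSum,
    Finset.mul_sum]
  apply Finset.sum_congr rfl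
  intro s hs
  have hs' : s ≤ k := Nat.lt_succ_iff.1 (Finset.mem_range.1 hs)
  simp only [eval_mul, eval_C, eval_pow, eval_sub, eval_one, eval_X, eval_add]
  rw [show 1 - (2 * x ^ 2 - 1) = 2 * (1 - x * x) by ring, show 1 + (2 * x ^ 2 - 1) = 2 * x ^ 2 by
    ring, show k + n - s = n + (k - s) by omega, neg_pow, mul_pow, mul_pow, pow_add]
  have : (2 : ℝ) ^ k = 2 ^ s * 2 ^ (k - s) := by rw [← pow_add]; congr 1; omega
  rw [this]
  field_simp
  ring

/-- The bijection between the indices `(n, k)` of the Fourier–Jacobi modes and the bidegrees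
`(i, j)` of the disc polynomials: `n = j - i` and `k = min i j`. -/
def modeEquiv : ℤ × ℕ ≃ ℕ × ℕ where
  toFun p := (p.2 + (-p.1).toNat, p.2 + p.1.toNat)
  invFun q := ((q.2 : ℤ) - q.1, min q.1 q.2)
  left_inv p := by ext <;> simp only <;> omega
  right_inv q := by ext <;> simp only <;> omega

/-- The complex coordinate `ζ = cos r · e^{iθ}` in the unit disc. -/
def zeta (r θ : ℝ) : ℂ := cos r * Complex.exp (θ * Complex.I)

theorem zeta_re (r θ : ℝ) : (zeta r θ).re = cos r * cos θ := by
  rw [zeta, Complex.re_ofReal_mul, Complex.exp_ofReal_mul_I_re]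

theorem norm_zeta (r θ : ℝ) : ‖zeta r θ‖ = |cos r| := by
  rw [zeta, norm_mul, Complex.norm_exp_ofReal_mul_I, mul_one, Complex.norm_real, Real.norm_eq_abs]

theorem norm_zeta_le (r θ : ℝ) : ‖zeta r θ‖ ≤ 1 := by
  rw [norm_zeta]; exact abs_cos_le_one r

/-- The Fourier–Jacobi mode `e^{inθ} Φ_{k,n}(r)` is a weighted disc polynomial in `ζ`. -/
theorem exp_mul_phi (n : ℤ) (k : ℕ) (r θ : ℝ) :
    Complex.exp (Complex.I * n * θ) * (phi k n r : ℂ) =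
      (((modeEquiv (n, k)).1 + (modeEquiv (n, k)).2 + 1 : ℕ) : ℂ) *
      disc (zeta r θ) (conj (zeta r θ)) (modeEquiv (n, k)).1 (modeEquiv (n, k)).2 := by
  have hmap : ∀ i j, disc ((cos r : ℝ) : ℂ) ((cos r : ℝ) : ℂ) i j =
      ((disc (cos r) (cos r) i j : ℝ) : ℂ) := fun i j => (map_disc _ _ Complex.ofRealHom i j).symm
  rw [zeta, disc_polar, hmap]
  have hcos : cos (2 * r) = 2 * cos r ^ 2 - 1 := cos_two_mul r
  have hd : disc (cos r) (cos r) (modeEquiv (n, k)).1 (modeEquiv (n, k)).2 =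
      cos r ^ n.natAbs * (jacobi k n.natAbs).eval (cos (2 * r)) := by
    rw [hcos, ← disc_eq_jacobi]
    simp only [modeEquiv, Equiv.coe_fn_mk]
    rcases le_total 0 n with h | h
    · rw [show (-n).toNat = 0 by omega, show n.toNat = n.natAbs by omega]; rfl
    · rw [show n.toNat = 0 by omega, show (-n).toNat = n.natAbs by omega, disc_swap]; rfl
  rw [hd, phi]
  have hw : (((modeEquiv (n, k)).1 + (modeEquiv (n, k)).2 + 1 : ℕ) : ℂ) =
      2 * k + n.natAbs + 1 := by
    have : (modeEquiv (n, k)).1 + (modeEquiv (n, k)).2 + 1 = 2 * k + n.natAbs + 1 := by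
      simp only [modeEquiv, Equiv.coe_fn_mk]; omega
    rw [this]; push_cast; ring
  have he : (((modeEquiv (n, k)).2 : ℤ) - (modeEquiv (n, k)).1 : ℤ) = n := by
    simp only [modeEquiv, Equiv.coe_fn_mk]; omega
  rw [hw, he]
  rw [show Complex.I * n * θ = n * (θ * Complex.I) by ring]
  push_cast
  ring

/-- The eigenvalue of the mode `(i, j)` for the negative subelliptic Laplacian. -/
def lam (i j : ℕ) : ℝ := 4 * i * j + 2 * i + 2 * j

theorem subEigenvalue_eq (n : ℤ) (k : ℕ) :
    subEigenvalue k n = -lam (modeEquiv (n, k)).1 (modeEquiv (n, k)).2 := by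
  simp only [subEigenvalue, lam, modeEquiv, Equiv.coe_fn_mk]
  rcases le_total 0 n with h | h
  · rw [show (-n).toNat = 0 by omega, show n.toNat = n.natAbs by omega]; push_cast; ring
  · rw [show n.toNat = 0 by omega, show (-n).toNat = n.natAbs by omega]; push_cast; ring

theorem riemEigenvalue_eq (n : ℤ) (k : ℕ) : riemEigenvalue k n =
    -((((modeEquiv (n, k)).1 + (modeEquiv (n, k)).2 : ℕ) : ℝ) *
      (((modeEquiv (n, k)).1 + (modeEquiv (n, k)).2 : ℕ) + 2)) := by
  have hn : (n : ℝ) ^ 2 = (n.natAbs : ℝ) ^ 2 := by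
    rw [Nat.cast_natAbs, Int.cast_abs, sq_abs]
  simp only [riemEigenvalue, modeEquiv, Equiv.coe_fn_mk, hn]
  rcases le_total 0 n with h | h
  · rw [show (-n).toNat = 0 by omega, show n.toNat = n.natAbs by omega]; push_cast; ring
  · rw [show n.toNat = 0 by omega, show (-n).toNat = n.natAbs by omega]; push_cast; ring

end Jacobi

/-! ### The generator on the disc -/

section Generator

/-- The generator `4(1 - zw) ∂_z ∂_w - 2z ∂_z - 2w ∂_w` as an operator on polynomials in two
variables.  For `w` the conjugate of `z` it is `div ((1 - |z|²) ∇)`. -/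
def gen (P : MvPolynomial (Fin 2) ℂ) : MvPolynomial (Fin 2) ℂ :=
  4 * (1 - MvPolynomial.X 0 * MvPolynomial.X 1) *
      MvPolynomial.pderiv 0 (MvPolynomial.pderiv 1 P) -
    2 * MvPolynomial.X 0 * MvPolynomial.pderiv 0 P - 2 * MvPolynomial.X 1 * MvPolynomial.pderiv 1 P

/-- The disc polynomials as formal polynomials. -/
def discPoly (i j : ℕ) : MvPolynomial (Fin 2) ℂ := disc (MvPolynomial.X 0) (MvPolynomial.X 1) i j

theorem eval_discPoly (z w : ℂ) (i j : ℕ) :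
    MvPolynomial.eval ![z, w] (discPoly i j) = disc z w i j := by
  rw [discPoly, map_disc]; simp

theorem pderiv_X_zero_one :
    MvPolynomial.pderiv 1 (MvPolynomial.X 0 : MvPolynomial (Fin 2) ℂ) = 0 :=
  MvPolynomial.pderiv_X_of_ne (by decide)

theorem pderiv_X_one_zero :
    MvPolynomial.pderiv 0 (MvPolynomial.X 1 : MvPolynomial (Fin 2) ℂ) = 0 :=
  MvPolynomial.pderiv_X_of_ne (by decide)

theorem discPoly_succ (i j : ℕ) : ((j + 1 : ℕ) : MvPolynomial (Fin 2) ℂ) * discPoly i (j + 1) =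
    ((i + j + 1 : ℕ) : MvPolynomial (Fin 2) ℂ) * (MvPolynomial.X 0 * discPoly i j) -
      (i : MvPolynomial (Fin 2) ℂ) * discPoly (i - 1) j := by
  rw [discPoly, discPoly, discPoly, mul_disc]; ring

theorem pderiv_natCast_mul (k : Fin 2) (n : ℕ) (P : MvPolynomial (Fin 2) ℂ) :
    MvPolynomial.pderiv k ((n : MvPolynomial (Fin 2) ℂ) * P) = n * MvPolynomial.pderiv k P := by
  rw [← nsmul_eq_mul, map_nsmul, nsmul_eq_mul]

/-- The lowering relation `(1 - zw) ∂_w D_{i,j} = i (D_{i-1,j} - z D_{i,j})`. -/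
theorem pderiv_one_discPoly (i j : ℕ) :
    (1 - MvPolynomial.X 0 * MvPolynomial.X 1) * MvPolynomial.pderiv 1 (discPoly i j) =
      (i : MvPolynomial (Fin 2) ℂ) * (discPoly (i - 1) j - MvPolynomial.X 0 * discPoly i j) := by
  induction j generalizing i with
  | zero =>
    rw [discPoly, discPoly, disc_zero_right, disc_zero_right, Derivation.leibniz_pow,
      MvPolynomial.pderiv_X_self]
    rcases i with _ | i
    · simp
    · simp only [Nat.add_sub_cancel, smul_eq_mul, nsmul_eq_mul]; ring
  | succ j ih =>
    have hne : ((j + 1 : ℕ) : MvPolynomial (Fin 2) ℂ) ≠ 0 := by exact_mod_cast Nat.succ_ne_zero j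
    apply mul_left_cancel₀ hne
    have h1 := congrArg (MvPolynomial.pderiv 1) (discPoly_succ i j)
    rw [map_sub, pderiv_natCast_mul, pderiv_natCast_mul, pderiv_natCast_mul, Derivation.leibniz,
      pderiv_X_zero_one, smul_zero, add_zero, smul_eq_mul] at h1
    have h2 := discPoly_succ i j
    have h3 := ih i
    rcases i with _ | i
    · push_cast at *
      linear_combination (1 - MvPolynomial.X 0 * MvPolynomial.X 1) * h1 +
        (j + 1) * MvPolynomial.X 0 * h3
    · have h4 := ih i
      have h5 := discPoly_succ i j
      rw [Nat.add_sub_cancel] at *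
      push_cast at *
      linear_combination (1 - MvPolynomial.X 0 * MvPolynomial.X 1) * h1 +
        ((i : MvPolynomial (Fin 2) ℂ) + 1 + j + 1) * MvPolynomial.X 0 * h3 - (i + 1) * h4 -
        (i + 1) * h5 + (i + 1) * MvPolynomial.X 0 * h2

theorem gen_X_mul (P : MvPolynomial (Fin 2) ℂ) : gen (MvPolynomial.X 0 * P) =
    MvPolynomial.X 0 * gen P - 2 * (MvPolynomial.X 0 * P) +
      4 * ((1 - MvPolynomial.X 0 * MvPolynomial.X 1) * MvPolynomial.pderiv 1 P) := by
  simp only [gen, Derivation.leibniz, pderiv_X_zero_one, MvPolynomial.pderiv_X_self, smul_eq_mul,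
    mul_zero, add_zero, mul_one]
  ring

theorem gen_natCast_mul (n : ℕ) (P : MvPolynomial (Fin 2) ℂ) :
    gen ((n : MvPolynomial (Fin 2) ℂ) * P) = n * gen P := by
  simp only [gen, pderiv_natCast_mul]; ring

theorem gen_sub (P Q : MvPolynomial (Fin 2) ℂ) : gen (P - Q) = gen P - gen Q := by
  simp only [gen, map_sub]; ring

/-- The disc polynomials are eigenfunctions of the generator. -/
theorem gen_discPoly (i j : ℕ) :
    gen (discPoly i j) = -((4 * i * j + 2 * i + 2 * j : ℕ) : MvPolynomial (Fin 2) ℂ) *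
      discPoly i j := by
  induction j generalizing i with
  | zero =>
    simp only [gen, discPoly, disc_zero_right, Derivation.leibniz_pow, MvPolynomial.pderiv_X_self,
      pderiv_X_one_zero]
    rcases i with _ | i
    · simp
    · simp [pow_succ]; ring
  | succ j ih =>
    have hne : ((j + 1 : ℕ) : MvPolynomial (Fin 2) ℂ) ≠ 0 := by exact_mod_cast Nat.succ_ne_zero j
    apply mul_left_cancel₀ hne
    have h1 := congrArg gen (discPoly_succ i j)
    rw [gen_sub, gen_natCast_mul, gen_natCast_mul, gen_natCast_mul, gen_X_mul,
      pderiv_one_discPoly, ih i, ih (i - 1)] at h1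
    have h2 := discPoly_succ i j
    rcases i with _ | i
    · push_cast at *
      linear_combination h1 + (2 * (j + 1)) * h2
    · rw [Nat.add_sub_cancel] at *
      push_cast at *
      linear_combination h1 + (4 * ((i : MvPolynomial (Fin 2) ℂ) + 1) * (j + 1) + 2 * (i + 1) +
        2 * (j + 1)) * h2

theorem hasDerivAt_eval {z w : ℝ → ℂ} {z' w' : ℂ} {ε : ℝ} (hz : HasDerivAt z z' ε)
    (hw : HasDerivAt w w' ε) (P : MvPolynomial (Fin 2) ℂ) :
    HasDerivAt (fun ε => MvPolynomial.eval ![z ε, w ε] P)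
      (z' * MvPolynomial.eval ![z ε, w ε] (MvPolynomial.pderiv 0 P) +
        w' * MvPolynomial.eval ![z ε, w ε] (MvPolynomial.pderiv 1 P)) ε := by
  induction P using MvPolynomial.induction_on with
  | C a => simpa using hasDerivAt_const ε a
  | add p q hp hq =>
    simp only [map_add]
    exact (hp.add hq).congr_deriv (by ring)
  | mul_X p k hp =>
    fin_cases k
    · simp only [Fin.zero_eta, map_mul, MvPolynomial.eval_X, Matrix.cons_val_zero]
      refine (hp.mul hz).congr_deriv ?_
      simp only [Derivation.leibniz, pderiv_X_zero_one, MvPolynomial.pderiv_X_self, smul_eq_mul,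
        map_add, map_mul, MvPolynomial.eval_X, Matrix.cons_val_zero, map_one, map_zero]
      ring
    · simp only [Fin.mk_one, map_mul, MvPolynomial.eval_X, Matrix.cons_val_one]
      refine (hp.mul hw).congr_deriv ?_
      simp only [Derivation.leibniz, pderiv_X_one_zero, MvPolynomial.pderiv_X_self, smul_eq_mul,
        map_add, map_mul, MvPolynomial.eval_X, Matrix.cons_val_one, Matrix.cons_val_fin_one,
        map_one, map_zero]
      ring

/-- The curve `ζ cos ε + √(1 - |ζ|²) ω sin ε` through `ζ`; it stays in the unit disc
for `|ω| = 1`. -/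
def curve (ζ ω : ℂ) (ε : ℝ) : ℂ := cos ε * ζ + sin ε * (√(1 - ‖ζ‖ ^ 2) * ω)

theorem curve_zero (ζ ω : ℂ) : curve ζ ω 0 = ζ := by simp [curve]

theorem norm_curve_le {ζ ω : ℂ} (hζ : ‖ζ‖ ≤ 1) (hω : ‖ω‖ = 1) (ε : ℝ) : ‖curve ζ ω ε‖ ≤ 1 := by
  have hs : 0 ≤ 1 - ‖ζ‖ ^ 2 := by nlinarith [norm_nonneg ζ]
  set s := √(1 - ‖ζ‖ ^ 2)
  have hs2 : s ^ 2 = 1 - ‖ζ‖ ^ 2 := sq_sqrt hs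
  have hs0 : 0 ≤ s := sqrt_nonneg _
  have h1 : ‖curve ζ ω ε‖ ≤ |cos ε| * ‖ζ‖ + |sin ε| * s := by
    refine (norm_add_le _ _).trans (le_of_eq ?_)
    rw [norm_mul, norm_mul, norm_mul, hω, Complex.norm_real, Complex.norm_real, Complex.norm_real,
      Real.norm_eq_abs, Real.norm_eq_abs, Real.norm_eq_abs, abs_of_nonneg hs0, mul_one]
  have h2 : (|cos ε| * ‖ζ‖ + |sin ε| * s) ^ 2 ≤ 1 := by
    have := sin_sq_add_cos_sq ε
    nlinarith [sq_nonneg (|cos ε| * s - |sin ε| * ‖ζ‖), sq_abs (cos ε), sq_abs (sin ε)]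
  exact h1.trans (by nlinarith [sq_nonneg (|cos ε| * ‖ζ‖ + |sin ε| * s - 1)])

theorem hasDerivAt_curve (ζ ω : ℂ) (ε : ℝ) :
    HasDerivAt (curve ζ ω) (-(sin ε : ℂ) * ζ + cos ε * (√(1 - ‖ζ‖ ^ 2) * ω)) ε := by
  have h1 : HasDerivAt (fun ε : ℝ => ((cos ε : ℝ) : ℂ)) ((-sin ε : ℝ) : ℂ) ε :=
    (hasDerivAt_cos ε).ofReal_comp
  have h2 : HasDerivAt (fun ε : ℝ => ((sin ε : ℝ) : ℂ)) ((cos ε : ℝ) : ℂ) ε :=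
    (hasDerivAt_sin ε).ofReal_comp
  exact ((h1.mul_const ζ).add (h2.mul_const (√(1 - ‖ζ‖ ^ 2) * ω))).congr_deriv
    (by push_cast; ring)

theorem hasDerivAt_curve' (ζ ω : ℂ) (ε : ℝ) :
    HasDerivAt (fun ε : ℝ => -(sin ε : ℂ) * ζ + cos ε * (√(1 - ‖ζ‖ ^ 2) * ω))
      (-curve ζ ω ε) ε := by
  have h1 : HasDerivAt (fun ε : ℝ => ((cos ε : ℝ) : ℂ)) ((-sin ε : ℝ) : ℂ) ε :=
    (hasDerivAt_cos ε).ofReal_comp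
  have h2 : HasDerivAt (fun ε : ℝ => ((sin ε : ℝ) : ℂ)) ((cos ε : ℝ) : ℂ) ε :=
    (hasDerivAt_sin ε).ofReal_comp
  have h3 : HasDerivAt (fun ε : ℝ => -((sin ε : ℝ) : ℂ) * ζ +
      ((cos ε : ℝ) : ℂ) * (√(1 - ‖ζ‖ ^ 2) * ω)) (-curve ζ ω ε) ε :=
    ((h2.neg.mul_const ζ).add (h1.mul_const (√(1 - ‖ζ‖ ^ 2) * ω))).congr_deriv
      (by simp only [curve]; push_cast; ring)
  simpa using h3

theorem hasDerivAt_conj {z : ℝ → ℂ} {z' : ℂ} {ε : ℝ} (h : HasDerivAt z z' ε) :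
    HasDerivAt (fun ε => conj (z ε)) (conj z') ε :=
  (Complex.conjCLE.toContinuousLinearMap.hasFDerivAt.comp_hasDerivAt ε h)

/-- The derivative of a polynomial along a curve of the disc. -/
def curveDeriv (P : MvPolynomial (Fin 2) ℂ) (ζ ω : ℂ) (ε : ℝ) : ℂ :=
  (-(sin ε : ℂ) * ζ + cos ε * (√(1 - ‖ζ‖ ^ 2) * ω)) *
      MvPolynomial.eval ![curve ζ ω ε, conj (curve ζ ω ε)] (MvPolynomial.pderiv 0 P) +
    conj (-(sin ε : ℂ) * ζ + cos ε * (√(1 - ‖ζ‖ ^ 2) * ω)) *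
      MvPolynomial.eval ![curve ζ ω ε, conj (curve ζ ω ε)] (MvPolynomial.pderiv 1 P)

theorem hasDerivAt_eval_curve (P : MvPolynomial (Fin 2) ℂ) (ζ ω : ℂ) (ε : ℝ) :
    HasDerivAt (fun ε => MvPolynomial.eval ![curve ζ ω ε, conj (curve ζ ω ε)] P)
      (curveDeriv P ζ ω ε) ε :=
  hasDerivAt_eval (hasDerivAt_curve ζ ω ε) (hasDerivAt_conj (hasDerivAt_curve ζ ω ε)) P

/-- The generator is the sum of the second derivatives along the two curves with `ω = 1` and
`ω = i`. -/
theorem hasDerivAt_curveDeriv {ζ : ℂ} (hζ : ‖ζ‖ ≤ 1) (P : MvPolynomial (Fin 2) ℂ) :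
    ∃ a b : ℂ, HasDerivAt (curveDeriv P ζ 1) a 0 ∧ HasDerivAt (curveDeriv P ζ Complex.I) b 0 ∧
      a + b = MvPolynomial.eval ![ζ, conj ζ] (gen P) := by
  have key : ∀ ω : ℂ, HasDerivAt (curveDeriv P ζ ω) _ 0 := fun ω =>
    ((hasDerivAt_curve' ζ ω 0).mul
      (hasDerivAt_eval_curve (MvPolynomial.pderiv 0 P) ζ ω 0)).add
    ((hasDerivAt_conj (hasDerivAt_curve' ζ ω 0)).mul
      (hasDerivAt_eval_curve (MvPolynomial.pderiv 1 P) ζ ω 0))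
  refine ⟨_, _, key 1, key Complex.I, ?_⟩
  have hs : 0 ≤ 1 - ‖ζ‖ ^ 2 := by nlinarith [norm_nonneg ζ]
  set s := √(1 - ‖ζ‖ ^ 2) with hsdef
  have hs2 : (s : ℂ) * s = 1 - ζ * conj ζ := by
    rw [Complex.mul_conj, Complex.normSq_eq_norm_sq, ← Complex.ofReal_mul, ← sq, hsdef, sq_sqrt hs]
    push_cast; ring
  have hcomm : MvPolynomial.pderiv 1 (MvPolynomial.pderiv 0 P) =
      MvPolynomial.pderiv 0 (MvPolynomial.pderiv 1 P) := by
    have : ⁅(MvPolynomial.pderiv 1 : Derivation ℂ (MvPolynomial (Fin 2) ℂ) _),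
        (MvPolynomial.pderiv 0 : Derivation ℂ (MvPolynomial (Fin 2) ℂ) _)⁆ = 0 := by
      apply MvPolynomial.derivation_ext
      intro k
      rw [Derivation.commutator_apply]
      fin_cases k <;> simp
    have h := congrArg (fun d => d P) this
    rw [Derivation.commutator_apply] at h
    exact sub_eq_zero.1 h
  simp only [curveDeriv, curve_zero, ← hsdef, sin_zero, cos_zero, Complex.ofReal_zero,
    Complex.ofReal_one, neg_zero, zero_mul, zero_add, one_mul, mul_one, map_neg, map_mul,
    Complex.conj_ofReal, Complex.conj_I, map_one, gen, map_sub, MvPolynomial.eval_X,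
    Matrix.cons_val_zero, Matrix.cons_val_one, map_ofNat, hcomm]
  linear_combination (MvPolynomial.eval ![ζ, conj ζ]
    (MvPolynomial.pderiv 0 (MvPolynomial.pderiv 1 P)) * (2 - 2 * Complex.I ^ 2)) * hs2 +
    (MvPolynomial.eval ![ζ, conj ζ] (MvPolynomial.pderiv 0 (MvPolynomial.pderiv 0 P)) * s ^ 2 +
    MvPolynomial.eval ![ζ, conj ζ] (MvPolynomial.pderiv 1 (MvPolynomial.pderiv 1 P)) * s ^ 2
    - 2 * (1 - ζ * conj ζ) * MvPolynomial.eval ![ζ, conj ζ]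
    (MvPolynomial.pderiv 0 (MvPolynomial.pderiv 1 P))) * Complex.I_sq

end Generator

/-! ### The maximum principle on the disc -/

section MaximumPrinciple

/-- The abstract parabolic maximum principle, for finite sums of eigenfunctions on a compact set. -/
theorem heat_nonneg {X ι : Type*} [TopologicalSpace X] {K : Set X} (hK : IsCompact K)
    (s : Finset ι) {φ : ι → X → ℝ} (hφ : ∀ a, Continuous (φ a)) {l : ι → ℝ}
    (hmin : ∀ c : ι → ℝ, ∀ x ∈ K, (∀ y ∈ K, ∑ a ∈ s, c a * φ a x ≤ ∑ a ∈ s, c a * φ a y) →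
      ∑ a ∈ s, c a * (l a * φ a x) ≤ 0)
    (c : ι → ℝ) (h0 : ∀ x ∈ K, 0 ≤ ∑ a ∈ s, c a * φ a x) {t : ℝ} (ht : 0 ≤ t) {x : X}
    (hx : x ∈ K) : 0 ≤ ∑ a ∈ s, c a * rexp (-l a * t) * φ a x := by
  set F : ℝ → X → ℝ := fun t x => ∑ a ∈ s, c a * rexp (-l a * t) * φ a x with hF
  have main : ∀ ε : ℝ, 0 < ε → 0 ≤ F t x + ε * t := by
    intro ε hε
    have hcont : Continuous fun p : ℝ × X => F p.1 p.2 + ε * p.1 := by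
      simp only [hF]
      have := fun a => (hφ a).comp (continuous_snd (X := ℝ))
      simp only [Function.comp_def] at this
      fun_prop
    obtain ⟨⟨t₀, x₀⟩, ⟨ht₀, hx₀⟩, hm⟩ := (isCompact_Icc.prod hK).exists_isMinOn
      (s := Icc 0 t ×ˢ K) ⟨(0, x), ⟨⟨le_rfl, ht⟩, hx⟩⟩ hcont.continuousOn
    have ht₀ : t₀ ∈ Icc 0 t := ht₀
    have hm' : ∀ t' ∈ Icc 0 t, ∀ y ∈ K, F t₀ x₀ + ε * t₀ ≤ F t' y + ε * t' :=
      fun t' ht' y hy => hm (Set.mk_mem_prod ht' hy)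
    have h1 : 0 ≤ F t₀ x₀ + ε * t₀ := by
      rcases ht₀.1.eq_or_lt with h | h
      · have e : F t₀ x₀ = ∑ a ∈ s, c a * φ a x₀ := by
          simp only [hF, ← h, mul_zero, exp_zero, mul_one]
        rw [e, ← h, mul_zero, add_zero]; exact h0 x₀ hx₀
      · -- at a minimum with `t₀ > 0` the time derivative is at least `ε`
        exfalso
        have hL : ∑ a ∈ s, (c a * rexp (-l a * t₀)) * (l a * φ a x₀) ≤ 0 := by
          apply hmin _ x₀ hx₀
          intro y hy
          have := hm' t₀ ht₀ y hy
          simp only [hF] at this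
          linarith
        have hd : HasDerivAt (fun t => F t x₀ + ε * t)
            (∑ a ∈ s, c a * (rexp (-l a * t₀) * (-l a)) * φ a x₀ + ε) t₀ := by
          apply HasDerivAt.add
          · apply HasDerivAt.fun_sum
            intro a _
            apply HasDerivAt.mul_const
            apply HasDerivAt.const_mul
            simpa using ((hasDerivAt_id t₀).const_mul (-l a)).exp
          · simpa using (hasDerivAt_id t₀).const_mul ε
        have hpos : 0 < ∑ a ∈ s, c a * (rexp (-l a * t₀) * (-l a)) * φ a x₀ + ε := by
          have : ∑ a ∈ s, c a * (rexp (-l a * t₀) * (-l a)) * φ a x₀ =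
              -∑ a ∈ s, (c a * rexp (-l a * t₀)) * (l a * φ a x₀) := by
            rw [← Finset.sum_neg_distrib]
            exact Finset.sum_congr rfl fun a _ => by ring
          rw [this]; linarith
        have hsl := (hasDerivAt_iff_tendsto_slope.1 hd).eventually (lt_mem_nhds hpos)
        have hsl2 : ∀ᶠ t' in 𝓝[<] t₀, 0 < slope (fun t => F t x₀ + ε * t) t₀ t' :=
          hsl.filter_mono (nhdsWithin_mono _ fun y hy => ne_of_lt hy)
        have h3 : ∀ᶠ t' in 𝓝[<] t₀, t' ∈ Ioo 0 t₀ := Ioo_mem_nhdsLT h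
        obtain ⟨t', h4, h5⟩ := (hsl2.and h3).exists
        have h6 := hm' t' ⟨h5.1.le, h5.2.le.trans ht₀.2⟩ x₀ hx₀
        rw [slope_def_field] at h4
        have h7 := (div_pos_iff.1 h4)
        rcases h7 with h7 | h7
        · linarith [h7.2, h5.2]
        · linarith [h7.1]
    have := hm' t ⟨ht, le_rfl⟩ x hx
    linarith
  have hlim : Tendsto (fun ε : ℝ => F t x + ε * t) (𝓝[>] 0) (𝓝 (F t x + 0 * t)) := by
    apply Tendsto.mono_left _ nhdsWithin_le_nhds
    exact (continuous_const.add (continuous_id.mul continuous_const)).tendsto 0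
  rw [zero_mul, add_zero] at hlim
  exact ge_of_tendsto hlim (eventually_nhdsWithin_of_forall fun ε hε => main ε hε)

/-- A function with a global minimum at `0` has non-negative second derivative there. -/
theorem second_deriv_nonneg {g g' : ℝ → ℝ} {a : ℝ} (hg : ∀ ε, HasDerivAt g (g' ε) ε)
    (hg' : HasDerivAt g' a 0) (hmin : IsLocalMin g 0) : 0 ≤ a := by
  by_contra! ha
  have e : deriv g = g' := funext fun ε => (hg ε).deriv
  have hd : deriv g 0 = 0 := hmin.deriv_eq_zero
  have hmax : IsLocalMax g 0 := isLocalMax_of_deriv_deriv_neg (by rw [e, hg'.deriv]; exact ha) hd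
    (hg 0).continuousAt
  have hconst : g =ᶠ[𝓝 0] fun _ => g 0 := by
    filter_upwards [hmin, hmax] with x h1 h2 using le_antisymm h2 h1
  have h1 : deriv g =ᶠ[𝓝 0] fun _ => 0 := by
    have := hconst.deriv
    simpa using this
  have h2 : deriv (deriv g) 0 = 0 := by rw [h1.deriv_eq]; simp
  rw [e, hg'.deriv] at h2
  exact ha.ne h2

theorem lam_eq (i j : ℕ) : ((4 * i * j + 2 * i + 2 * j : ℕ) : ℂ) = (lam i j : ℂ) := by
  rw [lam]; push_cast; ring

/-- Second derivatives of combinations of disc polynomials along the two curves. -/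
theorem exists_curve_deriv (s : Finset (ℕ × ℕ)) (c : ℕ × ℕ → ℝ) {ζ : ℂ} (hζ : ‖ζ‖ ≤ 1) :
    ∃ (g₁ g₂ : ℝ → ℝ) (a b : ℝ),
      (∀ ε, HasDerivAt (fun ε => ∑ p ∈ s, c p * discRe (curve ζ 1 ε) p.1 p.2) (g₁ ε) ε) ∧
      (∀ ε, HasDerivAt (fun ε => ∑ p ∈ s, c p * discRe (curve ζ Complex.I ε) p.1 p.2) (g₂ ε) ε) ∧
      HasDerivAt g₁ a 0 ∧ HasDerivAt g₂ b 0 ∧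
      a + b = -∑ p ∈ s, c p * (lam p.1 p.2 * discRe ζ p.1 p.2) := by
  set P : MvPolynomial (Fin 2) ℂ := ∑ p ∈ s, MvPolynomial.C (c p : ℂ) * discPoly p.1 p.2
  have hev : ∀ z w, MvPolynomial.eval ![z, w] P = ∑ p ∈ s, (c p : ℂ) * disc z w p.1 p.2 := by
    intro z w
    simp only [P, map_sum, map_mul, MvPolynomial.eval_C, eval_discPoly]
  have hre : ∀ z, (MvPolynomial.eval ![z, conj z] P).re = ∑ p ∈ s, c p * discRe z p.1 p.2 := by
    intro z
    rw [hev, Complex.re_sum]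
    exact Finset.sum_congr rfl fun p _ => by rw [Complex.re_ofReal_mul]; rfl
  have hgen : gen P = ∑ p ∈ s, MvPolynomial.C (c p : ℂ) * gen (discPoly p.1 p.2) := by
    have h1 : ∀ k : Fin 2, MvPolynomial.pderiv k P =
        ∑ p ∈ s, MvPolynomial.C (c p : ℂ) * MvPolynomial.pderiv k (discPoly p.1 p.2) := by
      intro k
      simp only [P, map_sum, MvPolynomial.pderiv_C_mul]
    simp only [gen, h1, map_sum, MvPolynomial.pderiv_C_mul, Finset.mul_sum,
      ← Finset.sum_sub_distrib]
    exact Finset.sum_congr rfl fun p _ => by ring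
  have hgenre : (MvPolynomial.eval ![ζ, conj ζ] (gen P)).re =
      -∑ p ∈ s, c p * (lam p.1 p.2 * discRe ζ p.1 p.2) := by
    rw [hgen, map_sum, Complex.re_sum, ← Finset.sum_neg_distrib]
    refine Finset.sum_congr rfl fun p _ => ?_
    rw [gen_discPoly, map_mul, map_mul, MvPolynomial.eval_C, eval_discPoly, map_neg, map_natCast,
      lam_eq, ← Complex.ofReal_neg, Complex.re_ofReal_mul, Complex.re_ofReal_mul, discRe]
    ring
  obtain ⟨a, b, ha, hb, hab⟩ := hasDerivAt_curveDeriv hζ P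
  have hreal : ∀ {f : ℝ → ℂ} {f' : ℂ} {ε : ℝ}, HasDerivAt f f' ε →
      HasDerivAt (fun ε => (f ε).re) f'.re ε := fun h =>
    (Complex.reCLM.hasFDerivAt.comp_hasDerivAt _ h)
  refine ⟨fun ε => (curveDeriv P ζ 1 ε).re, fun ε => (curveDeriv P ζ Complex.I ε).re, a.re, b.re,
    fun ε => ?_, fun ε => ?_, hreal ha, hreal hb, ?_⟩
  · simp_rw [← hre]; exact hreal (hasDerivAt_eval_curve P ζ 1 ε)
  · simp_rw [← hre]; exact hreal (hasDerivAt_eval_curve P ζ Complex.I ε)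
  · rw [← hgenre, ← hab, Complex.add_re]

/-- The subelliptic heat semigroup preserves non-negativity on the unit disc. -/
theorem disc_heat_nonneg (s : Finset (ℕ × ℕ)) (c : ℕ × ℕ → ℝ)
    (h0 : ∀ ζ : ℂ, ‖ζ‖ ≤ 1 → 0 ≤ ∑ p ∈ s, c p * discRe ζ p.1 p.2) {t : ℝ} (ht : 0 ≤ t) {ζ : ℂ}
    (hζ : ‖ζ‖ ≤ 1) : 0 ≤ ∑ p ∈ s, c p * rexp (-lam p.1 p.2 * t) * discRe ζ p.1 p.2 := by
  refine heat_nonneg (isCompact_closedBall (0 : ℂ) 1) s (φ := fun p ζ => discRe ζ p.1 p.2)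
    (fun p => continuous_discRe p.1 p.2) (l := fun p => lam p.1 p.2) ?_ c ?_ ht
    (by simpa using hζ)
  · intro c ζ hζ hmin
    have hζ' : ‖ζ‖ ≤ 1 := by simpa using hζ
    obtain ⟨g₁, g₂, a, b, h1, h2, ha, hb, hab⟩ := exists_curve_deriv s c hζ'
    have hm : ∀ ω : ℂ, ‖ω‖ = 1 →
        IsLocalMin (fun ε => ∑ p ∈ s, c p * discRe (curve ζ ω ε) p.1 p.2) 0 := by
      intro ω hω
      refine Filter.Eventually.of_forall fun ε => ?_
      simp only [curve_zero]
      exact hmin _ (by simpa using norm_curve_le hζ' hω ε)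
    have := second_deriv_nonneg h1 ha (hm 1 (by simp))
    have := second_deriv_nonneg h2 hb (hm Complex.I (by simp))
    linarith
  · intro ζ hζ
    exact h0 ζ (by simpa using hζ)

end MaximumPrinciple

/-! ### Summability over the bidegrees -/

section Summability

theorem summable_succ_pow_mul_exp (n : ℕ) {s : ℝ} (hs : 0 < s) :
    Summable fun i : ℕ => ((i : ℝ) + 1) ^ n * rexp (-s * i) := by
  have h := (summable_nat_add_iff 1).2 (Real.summable_pow_mul_exp_neg_nat_mul n hs)
  refine (h.mul_left (rexp s)).congr fun i => ?_
  push_cast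
  rw [show -s * (i : ℝ) = s + -s * (i + 1) by ring, Real.exp_add]
  ring

theorem summable_degree_pow_mul_exp (n : ℕ) {s : ℝ} (hs : 0 < s) :
    Summable fun p : ℕ × ℕ => ((p.1 + p.2 + 1 : ℕ) : ℝ) ^ n * rexp (-s * (p.1 + p.2 : ℕ)) := by
  have h := summable_succ_pow_mul_exp n hs
  refine Summable.of_nonneg_of_le (fun p => by positivity) (fun p => ?_)
    (h.mul_of_nonneg h (fun _ => by positivity) (fun _ => by positivity))
  have h1 : ((p.1 + p.2 + 1 : ℕ) : ℝ) ≤ ((p.1 : ℝ) + 1) * (p.2 + 1) := by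
    push_cast; nlinarith [Nat.cast_nonneg (α := ℝ) p.1, Nat.cast_nonneg (α := ℝ) p.2]
  have h2 : rexp (-s * (p.1 + p.2 : ℕ)) = rexp (-s * p.1) * rexp (-s * p.2) := by
    rw [← Real.exp_add]; push_cast; ring_nf
  rw [h2]
  calc ((p.1 + p.2 + 1 : ℕ) : ℝ) ^ n * (rexp (-s * p.1) * rexp (-s * p.2))
      ≤ (((p.1 : ℝ) + 1) * (p.2 + 1)) ^ n * (rexp (-s * p.1) * rexp (-s * p.2)) := by gcongr
    _ = _ := by rw [mul_pow]; ring

/-- A quantitative version, uniform for small `s`. -/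
theorem exists_tsum_degree_pow_le (n : ℕ) : ∃ K : ℝ, ∀ s : ℝ, 0 < s → s ≤ 1 →
    ∑' p : ℕ × ℕ, ((p.1 + p.2 + 1 : ℕ) : ℝ) ^ n * rexp (-s * (p.1 + p.2 : ℕ)) ≤
      K / s ^ (2 * (n + 2)) := by
  have hsum : Summable fun i : ℕ => 1 / ((i : ℝ) + 1) ^ 2 := by
    have := (summable_nat_add_iff 1).2 (Real.summable_one_div_nat_pow.2 (one_lt_two))
    simpa using this
  set A := ∑' i : ℕ, 1 / ((i : ℝ) + 1) ^ 2
  set B := rexp 1 * ((n + 2).factorial : ℝ)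
  refine ⟨(B * A) ^ 2, fun s hs hs1 => ?_⟩
  have h1 : ∀ i : ℕ, ((i : ℝ) + 1) ^ n * rexp (-s * i) ≤
      B / s ^ (n + 2) * (1 / ((i : ℝ) + 1) ^ 2) := by
    intro i
    have h := Real.pow_div_factorial_le_exp (x := s * (i + 1)) (by positivity) (n + 2)
    rw [div_le_iff₀ (by positivity)] at h
    have e : rexp (-s * i) = rexp s * (rexp (s * (i + 1)))⁻¹ := by
      rw [← Real.exp_neg, ← Real.exp_add]; ring_nf
    rw [e, div_mul_div_comm, mul_one, le_div_iff₀ (by positivity)]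
    have hes : rexp s ≤ rexp 1 := Real.exp_le_exp.2 hs1
    have hpos := Real.exp_pos (s * (i + 1))
    calc ((i : ℝ) + 1) ^ n * (rexp s * (rexp (s * (i + 1)))⁻¹) * (s ^ (n + 2) * (i + 1) ^ 2)
        = rexp s * (rexp (s * (i + 1)))⁻¹ * (s * (i + 1)) ^ (n + 2) := by
          rw [mul_pow s]; ring
      _ ≤ rexp 1 * (rexp (s * (i + 1)))⁻¹ * (rexp (s * (i + 1)) * (n + 2).factorial) := by
          gcongr
      _ = B := by simp only [B]; field_simp
  have hs1 := summable_succ_pow_mul_exp n hs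
  have hprod := hs1.mul_of_nonneg hs1 (fun _ => by positivity) (fun _ => by positivity)
  have hle : ∑' i : ℕ, ((i : ℝ) + 1) ^ n * rexp (-s * i) ≤ B / s ^ (n + 2) * A := by
    rw [← tsum_mul_left]
    exact hs1.tsum_le_tsum h1 (hsum.mul_left _)
  calc ∑' p : ℕ × ℕ, ((p.1 + p.2 + 1 : ℕ) : ℝ) ^ n * rexp (-s * (p.1 + p.2 : ℕ))
      ≤ ∑' p : ℕ × ℕ, (((p.1 : ℝ) + 1) ^ n * rexp (-s * p.1)) *
          (((p.2 : ℝ) + 1) ^ n * rexp (-s * p.2)) := by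
        refine (summable_degree_pow_mul_exp n hs).tsum_le_tsum (fun p => ?_) hprod
        have h1 : ((p.1 + p.2 + 1 : ℕ) : ℝ) ≤ ((p.1 : ℝ) + 1) * (p.2 + 1) := by
          push_cast; nlinarith [Nat.cast_nonneg (α := ℝ) p.1, Nat.cast_nonneg (α := ℝ) p.2]
        have h2 : rexp (-s * (p.1 + p.2 : ℕ)) = rexp (-s * p.1) * rexp (-s * p.2) := by
          rw [← Real.exp_add]; push_cast; ring_nf
        rw [h2]
        calc ((p.1 + p.2 + 1 : ℕ) : ℝ) ^ n * (rexp (-s * p.1) * rexp (-s * p.2))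
            ≤ (((p.1 : ℝ) + 1) * (p.2 + 1)) ^ n * (rexp (-s * p.1) * rexp (-s * p.2)) := by gcongr
          _ = _ := by rw [mul_pow]; ring
    _ = (∑' i : ℕ, ((i : ℝ) + 1) ^ n * rexp (-s * i)) ^ 2 := by
        rw [sq, hs1.tsum_mul_tsum hs1 hprod]
    _ ≤ (B / s ^ (n + 2) * A) ^ 2 := by
        gcongr
    _ = _ := by
        clear_value A B
        rw [mul_pow, div_pow, ← pow_mul, mul_comm (n + 2) 2, mul_pow]; ring

end Summability

/-! ### Moments of the heat kernel at the pole -/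

section Concentration

theorem two_mul_degree_le_lam (i j : ℕ) : 2 * ((i + j : ℕ) : ℝ) ≤ lam i j := by
  rw [lam]; push_cast
  nlinarith [mul_nonneg (Nat.cast_nonneg (α := ℝ) i) (Nat.cast_nonneg (α := ℝ) j)]

/-- Multiplication by `Re ζ` in terms of the real parts of the disc polynomials. -/
theorem re_mul_discRe (ζ : ℂ) (i j : ℕ) :
    2 * ((i + j + 1 : ℕ) : ℝ) * (ζ.re * discRe ζ i j) =
      (j + 1) * discRe ζ i (j + 1) + i * discRe ζ (i - 1) j +
        (i + 1) * discRe ζ (i + 1) j + j * discRe ζ i (j - 1) := by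
  have h1 := mul_disc ζ (conj ζ) i j
  have h2 := mul_disc' ζ (conj ζ) i j
  have h3 : 2 * ((i + j + 1 : ℕ) : ℂ) * ((ζ.re : ℂ) * disc ζ (conj ζ) i j) =
      ((j + 1 : ℕ) : ℝ) * disc ζ (conj ζ) i (j + 1) + ((i : ℝ) : ℂ) * disc ζ (conj ζ) (i - 1) j +
      ((i + 1 : ℕ) : ℝ) * disc ζ (conj ζ) (i + 1) j +
        ((j : ℝ) : ℂ) * disc ζ (conj ζ) i (j - 1) := by
    have h4 : (2 : ℂ) * (ζ.re : ℂ) = ζ + conj ζ := by rw [Complex.add_conj]; push_cast; ring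
    simp only [Complex.ofReal_natCast]
    linear_combination h1 + h2 + ((i + j + 1 : ℕ) : ℂ) * disc ζ (conj ζ) i j * h4
  have h5 := congrArg Complex.re h3
  rw [show (2 * ((i + j + 1 : ℕ) : ℂ) * ((ζ.re : ℂ) * disc ζ (conj ζ) i j)) =
    ((2 * ((i + j + 1 : ℕ) : ℝ) * ζ.re : ℝ) : ℂ) * disc ζ (conj ζ) i j by push_cast; ring] at h5
  simp only [Complex.add_re, Complex.re_ofReal_mul] at h5
  simp only [discRe]
  push_cast at h5 ⊢
  linarith

/-- The coefficient vector of `Re ζ · Re D_{i,j}`. -/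
def mulReCoeff (p : ℕ × ℕ) : ℕ × ℕ →₀ ℝ :=
  (1 / (2 * ((p.1 + p.2 + 1 : ℕ) : ℝ))) • (((p.2 : ℝ) + 1) • Finsupp.single (p.1, p.2 + 1) 1 +
    (p.1 : ℝ) • Finsupp.single (p.1 - 1, p.2) 1 +
    ((p.1 : ℝ) + 1) • Finsupp.single (p.1 + 1, p.2) 1 +
    (p.2 : ℝ) • Finsupp.single (p.1, p.2 - 1) 1)

/-- Multiplication by `1 - Re ζ` on coefficient vectors. -/
def defect : (ℕ × ℕ →₀ ℝ) →ₗ[ℝ] (ℕ × ℕ →₀ ℝ) :=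
  LinearMap.id - Finsupp.linearCombination ℝ mulReCoeff

/-- Evaluation at `ζ` of the function with a given coefficient vector. -/
def evalAt (ζ : ℂ) : (ℕ × ℕ →₀ ℝ) →ₗ[ℝ] ℝ := Finsupp.linearCombination ℝ fun p => discRe ζ p.1 p.2

/-- The heat semigroup at time `t` followed by evaluation at `ζ = 1`. -/
def heatAtOne (t : ℝ) : (ℕ × ℕ →₀ ℝ) →ₗ[ℝ] ℝ :=
  Finsupp.linearCombination ℝ fun p => rexp (-lam p.1 p.2 * t)

theorem evalAt_single (ζ : ℂ) (p : ℕ × ℕ) :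
    evalAt ζ (Finsupp.single p 1) = discRe ζ p.1 p.2 := by simp [evalAt]

theorem evalAt_eq_sum (ζ : ℂ) (v : ℕ × ℕ →₀ ℝ) :
    evalAt ζ v = ∑ p ∈ v.support, v p * discRe ζ p.1 p.2 := by
  simp [evalAt, Finsupp.linearCombination_apply, Finsupp.sum]

theorem heatAtOne_eq_sum (t : ℝ) (v : ℕ × ℕ →₀ ℝ) :
    heatAtOne t v = ∑ p ∈ v.support, v p * rexp (-lam p.1 p.2 * t) := by
  simp [heatAtOne, Finsupp.linearCombination_apply, Finsupp.sum]

theorem evalAt_mulReCoeff (ζ : ℂ) (p : ℕ × ℕ) :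
    evalAt ζ (mulReCoeff p) = ζ.re * discRe ζ p.1 p.2 := by
  have h := re_mul_discRe ζ p.1 p.2
  have hw : (0 : ℝ) < ((p.1 + p.2 + 1 : ℕ) : ℝ) := by positivity
  simp only [mulReCoeff, map_smul, map_add, evalAt_single, smul_eq_mul]
  rw [← h]; field_simp

theorem evalAt_defect (ζ : ℂ) (v : ℕ × ℕ →₀ ℝ) :
    evalAt ζ (defect v) = (1 - ζ.re) * evalAt ζ v := by
  induction v using Finsupp.induction_linear with
  | zero => simp
  | add f g hf hg => rw [map_add, map_add, hf, hg, map_add]; ring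
  | single p a =>
    have : Finsupp.single p a = a • Finsupp.single p (1 : ℝ) := by simp
    rw [this, map_smul, map_smul, map_smul, evalAt_single, defect, LinearMap.sub_apply,
      LinearMap.id_apply, map_sub, evalAt_single, Finsupp.linearCombination_single, one_smul,
      evalAt_mulReCoeff]
    simp only [smul_eq_mul]; ring

theorem evalAt_defect_pow (ζ : ℂ) (J : ℕ) (v : ℕ × ℕ →₀ ℝ) :
    evalAt ζ ((defect ^ J) v) = (1 - ζ.re) ^ J * evalAt ζ v := by
  induction J with
  | zero => simp
  | succ J ih => rw [pow_succ', Module.End.mul_apply, evalAt_defect, ih]; ring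

theorem heatAtOne_nonneg {v : ℕ × ℕ →₀ ℝ} (h : ∀ ζ : ℂ, ‖ζ‖ ≤ 1 → 0 ≤ evalAt ζ v) {t : ℝ}
    (ht : 0 ≤ t) : 0 ≤ heatAtOne t v := by
  have := disc_heat_nonneg v.support v (fun ζ hζ => by rw [← evalAt_eq_sum]; exact h ζ hζ) ht
    (ζ := 1) (by simp)
  simp only [discRe_one, mul_one] at this
  rwa [heatAtOne_eq_sum]

theorem heatAtOne_zero (v : ℕ × ℕ →₀ ℝ) : heatAtOne 0 v = evalAt 1 v := by
  rw [heatAtOne_eq_sum, evalAt_eq_sum]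
  simp [discRe_one]

/-- The generator on coefficient vectors. -/
def genCoeff : (ℕ × ℕ →₀ ℝ) →ₗ[ℝ] (ℕ × ℕ →₀ ℝ) :=
  Finsupp.linearCombination ℝ fun p => Finsupp.single p (-lam p.1 p.2)

theorem hasDerivAt_heatAtOne (v : ℕ × ℕ →₀ ℝ) (t : ℝ) :
    HasDerivAt (fun t => heatAtOne t v) (heatAtOne t (genCoeff v)) t := by
  induction v using Finsupp.induction_linear with
  | zero => simpa using hasDerivAt_const t (0 : ℝ)
  | add f g hf hg =>
    simp only [map_add]
    exact hf.add hg
  | single p a =>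
    simp only [heatAtOne, genCoeff, Finsupp.linearCombination_single, smul_eq_mul,
      Finsupp.smul_single]
    have := (((hasDerivAt_id t).const_mul (-lam p.1 p.2)).exp).const_mul a
    refine this.congr_deriv ?_
    simp only [id]; ring

/-- The value of the generator on a power of `1 - Re ζ`, up to the factor `1 - Re ζ` it loses. -/
theorem evalAt_genCoeff_defect_pow {ζ : ℂ} (hζ : ‖ζ‖ ≤ 1) (J : ℕ) :
    evalAt ζ (genCoeff ((defect ^ (J + 1)) (Finsupp.single (0, 0) 1))) ≤
      2 * (J + 1) ^ 2 * (1 - ζ.re) ^ J := by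
  set v := (defect ^ (J + 1)) (Finsupp.single (0, 0) (1 : ℝ)) with hv
  have hev : ∀ z, ∑ p ∈ v.support, v p * discRe z p.1 p.2 = (1 - z.re) ^ (J + 1) := by
    intro z
    rw [← evalAt_eq_sum, hv, evalAt_defect_pow, evalAt_single]; simp
  have hgen : evalAt ζ (genCoeff v) =
      -∑ p ∈ v.support, v p * (lam p.1 p.2 * discRe ζ p.1 p.2) := by
    rw [genCoeff, Finsupp.linearCombination_apply, Finsupp.sum, map_sum, ← Finset.sum_neg_distrib]
    refine Finset.sum_congr rfl fun p _ => ?_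
    rw [map_smul, show Finsupp.single p (-lam p.1 p.2) = (-lam p.1 p.2) • Finsupp.single p (1 : ℝ)
      by simp, map_smul, evalAt_single]
    simp only [smul_eq_mul]; ring
  obtain ⟨g₁, g₂, a, b, h1, h2, ha, hb, hab⟩ := exists_curve_deriv v.support v hζ
  have hs : 0 ≤ 1 - ‖ζ‖ ^ 2 := by nlinarith [norm_nonneg ζ]
  set s := √(1 - ‖ζ‖ ^ 2) with hsdef
  have hs2 : s ^ 2 = 1 - ‖ζ‖ ^ 2 := sq_sqrt hs
  simp only [hev] at h1 h2
  -- the second derivative of `(1 - k)^(J+1)` for `k'' = -k`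
  have second : ∀ (g : ℝ → ℝ) (a c : ℝ) (k : ℝ → ℝ), (∀ ε, k ε = cos ε * ζ.re + sin ε * c) →
      (∀ ε, HasDerivAt (fun ε => (1 - k ε) ^ (J + 1)) (g ε) ε) → HasDerivAt g a 0 →
      a = (J + 1) * J * (1 - ζ.re) ^ (J - 1) * c ^ 2 + (J + 1) * (1 - ζ.re) ^ J * ζ.re := by
    intro g a c k hk hg hga
    have hk1 : ∀ ε, HasDerivAt k (-sin ε * ζ.re + cos ε * c) ε := by
      intro ε
      have : k = fun ε => cos ε * ζ.re + sin ε * c := funext hk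
      rw [this]
      exact ((hasDerivAt_cos ε).mul_const _).add ((hasDerivAt_sin ε).mul_const _)
    have hk2 : HasDerivAt (fun ε => -sin ε * ζ.re + cos ε * c) (-ζ.re) 0 := by
      refine (((hasDerivAt_sin 0).neg.mul_const _).add
        ((hasDerivAt_cos 0).mul_const _)).congr_deriv ?_
      simp
    have hg1 : g = fun ε => (J + 1) * (1 - k ε) ^ J * -(-sin ε * ζ.re + cos ε * c) := by
      funext ε
      refine (hg ε).unique ((((hasDerivAt_const ε (1 : ℝ)).sub (hk1 ε)).pow (J + 1)).congr_deriv ?_)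
      simp
    rw [hg1] at hga
    have h3 := (((((hasDerivAt_const 0 (1 : ℝ)).sub (hk1 0)).pow J).const_mul
      ((J : ℝ) + 1)).mul hk2.neg)
    have h4 := hga.unique h3
    rw [h4]
    simp [hk]
    ring
  have e1 := second g₁ a s (fun ε => (curve ζ 1 ε).re) (by
    intro ε
    simp only [curve, mul_one, ← hsdef]
    rw [Complex.add_re, Complex.re_ofReal_mul, ← Complex.ofReal_mul, Complex.ofReal_re]) h1 ha
  have e2 := second g₂ b 0 (fun ε => (curve ζ Complex.I ε).re) (by
    intro ε
    simp only [curve, ← hsdef]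
    rw [Complex.add_re, Complex.re_ofReal_mul, Complex.re_ofReal_mul, Complex.re_ofReal_mul]
    simp) h2 hb
  rw [hgen, ← hab, e1, e2, hs2]
  have hre : |ζ.re| ≤ 1 := (Complex.abs_re_le_norm ζ).trans hζ
  have hre' := abs_le.1 hre
  have hn : 1 - ‖ζ‖ ^ 2 ≤ 2 * (1 - ζ.re) := by
    have : ζ.re ^ 2 ≤ ‖ζ‖ ^ 2 := by
      rw [← sq_abs]; exact pow_le_pow_left₀ (abs_nonneg _) (Complex.abs_re_le_norm ζ) 2
    nlinarith
  have hu : 0 ≤ 1 - ζ.re := by linarith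
  have t1 : (J + 1) * J * (1 - ζ.re) ^ (J - 1) * (1 - ‖ζ‖ ^ 2) ≤
      2 * (J + 1) * J * (1 - ζ.re) ^ J := by
    rcases J with _ | J
    · simp
    · rw [Nat.add_sub_cancel]
      calc _ ≤ ((J + 1 : ℕ) + 1 : ℝ) * (J + 1 : ℕ) * (1 - ζ.re) ^ J * (2 * (1 - ζ.re)) := by gcongr
        _ = _ := by rw [pow_succ]; ring
  have t2 : (J + 1) * (1 - ζ.re) ^ J * ζ.re ≤ (J + 1) * (1 - ζ.re) ^ J * 1 := by
    gcongr; exact hre'.2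
  nlinarith [t1, t2]

/-- The moments of the heat kernel on the disc: the `J`-th power of `1 - Re ζ` has size `t^J`. -/
theorem heatAtOne_defect_pow_le (J : ℕ) {t : ℝ} (ht : 0 ≤ t) :
    heatAtOne t ((defect ^ J) (Finsupp.single (0, 0) 1)) ≤ 2 ^ J * (J.factorial : ℝ) * t ^ J := by
  induction J generalizing t with
  | zero => simp [heatAtOne, lam]
  | succ J ih =>
    set v := (defect ^ (J + 1)) (Finsupp.single (0, 0) (1 : ℝ)) with hv
    set C : ℝ := 2 ^ J * (J.factorial : ℝ)
    have hder : ∀ t, HasDerivAt (fun t => 2 * (J + 1) * C * t ^ (J + 1) - heatAtOne t v)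
        (2 * (J + 1) * C * ((J + 1) * t ^ J) - heatAtOne t (genCoeff v)) t := by
      intro t
      refine HasDerivAt.sub ?_ (hasDerivAt_heatAtOne v t)
      apply HasDerivAt.const_mul
      simpa using hasDerivAt_pow (J + 1) t
    have hnn : ∀ t, 0 ≤ t → heatAtOne t (genCoeff v) ≤ 2 * (J + 1) * C * ((J + 1) * t ^ J) := by
      intro t ht
      have h1 : 0 ≤ heatAtOne t ((2 * ((J : ℝ) + 1) ^ 2) •
          (defect ^ J) (Finsupp.single (0, 0) 1) - genCoeff v) := by
        apply heatAtOne_nonneg _ ht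
        intro ζ hζ
        rw [map_sub, map_smul, evalAt_defect_pow, evalAt_single, discRe_zero_zero, mul_one,
          smul_eq_mul]
        linarith [evalAt_genCoeff_defect_pow hζ J]
      rw [map_sub, map_smul, smul_eq_mul] at h1
      have h2 := ih ht
      have h3 : 2 * ((J : ℝ) + 1) ^ 2 * heatAtOne t ((defect ^ J) (Finsupp.single (0, 0) 1)) ≤
        2 * ((J : ℝ) + 1) ^ 2 * (C * t ^ J) := by gcongr
      linarith
    have hmono : MonotoneOn (fun t => 2 * (J + 1) * C * t ^ (J + 1) - heatAtOne t v) (Ici 0) := by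
      apply monotoneOn_of_deriv_nonneg (convex_Ici 0)
      · exact fun t _ => (hder t).continuousAt.continuousWithinAt
      · exact fun t _ => (hder t).differentiableAt.differentiableWithinAt
      · intro t ht
        rw [interior_Ici] at ht
        rw [(hder t).deriv]
        linarith [hnn t (le_of_lt ht)]
    have := hmono (mem_Ici.2 le_rfl) (mem_Ici.2 ht) ht
    have h0 : heatAtOne 0 v = 0 := by
      rw [heatAtOne_zero, hv, evalAt_defect_pow]; simp
    simp only [h0] at this
    rw [Nat.factorial_succ]
    push_cast
    simp only [C] at this
    ring_nf at this ⊢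
    linarith

end Concentration

/-! ### The heat kernel of the disc -/

section DiscHeatKernel

/-- The heat kernel of the unit disc, as a function of `ζ` with the pole `1`: the subelliptic
heat kernel in the coordinate `ζ = cos r · e^{iθ}`. -/
def heatDisc (t : ℝ) (ζ : ℂ) : ℝ :=
  ∑' p : ℕ × ℕ, ((p.1 + p.2 + 1 : ℕ) : ℝ) * rexp (-lam p.1 p.2 * t) * discRe ζ p.1 p.2

theorem abs_discRe_le' {ζ : ℂ} (hζ : ‖ζ‖ ≤ 1) (p : ℕ × ℕ) :
    |discRe ζ p.1 p.2| ≤ ((p.1 + p.2 + 1 : ℕ) : ℝ) := by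
  push_cast; exact abs_discRe_le hζ _ _

theorem exp_neg_lam_le {t : ℝ} (ht : 0 ≤ t) (p : ℕ × ℕ) :
    rexp (-lam p.1 p.2 * t) ≤ rexp (-(2 * t) * (p.1 + p.2 : ℕ)) := by
  apply Real.exp_le_exp.2
  nlinarith [mul_le_mul_of_nonneg_right (two_mul_degree_le_lam p.1 p.2) ht]

/-- Series in the functions `Re D_{i,j}` with exponentially decaying coefficients. -/
theorem summable_mul_discRe {s K : ℝ} (hs : 0 < s) {G : ℕ × ℕ → ℝ} (n : ℕ)
    (hG : ∀ p, |G p| ≤ K * (((p.1 + p.2 + 1 : ℕ) : ℝ) ^ n * rexp (-s * (p.1 + p.2 : ℕ))))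
    {ζ : ℂ} (hζ : ‖ζ‖ ≤ 1) : Summable fun p => G p * discRe ζ p.1 p.2 := by
  refine Summable.of_norm_bounded ((summable_degree_pow_mul_exp (n + 1) hs).mul_left K) fun p => ?_
  rw [Real.norm_eq_abs, abs_mul]
  calc |G p| * |discRe ζ p.1 p.2| ≤ K * (((p.1 + p.2 + 1 : ℕ) : ℝ) ^ n *
        rexp (-s * (p.1 + p.2 : ℕ))) * ((p.1 + p.2 + 1 : ℕ) : ℝ) :=
        mul_le_mul (hG p) (abs_discRe_le' hζ p) (abs_nonneg _) ((abs_nonneg _).trans (hG p))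
    _ = _ := by ring

theorem heatDisc_coeff_le {t : ℝ} (ht : 0 ≤ t) (p : ℕ × ℕ) :
    |((p.1 + p.2 + 1 : ℕ) : ℝ) * rexp (-lam p.1 p.2 * t)| ≤
      1 * (((p.1 + p.2 + 1 : ℕ) : ℝ) ^ 1 * rexp (-(2 * t) * (p.1 + p.2 : ℕ))) := by
  rw [abs_of_nonneg (by positivity), pow_one, one_mul]
  exact mul_le_mul_of_nonneg_left (exp_neg_lam_le ht p) (by positivity)

theorem hasSum_heatDisc {t : ℝ} (ht : 0 < t) {ζ : ℂ} (hζ : ‖ζ‖ ≤ 1) :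
    HasSum (fun p : ℕ × ℕ => ((p.1 + p.2 + 1 : ℕ) : ℝ) * rexp (-lam p.1 p.2 * t) *
      discRe ζ p.1 p.2) (heatDisc t ζ) :=
  (summable_mul_discRe (by linarith : 0 < 2 * t) 1 (heatDisc_coeff_le ht.le) hζ).hasSum

theorem hasSum_shift_right {F : ℕ × ℕ → ℝ} (h0 : ∀ i, F (i, 0) = 0) {s : ℝ} :
    HasSum (fun p : ℕ × ℕ => F (p.1, p.2 + 1)) s ↔ HasSum F s := by
  have hinj : Function.Injective fun p : ℕ × ℕ => (p.1, p.2 + 1) := by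
    rintro ⟨a, b⟩ ⟨c, d⟩ h; simpa using h
  refine hinj.hasSum_iff (f := F) ?_
  rintro ⟨i, j⟩ hj
  rcases j with _ | j
  · exact h0 i
  · exact absurd ⟨(i, j), rfl⟩ hj

theorem hasSum_shift_left {F : ℕ × ℕ → ℝ} (h0 : ∀ j, F (0, j) = 0) {s : ℝ} :
    HasSum (fun p : ℕ × ℕ => F (p.1 + 1, p.2)) s ↔ HasSum F s := by
  have hinj : Function.Injective fun p : ℕ × ℕ => (p.1 + 1, p.2) := by
    rintro ⟨a, b⟩ ⟨c, d⟩ h; simpa using h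
  refine hinj.hasSum_iff (f := F) ?_
  rintro ⟨i, j⟩ hj
  rcases i with _ | i
  · exact h0 j
  · exact absurd ⟨(i, j), rfl⟩ hj

/-- Multiplying a series in the `(i+j+1) Re D_{i,j}` by `1 - Re ζ` acts on the coefficients by the
transpose of `defect`; this operator is symmetric in the normalization used here. -/
theorem hasSum_one_sub_re_mul {s K : ℝ} (hs : 0 < s) {G G' : ℕ × ℕ → ℝ}
    (hG : ∀ p, |G p| ≤ K * rexp (-s * (p.1 + p.2 : ℕ)))
    (hG' : ∀ i j, 2 * ((i + j + 1 : ℕ) : ℝ) * (G (i, j) - G' (i, j)) = (j + 1) * G (i, j + 1) +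
      i * G (i - 1, j) + (i + 1) * G (i + 1, j) + j * G (i, j - 1))
    {ζ : ℂ} (hζ : ‖ζ‖ ≤ 1) {S : ℝ}
    (h : HasSum (fun p : ℕ × ℕ => ((p.1 + p.2 + 1 : ℕ) : ℝ) * G p * discRe ζ p.1 p.2) S) :
    HasSum (fun p : ℕ × ℕ => ((p.1 + p.2 + 1 : ℕ) : ℝ) * G' p * discRe ζ p.1 p.2)
      ((1 - ζ.re) * S) := by
  have hbound : Summable fun p : ℕ × ℕ => K * (((p.1 + p.2 + 1 : ℕ) : ℝ) ^ 2 *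
      rexp (-s * (p.1 + p.2 : ℕ))) * 2 :=
    ((summable_degree_pow_mul_exp 2 hs).mul_left K).mul_right 2
  have hK : 0 ≤ K := by simpa using (abs_nonneg _).trans (hG (0, 0))
  have key : ∀ (c : ℕ × ℕ → ℝ) (f : ℕ × ℕ → ℕ × ℕ), (∀ p, |c p| ≤ ((p.1 + p.2 + 1 : ℕ) : ℝ)) →
      (∀ p, (f p).1 + (f p).2 ≤ p.1 + p.2 + 1) →
      Summable fun p => c p * G p * discRe ζ (f p).1 (f p).2 := by
    intro c f hc hf
    refine Summable.of_norm_bounded hbound fun p => ?_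
    rw [Real.norm_eq_abs, abs_mul, abs_mul]
    have h1 : |discRe ζ (f p).1 (f p).2| ≤ ((p.1 + p.2 + 1 : ℕ) : ℝ) * 2 := by
      refine (abs_discRe_le' hζ (f p)).trans ?_
      have := hf p
      exact_mod_cast (by omega : (f p).1 + (f p).2 + 1 ≤ (p.1 + p.2 + 1) * 2)
    calc |c p| * |G p| * |discRe ζ (f p).1 (f p).2|
        ≤ ((p.1 + p.2 + 1 : ℕ) : ℝ) * (K * rexp (-s * (p.1 + p.2 : ℕ))) *
          (((p.1 + p.2 + 1 : ℕ) : ℝ) * 2) := by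
          gcongr
          · exact hc p
          · exact hG p
      _ = _ := by ring
  have n1 : ∀ p : ℕ × ℕ, |(p.2 : ℝ) + 1| ≤ ((p.1 + p.2 + 1 : ℕ) : ℝ) := fun p => by
    rw [abs_of_nonneg (by positivity)]; push_cast; linarith [Nat.cast_nonneg (α := ℝ) p.1]
  have n2 : ∀ p : ℕ × ℕ, |(p.1 : ℝ)| ≤ ((p.1 + p.2 + 1 : ℕ) : ℝ) := fun p => by
    rw [abs_of_nonneg (by positivity)]; push_cast; linarith [Nat.cast_nonneg (α := ℝ) p.2]
  have n3 : ∀ p : ℕ × ℕ, |(p.1 : ℝ) + 1| ≤ ((p.1 + p.2 + 1 : ℕ) : ℝ) := fun p => by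
    rw [abs_of_nonneg (by positivity)]; push_cast; linarith [Nat.cast_nonneg (α := ℝ) p.2]
  have n4 : ∀ p : ℕ × ℕ, |(p.2 : ℝ)| ≤ ((p.1 + p.2 + 1 : ℕ) : ℝ) := fun p => by
    rw [abs_of_nonneg (by positivity)]; push_cast; linarith [Nat.cast_nonneg (α := ℝ) p.1]
  have s1 := (key (fun p => p.2 + 1) (fun p => (p.1, p.2 + 1)) n1
    (fun p => by simp only; omega)).hasSum
  have s2 := (key (fun p => p.1) (fun p => (p.1 - 1, p.2)) n2 (fun p => by simp only; omega)).hasSum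
  have s3 := (key (fun p => p.1 + 1) (fun p => (p.1 + 1, p.2)) n3
    (fun p => by simp only; omega)).hasSum
  have s4 := (key (fun p => p.2) (fun p => (p.1, p.2 - 1)) n4 (fun p => by simp only; omega)).hasSum
  have e := (((s1.add s2).add s3).add s4).unique (((h.mul_left (2 * ζ.re))).congr_fun fun p => by
    have := re_mul_discRe ζ p.1 p.2
    simp only
    linear_combination (-G p) * this)
  have r1 := (hasSum_shift_right (F := fun p => (p.2 : ℝ) * G (p.1, p.2 - 1) * discRe ζ p.1 p.2)
    (by simp) ).1 (by simpa using s1)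
  have r3 := (hasSum_shift_left (F := fun p => (p.1 : ℝ) * G (p.1 - 1, p.2) * discRe ζ p.1 p.2)
    (by simp)).1 (by simpa using s3)
  have r2 := (hasSum_shift_left (F := fun p => (p.1 : ℝ) * G p * discRe ζ (p.1 - 1) p.2)
    (by simp)).2 s2
  have r4 := (hasSum_shift_right (F := fun p => (p.2 : ℝ) * G p * discRe ζ p.1 (p.2 - 1))
    (by simp)).2 s4
  have tot := h.sub ((((r1.add r2).add r3).add r4).mul_left (1 / 2))
  have hS : (1 - ζ.re) * S = S - 1 / 2 * (2 * ζ.re * S) := by ring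
  rw [hS, ← e]
  refine tot.congr_fun fun ⟨i, j⟩ => ?_
  have := hG' i j
  simp only [Nat.add_sub_cancel]
  push_cast at this ⊢
  linear_combination (-(1 / 2) * discRe ζ i j) * this

/-- The coefficients of `(1 - Re ζ)^J` times the heat kernel. -/
def starCoeff (t : ℝ) (J : ℕ) (p : ℕ × ℕ) : ℝ := heatAtOne t ((defect ^ J) (Finsupp.single p 1))

theorem starCoeff_zero (t : ℝ) (p : ℕ × ℕ) : starCoeff t 0 p = rexp (-lam p.1 p.2 * t) := by
  simp [starCoeff, heatAtOne]

theorem starCoeff_succ (t : ℝ) (J i j : ℕ) :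
    2 * ((i + j + 1 : ℕ) : ℝ) * (starCoeff t J (i, j) - starCoeff t (J + 1) (i, j)) =
      (j + 1) * starCoeff t J (i, j + 1) + i * starCoeff t J (i - 1, j) +
        (i + 1) * starCoeff t J (i + 1, j) + j * starCoeff t J (i, j - 1) := by
  have hw : (0 : ℝ) < ((i + j + 1 : ℕ) : ℝ) := by positivity
  simp only [starCoeff]
  rw [pow_succ, Module.End.mul_apply, defect, LinearMap.sub_apply, ← defect,
    Finsupp.linearCombination_single, LinearMap.id_apply, one_smul, map_sub, map_sub,
    sub_sub_cancel, mulReCoeff]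
  simp only [map_smul, map_add, smul_eq_mul]
  field_simp

/-- Positivity of the semigroup and `|D_{i,j}| ≤ i + j + 1` compare the coefficient with the moment
of `(1 - Re ζ)^J`. -/
theorem abs_starCoeff_le {t : ℝ} (ht : 0 ≤ t) (J : ℕ) (p : ℕ × ℕ) :
    |starCoeff t J p| ≤ ((p.1 + p.2 + 1 : ℕ) : ℝ) * (2 ^ J * (J.factorial : ℝ) * t ^ J) := by
  have key : ∀ ε : ℝ, |ε| = 1 → 0 ≤ ((p.1 + p.2 + 1 : ℕ) : ℝ) * heatAtOne t
      ((defect ^ J) (Finsupp.single (0, 0) 1)) + ε * starCoeff t J p := by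
    intro ε hε
    have := heatAtOne_nonneg (v := ((p.1 + p.2 + 1 : ℕ) : ℝ) •
      (defect ^ J) (Finsupp.single (0, 0) 1) + ε • (defect ^ J) (Finsupp.single p 1)) (t := t) ?_ ht
    · simpa only [map_add, map_smul, smul_eq_mul, starCoeff] using this
    · intro ζ hζ
      simp only [map_add, map_smul, smul_eq_mul, evalAt_defect_pow, evalAt_single,
        discRe_zero_zero, mul_one]
      have h1 : 0 ≤ 1 - ζ.re := by
        linarith [(abs_le.1 ((Complex.abs_re_le_norm ζ).trans hζ)).2]
      have h2 : |ε * discRe ζ p.1 p.2| ≤ ((p.1 + p.2 + 1 : ℕ) : ℝ) := by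
        rw [abs_mul, hε, one_mul]; exact abs_discRe_le' hζ p
      have h3 := (abs_le.1 h2).1
      have h4 : 0 ≤ (1 - ζ.re) ^ J * (((p.1 + p.2 + 1 : ℕ) : ℝ) + ε * discRe ζ p.1 p.2) :=
        mul_nonneg (pow_nonneg h1 J) (by linarith)
      linarith
  have h := mul_le_mul_of_nonneg_left (heatAtOne_defect_pow_le J ht)
    (Nat.cast_nonneg (α := ℝ) (p.1 + p.2 + 1))
  have k1 := key 1 (by simp)
  have k2 := key (-1) (by simp)
  rw [abs_le]
  constructor <;> linarith

/-- The coefficients keep the exponential decay in the degree: each factor `1 - Re ζ` changes the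
degree by at most one. -/
theorem abs_starCoeff_le_exp {t : ℝ} (ht : 0 ≤ t) (J : ℕ) (p : ℕ × ℕ) :
    |starCoeff t J p| ≤ (2 * rexp (2 * t)) ^ J * rexp (-(2 * t) * (p.1 + p.2 : ℕ)) := by
  induction J generalizing p with
  | zero =>
    rw [starCoeff_zero, abs_of_nonneg (by positivity), pow_zero, one_mul]
    exact exp_neg_lam_le ht p
  | succ J ih =>
    obtain ⟨i, j⟩ := p
    set A : ℝ := (2 * rexp (2 * t)) ^ J
    set E : ℝ := A * (rexp (2 * t) * rexp (-(2 * t) * (i + j : ℕ))) with hE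
    have hA : 0 ≤ A := by positivity
    have nb : ∀ a b : ℕ, i + j ≤ a + b + 1 → |starCoeff t J (a, b)| ≤ E := by
      intro a b hab
      refine (ih (a, b)).trans (mul_le_mul_of_nonneg_left ?_ hA)
      rw [← Real.exp_add]
      apply Real.exp_le_exp.2
      have : ((i + j : ℕ) : ℝ) ≤ ((a + b : ℕ) : ℝ) + 1 := by exact_mod_cast hab
      simp only
      nlinarith
    have h0 := nb i j (by omega)
    have h1 := nb i (j + 1) (by omega)
    have h2 := nb (i - 1) j (by omega)
    have h3 := nb (i + 1) j (by omega)
    have h4 := nb i (j - 1) (by omega)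
    have hrec := starCoeff_succ t J i j
    have hw : (0 : ℝ) < ((i + j + 1 : ℕ) : ℝ) := by positivity
    have m : ∀ c x : ℝ, 0 ≤ c → |x| ≤ E → |c * x| ≤ c * E := fun c x hc hx => by
      rw [abs_mul, abs_of_nonneg hc]; exact mul_le_mul_of_nonneg_left hx hc
    have m1 := abs_le.1 (m (j + 1) _ (by positivity) h1)
    have m2 := abs_le.1 (m i _ (by positivity) h2)
    have m3 := abs_le.1 (m (i + 1) _ (by positivity) h3)
    have m4 := abs_le.1 (m j _ (by positivity) h4)
    have hd : |starCoeff t J (i, j) - starCoeff t (J + 1) (i, j)| ≤ E := by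
      have : |2 * ((i + j + 1 : ℕ) : ℝ) * (starCoeff t J (i, j) - starCoeff t (J + 1) (i, j))| ≤
          2 * ((i + j + 1 : ℕ) : ℝ) * E := by
        rw [hrec, abs_le]; push_cast
        constructor <;> linarith
      rw [abs_mul, abs_of_pos (by positivity)] at this
      exact le_of_mul_le_mul_left this (by positivity)
    have : |starCoeff t (J + 1) (i, j)| ≤ 2 * E := by
      rw [abs_le] at hd h0 ⊢
      constructor <;> linarith
    refine this.trans (le_of_eq ?_)
    rw [hE, pow_succ]; ring

theorem hasSum_starCoeff {t : ℝ} (ht : 0 < t) (J : ℕ) {ζ : ℂ} (hζ : ‖ζ‖ ≤ 1) :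
    HasSum (fun p : ℕ × ℕ => ((p.1 + p.2 + 1 : ℕ) : ℝ) * starCoeff t J p * discRe ζ p.1 p.2)
      ((1 - ζ.re) ^ J * heatDisc t ζ) := by
  induction J with
  | zero => simpa only [starCoeff_zero, pow_zero, one_mul] using hasSum_heatDisc ht hζ
  | succ J ih =>
    rw [pow_succ', mul_assoc]
    exact hasSum_one_sub_re_mul (by linarith : 0 < 2 * t) (abs_starCoeff_le_exp ht.le J)
      (starCoeff_succ t J) hζ ih

/-- Off-diagonal decay of the heat kernel: away from the pole it vanishes, uniformly, as `t → 0`.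
The geometric mean of the two bounds on the coefficients of `(1 - Re ζ)^J` times the kernel is of
order `t^{J/2}`, and the crude bound on the sum over all bidegrees costs `t^{-10}`; the exponent
`J = 22` leaves a factor `t`. -/
theorem exists_one_sub_re_pow_mul_heatDisc_le : ∃ K : ℝ, ∀ t : ℝ, 0 < t → t ≤ 1 → ∀ ζ : ℂ,
    ‖ζ‖ ≤ 1 → (1 - ζ.re) ^ 22 * |heatDisc t ζ| ≤ K * t := by
  obtain ⟨K', hK'⟩ := exists_tsum_degree_pow_le 3
  set C : ℝ := 2 ^ 22 * (Nat.factorial 22 : ℝ) with hC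
  set L : ℝ := √(C * (2 * rexp 2) ^ 22)
  refine ⟨L * K', fun t ht ht1 ζ hζ => ?_⟩
  have hcoeff : ∀ p : ℕ × ℕ, |starCoeff t 22 p| ≤
      L * t ^ 11 * (((p.1 + p.2 + 1 : ℕ) : ℝ) * rexp (-t * (p.1 + p.2 : ℕ))) := by
    intro p
    have h1 := abs_starCoeff_le ht.le 22 p
    have h2 := abs_starCoeff_le_exp ht.le 22 p
    have hw : (1 : ℝ) ≤ ((p.1 + p.2 + 1 : ℕ) : ℝ) := by
      push_cast; linarith [Nat.cast_nonneg (α := ℝ) p.1, Nat.cast_nonneg (α := ℝ) p.2]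
    apply abs_le_of_sq_le_sq _ (by positivity)
    have e2 : rexp (2 * t) ≤ rexp 2 := Real.exp_le_exp.2 (by linarith)
    have hL : L ^ 2 = C * (2 * rexp 2) ^ 22 := sq_sqrt (by positivity)
    have he : rexp (-(2 * t) * (p.1 + p.2 : ℕ)) = rexp (-t * (p.1 + p.2 : ℕ)) ^ 2 := by
      rw [← Real.exp_nat_mul]; ring_nf
    calc starCoeff t 22 p ^ 2 = |starCoeff t 22 p| * |starCoeff t 22 p| := by
          rw [← sq, sq_abs]
      _ ≤ (((p.1 + p.2 + 1 : ℕ) : ℝ) * (C * t ^ 22)) *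
          ((2 * rexp (2 * t)) ^ 22 * rexp (-(2 * t) * (p.1 + p.2 : ℕ))) :=
          mul_le_mul h1 h2 (abs_nonneg _) (by positivity)
      _ ≤ (((p.1 + p.2 + 1 : ℕ) : ℝ) ^ 2 * (C * t ^ 22)) *
          ((2 * rexp 2) ^ 22 * rexp (-(2 * t) * (p.1 + p.2 : ℕ))) := by
          gcongr
          nlinarith
      _ = _ := by
          rw [he, mul_pow (L * t ^ 11), mul_pow L, hL]; ring
  have hs := hasSum_starCoeff ht 22 hζ
  have hre : 0 ≤ 1 - ζ.re := by linarith [(abs_le.1 ((Complex.abs_re_le_norm ζ).trans hζ)).2]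
  have hb := (summable_degree_pow_mul_exp 3 ht).mul_left (L * t ^ 11)
  have h1 : (1 - ζ.re) ^ 22 * |heatDisc t ζ| ≤ L * t ^ 11 *
      ∑' p : ℕ × ℕ, ((p.1 + p.2 + 1 : ℕ) : ℝ) ^ 3 * rexp (-t * (p.1 + p.2 : ℕ)) := by
    rw [← abs_of_nonneg (pow_nonneg hre 22), ← abs_mul, ← hs.tsum_eq, ← tsum_mul_left,
      ← Real.norm_eq_abs]
    refine tsum_of_norm_bounded hb.hasSum fun p => ?_
    rw [Real.norm_eq_abs, abs_mul, abs_mul, Nat.abs_cast]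
    calc ((p.1 + p.2 + 1 : ℕ) : ℝ) * |starCoeff t 22 p| * |discRe ζ p.1 p.2|
        ≤ ((p.1 + p.2 + 1 : ℕ) : ℝ) * (L * t ^ 11 * (((p.1 + p.2 + 1 : ℕ) : ℝ) *
          rexp (-t * (p.1 + p.2 : ℕ)))) * ((p.1 + p.2 + 1 : ℕ) : ℝ) := by
          gcongr
          · exact hcoeff p
          · exact abs_discRe_le' hζ p
      _ = _ := by ring
  refine h1.trans ((mul_le_mul_of_nonneg_left (hK' t ht ht1) (by positivity)).trans (le_of_eq ?_))
  have : t ≠ 0 := ht.ne'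
  norm_num
  field_simp

/-- The subelliptic profile is the heat kernel of the disc at `ζ = cos r · e^{iθ}`. -/
theorem subellipticProfile_eq {t : ℝ} (ht : 0 < t) (r θ : ℝ) :
    subellipticProfile t r θ = heatDisc t (zeta r θ) := by
  set ζ := zeta r θ
  have hζ : ‖ζ‖ ≤ 1 := norm_zeta_le r θ
  have hs : Summable fun p : ℕ × ℕ => (((p.1 + p.2 + 1 : ℕ) : ℝ) * rexp (-lam p.1 p.2 * t) : ℂ) *
      disc ζ (conj ζ) p.1 p.2 := by
    refine Summable.of_norm_bounded
      ((summable_degree_pow_mul_exp 2 (by linarith : 0 < 2 * t))) fun p => ?_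
    have h1 := heatDisc_coeff_le ht.le p
    have h2 := norm_disc_le hζ p.1 p.2
    rw [norm_mul, ← Complex.ofReal_mul, Complex.norm_real, Real.norm_eq_abs]
    calc _ ≤ 1 * (((p.1 + p.2 + 1 : ℕ) : ℝ) ^ 1 * rexp (-(2 * t) * (p.1 + p.2 : ℕ))) *
          ((p.1 + p.2 + 1 : ℕ) : ℝ) := by
          gcongr
          push_cast; exact h2
      _ = _ := by ring
  have hs' := (modeEquiv.summable_iff).2 hs
  have e : ∀ p : ℤ × ℕ, (rexp (subEigenvalue p.2 p.1 * t) : ℂ) *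
      Complex.exp (Complex.I * p.1 * θ) * (phi p.2 p.1 r : ℂ) =
      ((fun p : ℕ × ℕ => (((p.1 + p.2 + 1 : ℕ) : ℝ) * rexp (-lam p.1 p.2 * t) : ℂ) *
      disc ζ (conj ζ) p.1 p.2) ∘ modeEquiv) p := by
    intro p
    rw [mul_assoc, exp_mul_phi, subEigenvalue_eq]
    simp only [Function.comp, ζ]
    push_cast
    ring
  have : ∑' n : ℤ, ∑' k : ℕ, (rexp (subEigenvalue k n * t) : ℂ) *
      Complex.exp (Complex.I * n * θ) * (phi k n r : ℂ) =
      ∑' p : ℕ × ℕ, (((p.1 + p.2 + 1 : ℕ) : ℝ) * rexp (-lam p.1 p.2 * t) : ℂ) *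
      disc ζ (conj ζ) p.1 p.2 := by
    rw [← modeEquiv.tsum_eq]
    refine Eq.trans ?_ (Summable.tsum_prod' hs' hs'.prod_factor).symm
    exact tsum_congr fun n => tsum_congr fun k => e (n, k)
  rw [subellipticProfile, this, Complex.re_tsum hs, heatDisc]
  refine tsum_congr fun p => ?_
  rw [← Complex.ofReal_mul, Complex.re_ofReal_mul, discRe]

end DiscHeatKernel

/-! ### The heat kernel of the sphere -/

section SphereHeatKernel

/-- The heat kernel of the unit sphere `S³` as a function of the cosine of the distance, given by
its expansion in zonal functions. -/
def heatSphere (t x : ℝ) : ℝ :=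
  ∑' m : ℕ, ((m : ℝ) + 1) * rexp (-(m * (m + 2)) * t) * (Chebyshev.U ℝ m).eval x

theorem exp_neg_mul_le {t : ℝ} (ht : 0 ≤ t) (m : ℕ) :
    rexp (-((m : ℝ) * (m + 2)) * t) ≤ rexp (-(2 * t) * m) := by
  apply Real.exp_le_exp.2
  have := Nat.cast_nonneg (α := ℝ) m
  nlinarith [mul_nonneg (mul_nonneg this this) ht]

theorem heatSphere_term_le {t : ℝ} (ht : 0 ≤ t) (m : ℕ) {x : ℝ} (hx : |x| ≤ 1) :
    ‖((m : ℝ) + 1) * rexp (-(m * (m + 2)) * t) * (Chebyshev.U ℝ m).eval x‖ ≤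
      ((m : ℝ) + 1) ^ 2 * rexp (-(2 * t) * m) := by
  rw [norm_mul, norm_mul, Real.norm_of_nonneg (by positivity), Real.norm_of_nonneg (by positivity)]
  calc ((m : ℝ) + 1) * rexp (-(m * (m + 2)) * t) * ‖(Chebyshev.U ℝ m).eval x‖
      ≤ ((m : ℝ) + 1) * rexp (-(2 * t) * m) * ((m : ℝ) + 1) := by
        refine mul_le_mul (mul_le_mul_of_nonneg_left (exp_neg_mul_le ht m) (by positivity))
          (abs_chebyshevU_le hx m) (norm_nonneg _) (by positivity)
    _ = _ := by ring

theorem hasSum_heatSphere {t : ℝ} (ht : 0 < t) {x : ℝ} (hx : |x| ≤ 1) :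
    HasSum (fun m : ℕ => ((m : ℝ) + 1) * rexp (-(m * (m + 2)) * t) * (Chebyshev.U ℝ m).eval x)
      (heatSphere t x) :=
  (Summable.of_norm_bounded (summable_succ_pow_mul_exp 2 (by linarith : 0 < 2 * t))
    fun m => heatSphere_term_le ht.le m hx).hasSum

theorem continuousOn_heatSphere {t : ℝ} (ht : 0 < t) :
    ContinuousOn (heatSphere t) (Icc (-1) 1) := by
  unfold heatSphere
  refine continuousOn_tsum (fun m => ?_) (summable_succ_pow_mul_exp 2 (by linarith : 0 < 2 * t))
    fun m x hx => heatSphere_term_le ht.le m (abs_le.2 hx)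
  fun_prop

/-- The theta identity: the Gaussian sum is dual to the sum over the spectrum. -/
theorem hasSum_sin_theta {t : ℝ} (ht : 0 < t) (φ : ℝ) :
    HasSum (fun n : ℕ => (n : ℝ) * rexp (-n ^ 2 * t) * sin (n * φ))
      (√π / (4 * t ^ (3 / 2 : ℝ)) *
        ∑' k : ℤ, (φ + 2 * k * π) * rexp (-(φ + 2 * k * π) ^ 2 / (4 * t))) := by
  have hπ := pi_pos
  set a : ℝ := φ / (2 * π) with ha
  have h1 := HurwitzZeta.hasSum_nat_sinKernel a (div_pos ht hπ)
  have h2 := HurwitzZeta.hasSum_int_oddKernel a (div_pos hπ ht)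
  have h3 := HurwitzZeta.oddKernel_functional_equation a (π / t)
  rw [one_div_div] at h3
  have e2 : HasSum (fun k : ℤ => (φ + 2 * k * π) * rexp (-(φ + 2 * k * π) ^ 2 / (4 * t)))
      (2 * π * HurwitzZeta.oddKernel a (π / t)) := by
    refine (h2.mul_left (2 * π)).congr_fun fun k => ?_
    have e : φ + 2 * k * π = 2 * π * (k + a) := by rw [ha]; field_simp; ring
    rw [e, mul_assoc]
    congr 3
    field_simp
    ring
  rw [e2.tsum_eq, h3]
  have e3 : √π / (4 * t ^ (3 / 2 : ℝ)) * (2 * π * (1 / (π / t) ^ (3 / 2 : ℝ) *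
      HurwitzZeta.sinKernel a (t / π))) = 1 / 2 * HurwitzZeta.sinKernel a (t / π) := by
    have hp : π ^ (3 / 2 : ℝ) = π * √π := by
      rw [show (3 / 2 : ℝ) = 1 + 1 / 2 by norm_num, Real.rpow_add hπ, Real.rpow_one,
        Real.sqrt_eq_rpow]
    have ht' : t ^ (3 / 2 : ℝ) ≠ 0 := (Real.rpow_pos_of_pos ht _).ne'
    have hs : √π ≠ 0 := (sqrt_pos.2 hπ).ne'
    rw [Real.div_rpow hπ.le ht.le, hp]
    field_simp
    ring
  rw [e3]
  refine (h1.mul_left (1 / 2)).congr_fun fun n => ?_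
  have e4 : 2 * π * a * n = n * φ := by rw [ha]; field_simp
  have e5 : -π * (n : ℝ) ^ 2 * (t / π) = -n ^ 2 * t := by field_simp
  rw [e4, e5]; ring

/-- The closed formula agrees with the zonal expansion: on `(-1, 1)` by the functional equation of
the theta function, at the end points by continuity. -/
theorem riemProfile_eq {t : ℝ} (ht : 0 < t) {x : ℝ} (hx : x ∈ Icc (-1 : ℝ) 1) :
    riemProfile t x = heatSphere t x := by
  have key : ∀ y ∈ Ioo (-1 : ℝ) 1, heatSphere t y =
      √π * rexp t / (4 * t ^ (3 / 2 : ℝ)) * (1 / √(1 - y ^ 2)) *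
      ∑' k : ℤ, (arccos y + 2 * k * π) * rexp (-(arccos y + 2 * k * π) ^ 2 / (4 * t)) := by
    intro y hy
    have hs : sin (arccos y) = √(1 - y ^ 2) := sin_arccos y
    have hpos : 0 < √(1 - y ^ 2) := sqrt_pos.2 (by nlinarith [hy.1, hy.2])
    have h1 := (hasSum_nat_add_iff' 1).2 (hasSum_sin_theta ht (arccos y))
    have h2 := h1.mul_left (rexp t / √(1 - y ^ 2))
    refine HasSum.unique (hasSum_heatSphere ht (abs_le.2 (Ioo_subset_Icc_self hy))) ?_
    simp only [Finset.range_one, Finset.sum_singleton, Nat.cast_zero, zero_mul, sub_zero] at h2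
    rw [show ∀ a b c d : ℝ, a * b / c * (1 / d) = b / d * (a / c) from fun a b c d => by ring,
      mul_assoc]
    refine h2.congr_fun fun m => ?_
    have hU := Polynomial.Chebyshev.U_real_cos (arccos y) m
    rw [cos_arccos hy.1.le hy.2.le, hs] at hU
    have e : rexp (-((m : ℝ) * (m + 2)) * t) = rexp t * rexp (-((m + 1 : ℕ) : ℝ) ^ 2 * t) := by
      rw [← Real.exp_add]; push_cast; ring_nf
    have hU' : (Chebyshev.U ℝ m).eval y = sin (((m : ℝ) + 1) * arccos y) / √(1 - y ^ 2) := by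
      rw [eq_div_iff hpos.ne']; exact_mod_cast hU
    rw [hU', e]; push_cast; ring
  refine extendFrom_eq ?_ ?_
  · rw [closure_Ioo (by norm_num)]; exact hx
  · have hc := (continuousOn_heatSphere ht x hx).mono_left
      (nhdsWithin_mono x (Ioo_subset_Icc_self (a := (-1 : ℝ)) (b := 1)))
    refine Tendsto.congr' ?_ hc
    filter_upwards [self_mem_nhdsWithin] with y hy using key y hy

theorem chebyshevU_ode (m : ℕ) (x : ℝ) : (1 - x ^ 2) * (derivative (derivative
    (Chebyshev.U ℝ m))).eval x - 3 * x * (derivative (Chebyshev.U ℝ m)).eval x =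
    -((m * (m + 2) : ℝ) * (Chebyshev.U ℝ m).eval x) := by
  have h := congrArg (eval x)
    (Chebyshev.one_sub_X_sq_mul_derivative_derivative_U_eq_poly_in_U (R := ℝ) m)
  simp at h
  linarith

/-- The heat semigroup on zonal functions of `S³` preserves positivity. -/
theorem sphere_heat_nonneg (s : Finset ℕ) (c : ℕ → ℝ)
    (h0 : ∀ x ∈ Icc (-1 : ℝ) 1, 0 ≤ ∑ m ∈ s, c m * (Chebyshev.U ℝ m).eval x) {t : ℝ} (ht : 0 ≤ t)
    {x : ℝ} (hx : x ∈ Icc (-1 : ℝ) 1) :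
    0 ≤ ∑ m ∈ s, c m * rexp (-((m : ℝ) * (m + 2)) * t) * (Chebyshev.U ℝ m).eval x := by
  refine heat_nonneg isCompact_Icc s (φ := fun (m : ℕ) x => (Chebyshev.U ℝ m).eval x)
    (fun m => Polynomial.continuous _) (l := fun m => (m : ℝ) * (m + 2)) ?_ c h0 ht hx
  intro c x hx hmin
  set f : ℝ[X] := ∑ m ∈ s, C (c m) * Chebyshev.U ℝ m with hf
  have hfe : ∀ y, ∑ m ∈ s, c m * (Chebyshev.U ℝ m).eval y = f.eval y := fun y => by
    simp [hf, eval_finsetSum]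
  have hode : (1 - x ^ 2) * (derivative (derivative f)).eval x - 3 * x * (derivative f).eval x =
      -∑ m ∈ s, c m * ((m : ℝ) * (m + 2) * (Chebyshev.U ℝ m).eval x) := by
    simp only [hf, derivative_sum, derivative_C_mul, eval_finsetSum, eval_mul, eval_C,
      Finset.mul_sum, ← Finset.sum_sub_distrib, ← Finset.sum_neg_distrib]
    refine Finset.sum_congr rfl fun m _ => ?_
    linear_combination c m * chebyshevU_ode m x
  simp only [hfe] at hmin
  have hs0 : 0 ≤ 1 - x ^ 2 := by nlinarith [hx.1, hx.2]
  set r := √(1 - x ^ 2)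
  have hr2 : r ^ 2 = 1 - x ^ 2 := sq_sqrt hs0
  -- move along the circle through the points with first coordinate `x`
  set k : ℝ → ℝ := fun ε => cos ε * x + sin ε * r with hk
  have hk0 : k 0 = x := by simp [hk]
  have hk1 : ∀ ε, HasDerivAt k (-sin ε * x + cos ε * r) ε := fun ε =>
    ((hasDerivAt_cos ε).mul_const _).add ((hasDerivAt_sin ε).mul_const _)
  have hkI : ∀ ε, k ε ∈ Icc (-1 : ℝ) 1 := fun ε => by
    refine abs_le.1 (abs_le_of_sq_le_sq ?_ zero_le_one)
    have := sq_nonneg (sin ε * x - cos ε * r)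
    have h1 := sin_sq_add_cos_sq ε
    simp only [hk]
    have : (cos ε * x + sin ε * r) ^ 2 + (sin ε * x - cos ε * r) ^ 2 =
      (sin ε ^ 2 + cos ε ^ 2) * (x ^ 2 + r ^ 2) := by ring
    rw [h1, hr2] at this
    linarith
  have hg : ∀ ε, HasDerivAt (fun ε => f.eval (k ε))
      ((derivative f).eval (k ε) * (-sin ε * x + cos ε * r)) ε := fun ε =>
    (f.hasDerivAt (k ε)).comp ε (hk1 ε)
  have hmin' : IsLocalMin (fun ε => f.eval (k ε)) 0 :=
    Eventually.of_forall fun ε => by simpa [hk0] using hmin (k ε) (hkI ε)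
  have hd1 := hmin'.hasDerivAt_eq_zero (hg 0)
  have hk2 : HasDerivAt (fun ε => -sin ε * x + cos ε * r) (-x) 0 :=
    (((hasDerivAt_sin 0).neg.mul_const _).add
      ((hasDerivAt_cos 0).mul_const _)).congr_deriv (by simp)
  have hd2 := second_deriv_nonneg hg
    ((((derivative f).hasDerivAt (k 0)).comp 0 (hk1 0)).mul hk2) hmin'
  simp only [hk0, Function.comp, sin_zero, cos_zero, neg_zero, zero_mul, zero_add, one_mul,
    mul_eq_zero] at hd1 hd2
  have hx' : 0 ≤ -x * (derivative f).eval x := by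
    rcases hd1 with h | h
    · rw [h]; simp
    · rw [h] at hd2; linarith
  have hd3 : (derivative (derivative f)).eval x * r * r =
      (1 - x ^ 2) * (derivative (derivative f)).eval x := by rw [← hr2]; ring
  linarith

/-- The expansion of the heat kernel of `S³` in the disc polynomials. -/
theorem hasSum_heatSphere_disc {t : ℝ} (ht : 0 < t) {ζ : ℂ} (hζ : ‖ζ‖ ≤ 1) :
    HasSum (fun p : ℕ × ℕ => (((p.1 + p.2 + 1 : ℕ) : ℝ) *
      rexp (-(((p.1 + p.2 : ℕ) : ℝ) * ((p.1 + p.2 : ℕ) + 2)) * t) : ℂ) *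
        disc ζ (conj ζ) p.1 p.2) (heatSphere t ζ.re : ℂ) := by
  have hs : Summable fun p : ℕ × ℕ => (((p.1 + p.2 + 1 : ℕ) : ℝ) *
      rexp (-(((p.1 + p.2 : ℕ) : ℝ) * ((p.1 + p.2 : ℕ) + 2)) * t) : ℂ) *
        disc ζ (conj ζ) p.1 p.2 := by
    refine Summable.of_norm_bounded
      ((summable_degree_pow_mul_exp 2 (by linarith : 0 < 2 * t))) fun p => ?_
    have h1 := exp_neg_mul_le ht.le (p.1 + p.2)
    have h2 := norm_disc_le hζ p.1 p.2
    rw [norm_mul, ← Complex.ofReal_mul, Complex.norm_real, Real.norm_of_nonneg (by positivity)]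
    calc _ ≤ ((p.1 + p.2 + 1 : ℕ) : ℝ) * rexp (-(2 * t) * (p.1 + p.2 : ℕ)) *
          ((p.1 + p.2 + 1 : ℕ) : ℝ) := by
          gcongr
          push_cast; exact h2
      _ = _ := by ring
  obtain ⟨S, hS⟩ := hs
  have h1 := (Finset.HasAntidiagonal.sigmaAntidiagonalEquivProd.hasSum_iff).2 hS
  have h2 := h1.sigma fun m => (Finset.hasSum (Finset.HasAntidiagonal.antidiagonal m)
    fun p : ℕ × ℕ => (((p.1 + p.2 + 1 : ℕ) : ℝ) *
      rexp (-(((p.1 + p.2 : ℕ) : ℝ) * ((p.1 + p.2 : ℕ) + 2)) * t) : ℂ) *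
        disc ζ (conj ζ) p.1 p.2)
  have hre : |ζ.re| ≤ 1 := (Complex.abs_re_le_norm ζ).trans hζ
  have h3 := (Complex.hasSum_ofReal.2 (hasSum_heatSphere ht hre))
  have : S = (heatSphere t ζ.re : ℂ) := by
    refine h2.unique (h3.congr_fun fun m => ?_)
    have hd := sum_disc_eq_chebyshev (z := ζ) (w := conj ζ) (u := (ζ.re : ℂ))
      (by rw [Complex.add_conj]; push_cast; ring) m
    have hc : (((Chebyshev.U ℝ m).eval ζ.re : ℝ) : ℂ) = (Chebyshev.U ℂ m).eval (ζ.re : ℂ) := by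
      simp
    rw [Complex.ofReal_mul, hc, ← hd, Finset.mul_sum]
    refine Finset.sum_congr rfl fun p hp => ?_
    rw [Finset.HasAntidiagonal.mem_antidiagonal] at hp
    rw [hp, ← hp]
    push_cast; ring
  rwa [← this]

/-- The double series for the Riemannian heat kernel. -/
theorem hasSum_riemProfile {t : ℝ} (ht : 0 < t) (r θ : ℝ) :
    HasSum (fun nk : ℤ × ℕ => (rexp (riemEigenvalue nk.2 nk.1 * t) : ℂ) *
      Complex.exp (Complex.I * nk.1 * θ) * (phi nk.2 nk.1 r : ℂ))
      (riemProfile t (cos (delta r θ)) : ℂ) := by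
  have hre : |cos r * cos θ| ≤ 1 := by
    rw [← zeta_re]; exact (Complex.abs_re_le_norm _).trans (norm_zeta_le r θ)
  have hc : cos (delta r θ) = (zeta r θ).re := by
    rw [delta, cos_arccos (abs_le.1 hre).1 (abs_le.1 hre).2, zeta_re]
  rw [hc, riemProfile_eq ht (by rw [zeta_re]; exact abs_le.1 hre)]
  refine ((modeEquiv.hasSum_iff).2 (hasSum_heatSphere_disc ht (norm_zeta_le r θ))).congr_fun
    fun p => ?_
  rw [mul_assoc, exp_mul_phi, riemEigenvalue_eq]
  simp only [Function.comp]
  push_cast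
  ring

end SphereHeatKernel

/-! ### Spectral projections of the disc -/

section Levels

/-- The eigenvalue `lam i j` is twice this natural number. -/
def level (p : ℕ × ℕ) : ℕ := 2 * p.1 * p.2 + p.1 + p.2

/-- The indices of the disc polynomials in one eigenspace. -/
def modes (N : ℕ) : Finset (ℕ × ℕ) :=
  (Finset.range (N + 1) ×ˢ Finset.range (N + 1)).filter fun p => level p = N

theorem mem_modes {N : ℕ} {p : ℕ × ℕ} : p ∈ modes N ↔ level p = N := by
  rw [modes, Finset.mem_filter, Finset.mem_product, Finset.mem_range, Finset.mem_range,
    and_iff_right_iff_imp, level]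
  intro h
  have := Nat.zero_le (2 * p.1 * p.2)
  omega

theorem degree_le_level (p : ℕ × ℕ) : p.1 + p.2 ≤ level p := by
  have := Nat.zero_le (2 * p.1 * p.2)
  rw [level]; omega

theorem lam_eq_level (p : ℕ × ℕ) : lam p.1 p.2 = 2 * (level p : ℝ) := by
  rw [lam, level]; push_cast; ring

/-- The spectral projection kernel of the disc at the eigenvalue `2N`, with pole `1`. -/
def psi (N : ℕ) (ζ : ℂ) : ℝ := ∑ p ∈ modes N, ((p.1 + p.2 + 1 : ℕ) : ℝ) * discRe ζ p.1 p.2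

theorem modes_zero : modes 0 = {(0, 0)} := by decide

theorem modes_one : modes 1 = {(0, 1), (1, 0)} := by decide

theorem modes_two : modes 2 = {(0, 2), (2, 0)} := by decide

theorem psi_zero (ζ : ℂ) : psi 0 ζ = 1 := by simp [psi, modes_zero]

theorem psi_one (ζ : ℂ) : psi 1 ζ = 4 * ζ.re := by
  rw [psi, modes_one, Finset.sum_pair (by simp), discRe_swap ζ 1 0, discRe_zero_left]
  push_cast; rw [pow_one]; ring

theorem psi_two (ζ : ℂ) : psi 2 ζ = 6 * (ζ.re ^ 2 - ζ.im ^ 2) := by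
  rw [psi, modes_two, Finset.sum_pair (by simp), discRe_swap ζ 2 0, discRe_zero_left, sq,
    Complex.mul_re]
  push_cast; ring

theorem continuous_psi (N : ℕ) : Continuous (psi N) := by
  unfold psi
  exact continuous_finsetSum _ fun p _ => (continuous_discRe p.1 p.2).const_mul _

theorem abs_psi_le {ζ : ℂ} (hζ : ‖ζ‖ ≤ 1) (N : ℕ) : |psi N ζ| ≤ ((N : ℝ) + 1) ^ 4 := by
  have h1 : ∀ p ∈ modes N, |((p.1 + p.2 + 1 : ℕ) : ℝ) * discRe ζ p.1 p.2| ≤ ((N : ℝ) + 1) ^ 2 := by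
    intro p hp
    have hd : ((p.1 + p.2 + 1 : ℕ) : ℝ) ≤ (N : ℝ) + 1 := by
      have := degree_le_level p
      rw [mem_modes.1 hp] at this
      exact_mod_cast Nat.succ_le_succ this
    rw [abs_mul, Nat.abs_cast, sq]
    exact mul_le_mul hd ((abs_discRe_le' hζ p).trans hd) (abs_nonneg _) (by positivity)
  have hcard : ((modes N).card : ℝ) ≤ ((N : ℝ) + 1) ^ 2 := by
    have := Finset.card_filter_le (Finset.range (N + 1) ×ˢ Finset.range (N + 1))
      fun p => level p = N
    rw [Finset.card_product, Finset.card_range] at this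
    rw [sq]; exact_mod_cast this
  calc |psi N ζ| ≤ ∑ p ∈ modes N, ((N : ℝ) + 1) ^ 2 :=
        (Finset.abs_sum_le_sum_abs _ _).trans (Finset.sum_le_sum h1)
    _ = (modes N).card * ((N : ℝ) + 1) ^ 2 := by rw [Finset.sum_const, nsmul_eq_mul]
    _ ≤ ((N : ℝ) + 1) ^ 2 * ((N : ℝ) + 1) ^ 2 := by gcongr
    _ = _ := by ring

/-- The heat kernel of the disc is a power series in `e^{-2t}`. -/
theorem hasSum_psi {t : ℝ} (ht : 0 < t) {ζ : ℂ} (hζ : ‖ζ‖ ≤ 1) :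
    HasSum (fun N : ℕ => psi N ζ * rexp (-(2 * N) * t)) (heatDisc t ζ) := by
  have h1 := ((Equiv.sigmaFiberEquiv level).hasSum_iff).2 (hasSum_heatDisc ht hζ)
  refine h1.sigma fun N => ?_
  have h2 := (modes N).hasSum fun p : ℕ × ℕ => ((p.1 + p.2 + 1 : ℕ) : ℝ) *
    rexp (-lam p.1 p.2 * t) * discRe ζ p.1 p.2
  have h3 := ((Equiv.subtypeEquivRight (p := fun p => level p = N) (q := fun p => p ∈ modes N)
    fun p => mem_modes.symm).hasSum_iff).2 h2
  have h4 : psi N ζ * rexp (-(2 * N) * t) = ∑ p ∈ modes N, ((p.1 + p.2 + 1 : ℕ) : ℝ) *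
      rexp (-lam p.1 p.2 * t) * discRe ζ p.1 p.2 := by
    rw [psi, Finset.sum_mul]
    refine Finset.sum_congr rfl fun p hp => ?_
    rw [lam_eq_level, mem_modes.1 hp]
    ring
  rw [h4]
  exact h3

theorem heatDisc_conj (t : ℝ) (ζ : ℂ) : heatDisc t (conj ζ) = heatDisc t ζ := by
  refine tsum_congr fun p => ?_
  have : discRe (conj ζ) p.1 p.2 = discRe ζ p.1 p.2 := by
    rw [discRe_swap, discRe, discRe, Complex.conj_conj, disc_swap]
  rw [this]

theorem continuousOn_heatDisc {t : ℝ} (ht : 0 < t) :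
    ContinuousOn (heatDisc t) (Metric.closedBall 0 1) := by
  unfold heatDisc
  refine continuousOn_tsum (fun p => ?_)
    ((summable_degree_pow_mul_exp 2 (by linarith : 0 < 2 * t))) fun p ζ hζ => ?_
  · exact ((continuous_discRe p.1 p.2).const_mul _).continuousOn
  · rw [norm_mul, Real.norm_eq_abs, Real.norm_eq_abs]
    calc _ ≤ 1 * (((p.1 + p.2 + 1 : ℕ) : ℝ) ^ 1 * rexp (-(2 * t) * (p.1 + p.2 : ℕ))) *
          ((p.1 + p.2 + 1 : ℕ) : ℝ) := by
          refine mul_le_mul (heatDisc_coeff_le ht.le p) (abs_discRe_le' ?_ p) (abs_nonneg _)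
            (by positivity)
          simpa using hζ
      _ = _ := by ring

end Levels

/-! ### Uniqueness of exponential series -/

section ExponentialSeries

variable {a : ℕ → ℝ} {B : ℝ} {k : ℕ}

theorem summable_exp_series (h : ∀ N, |a N| ≤ B * ((N : ℝ) + 1) ^ k) {t : ℝ} (ht : 0 < t) :
    Summable fun N : ℕ => a N * rexp (-(2 * N) * t) := by
  refine Summable.of_norm_bounded
    ((summable_succ_pow_mul_exp k (by linarith : 0 < 2 * t)).mul_left B) fun N => ?_
  rw [norm_mul, Real.norm_of_nonneg (exp_pos _).le, ← mul_assoc,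
    show -(2 * (N : ℝ)) * t = -(2 * t) * N by ring]
  exact mul_le_mul_of_nonneg_right (h N) (exp_pos _).le

theorem tendsto_exp_series (h : ∀ N, |a N| ≤ B * ((N : ℝ) + 1) ^ k) :
    Tendsto (fun n : ℕ => ∑' N : ℕ, a N * rexp (-(2 * N) * n)) atTop (𝓝 (a 0)) := by
  have h0 : a 0 = ∑' N : ℕ, if N = 0 then a 0 else 0 := by
    rw [tsum_ite_eq]
  rw [h0]
  refine tendsto_tsum_of_dominated_convergence
    ((summable_succ_pow_mul_exp k (by norm_num : (0 : ℝ) < 2)).mul_left B) (fun N => ?_) ?_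
  · rcases N with _ | N
    · simp
    · simp only [Nat.add_one_ne_zero, if_false]
      rw [← mul_zero (a (N + 1))]
      refine Tendsto.const_mul _ (Real.tendsto_exp_atBot.comp ?_)
      refine Tendsto.const_mul_atTop_of_neg ?_ tendsto_natCast_atTop_atTop
      push_cast; linarith [Nat.cast_nonneg (α := ℝ) N]
  · filter_upwards [eventually_ge_atTop 1] with n hn N
    rw [norm_mul, Real.norm_of_nonneg (exp_pos _).le, ← mul_assoc]
    refine mul_le_mul (h N) (Real.exp_le_exp.2 ?_) (exp_pos _).le ((abs_nonneg _).trans (h N))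
    have : (1 : ℝ) ≤ n := by exact_mod_cast hn
    nlinarith [Nat.cast_nonneg (α := ℝ) N]

/-- The coefficients of a power series in `e^{-2t}` are recovered from its values at the positive
integers. -/
theorem tendsto_exp_series_coeff (h : ∀ N, |a N| ≤ B * ((N : ℝ) + 1) ^ k) {F : ℕ → ℝ}
    (hF : ∀ n : ℕ, 0 < n → HasSum (fun N : ℕ => a N * rexp (-(2 * N) * n)) (F n)) (K : ℕ) :
    Tendsto (fun n : ℕ => rexp (2 * K * n) *
      (F n - ∑ N ∈ Finset.range K, a N * rexp (-(2 * N) * n))) atTop (𝓝 (a K)) := by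
  have hB : 0 ≤ B := by simpa using (abs_nonneg _).trans (h 0)
  have h' : ∀ N, |a (N + K)| ≤ (B * (K + 1) ^ k) * ((N : ℝ) + 1) ^ k := fun N => by
    refine (h (N + K)).trans ?_
    rw [mul_assoc, ← mul_pow]
    refine mul_le_mul_of_nonneg_left (pow_le_pow_left₀ (by positivity) ?_ k) hB
    push_cast
    nlinarith [mul_nonneg (Nat.cast_nonneg (α := ℝ) N) (Nat.cast_nonneg (α := ℝ) K)]
  have ht := tendsto_exp_series h'
  rw [zero_add] at ht
  refine ht.congr' ?_
  filter_upwards [eventually_ge_atTop 1] with n hn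
  have h1 := ((hasSum_nat_add_iff' K).2 (hF n hn)).mul_left (rexp (2 * K * n))
  rw [← h1.tsum_eq]
  refine tsum_congr fun N => ?_
  have : rexp (-(2 * (N : ℝ)) * n) = rexp (2 * K * n) * rexp (-(2 * ((N + K : ℕ) : ℝ)) * n) := by
    rw [← Real.exp_add]; push_cast; ring_nf
  rw [this]; ring

theorem exp_series_unique {b : ℕ → ℝ} (ha : ∀ N, |a N| ≤ B * ((N : ℝ) + 1) ^ k)
    (hb : ∀ N, |b N| ≤ B * ((N : ℝ) + 1) ^ k) {F : ℕ → ℝ}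
    (hF : ∀ n : ℕ, 0 < n → HasSum (fun N : ℕ => a N * rexp (-(2 * N) * n)) (F n))
    (hF' : ∀ n : ℕ, 0 < n → HasSum (fun N : ℕ => b N * rexp (-(2 * N) * n)) (F n)) (K : ℕ) :
    a K = b K := by
  induction K using Nat.strong_induction_on with
  | _ K ih =>
    refine tendsto_nhds_unique (tendsto_exp_series_coeff ha hF K) ?_
    refine (tendsto_exp_series_coeff hb hF' K).congr fun n => ?_
    rw [Finset.sum_congr rfl fun N hN => by rw [← ih N (Finset.mem_range.1 hN)]]

end ExponentialSeries

/-! ### Measurability of the disc coordinate -/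

theorem tendsto_psi {ζ : ℂ} (hζ : ‖ζ‖ ≤ 1) (K : ℕ) :
    Tendsto (fun n : ℕ => rexp (2 * K * n) *
      (heatDisc n ζ - ∑ N ∈ Finset.range K, psi N ζ * rexp (-(2 * N) * n))) atTop
      (𝓝 (psi K ζ)) :=
  tendsto_exp_series_coeff (B := 1) (k := 4) (fun N => by rw [one_mul]; exact abs_psi_le hζ N)
    (fun n hn => hasSum_psi (by exact_mod_cast hn) hζ) K

/-- The spectral projection kernels are measurable as soon as the heat kernel is. -/
theorem measurable_psi {X : Type*} [MeasurableSpace X] {z : X → ℂ} (hz : ∀ x, ‖z x‖ ≤ 1)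
    (h : ∀ t : ℝ, 0 < t → Measurable fun x => heatDisc t (z x)) (K : ℕ) :
    Measurable fun x => psi K (z x) := by
  induction K using Nat.strong_induction_on with
  | _ K ih =>
    have h1 : Tendsto (fun (n : ℕ) x => rexp (2 * K * (n + 1 : ℕ)) * (heatDisc (n + 1 : ℕ) (z x) -
        ∑ N ∈ Finset.range K, psi N (z x) * rexp (-(2 * N) * (n + 1 : ℕ)))) atTop
        (𝓝 fun x => psi K (z x)) :=
      tendsto_pi_nhds.2 fun x => (tendsto_psi (hz x) K).comp (tendsto_add_atTop_nat 1)
    refine measurable_of_tendsto_metrizable (fun n => ?_) h1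
    refine ((h _ (by positivity)).sub ?_).const_mul _
    exact Finset.measurable_fun_sum _ fun N hN => (ih N (Finset.mem_range.1 hN)).mul_const _

/-- The representative of `ζ` modulo complex conjugation in the upper half plane. -/
def fold (ζ : ℂ) : ℂ := ⟨ζ.re, |ζ.im|⟩

theorem fold_eq (ζ : ℂ) : fold ζ = ζ ∨ fold ζ = conj ζ := by
  rcases abs_choice ζ.im with h | h
  · left; rw [fold, h]
  · right; rw [fold, h]; rfl

theorem norm_fold (ζ : ℂ) : ‖fold ζ‖ = ‖ζ‖ := by
  rcases fold_eq ζ with h | h <;> rw [h]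
  exact Complex.norm_conj ζ

theorem heatDisc_fold (t : ℝ) (ζ : ℂ) : heatDisc t (fold ζ) = heatDisc t ζ := by
  rcases fold_eq ζ with h | h <;> rw [h]
  exact heatDisc_conj t ζ

/-- The heat kernel determines `Re ζ` and `|Im ζ|` measurably, through the first two spectral
projections `4 Re ζ` and `6 Re ζ²`. -/
theorem measurable_fold {X : Type*} [MeasurableSpace X] {z : X → ℂ} (hz : ∀ x, ‖z x‖ ≤ 1)
    (h : ∀ t : ℝ, 0 < t → Measurable fun x => heatDisc t (z x)) :
    Measurable fun x => fold (z x) := by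
  have h1 := (measurable_psi hz h 1).div_const 4
  have h2 := (measurable_psi hz h 2).div_const 6
  simp only [psi_one, psi_two] at h1 h2
  have hre : Measurable fun x => (z x).re := by convert h1 using 2; ring
  have him : Measurable fun x => |(z x).im| := by
    have := ((hre.pow_const 2).sub h2).sqrt
    convert this using 2 with x
    rw [← Real.sqrt_sq_eq_abs]; congr 1; simp only [Pi.sub_apply]; ring
  have : (fun x => fold (z x)) = fun x => ((z x).re : ℂ) + (|(z x).im| : ℝ) * Complex.I := by
    funext x; apply Complex.ext <;> simp [fold]
  rw [this]
  exact (Complex.measurable_ofReal.comp hre).add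
    ((Complex.measurable_ofReal.comp him).mul_const _)

/-! ### Moments of the law of the disc coordinate -/

section Moments

variable (ν : Measure ℂ)

theorem integrable_of_continuous_of_disc {ν : Measure ℂ} [IsFiniteMeasure ν]
    (hν : ∀ᵐ ζ ∂ν, ‖ζ‖ ≤ 1) {h : ℂ → ℝ} (hh : Continuous h) : Integrable h ν := by
  obtain ⟨B, hB⟩ := (isCompact_closedBall (0 : ℂ) 1).exists_bound_of_continuousOn hh.continuousOn
  refine Integrable.of_bound hh.aestronglyMeasurable B ?_
  filter_upwards [hν] with ζ hζ using hB ζ (by simpa using hζ)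

/-- The product whose integral is the correlation of two disc polynomials. -/
def corrFun (a b : ℕ × ℕ) (ζ : ℂ) : ℝ :=
  (disc ζ (conj ζ) a.1 a.2 * conj (disc ζ (conj ζ) b.1 b.2)).re

/-- The correlation of two disc polynomials under a measure on the disc. -/
def corr (a b : ℕ × ℕ) : ℝ := ∫ ζ, corrFun a b ζ ∂ν

theorem continuous_corrFun (a b : ℕ × ℕ) : Continuous (corrFun a b) := by
  have h1 := fun a : ℕ × ℕ =>
    continuous_disc (continuous_id (X := ℂ)) Complex.continuous_conj a.1 a.2
  exact Complex.continuous_re.comp ((h1 a).mul (Complex.continuous_conj.comp (h1 b)))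

theorem corr_comm (a b : ℕ × ℕ) : corr ν a b = corr ν b a := by
  refine integral_congr_ae (Eventually.of_forall fun ζ => ?_)
  simp only [corrFun]
  rw [← Complex.conj_re, map_mul, Complex.conj_conj, mul_comm]

theorem corr_swap (a b : ℕ × ℕ) : corr ν a.swap b.swap = corr ν a b := by
  refine integral_congr_ae (Eventually.of_forall fun ζ => ?_)
  simp only [corrFun, Prod.fst_swap, Prod.snd_swap]
  rw [← conj_disc ζ a.1 a.2, ← conj_disc ζ b.1 b.2, ← map_mul, Complex.conj_re]

theorem discRe_mul_discRe (a b : ℕ × ℕ) (ζ : ℂ) : discRe ζ a.1 a.2 * discRe ζ b.1 b.2 =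
    1 / 2 * (corrFun a b ζ + corrFun a b.swap ζ) := by
  simp only [corrFun, discRe, Prod.fst_swap, Prod.snd_swap]
  rw [← conj_disc ζ b.1 b.2, Complex.conj_conj, Complex.mul_re, Complex.mul_re, Complex.conj_re,
    Complex.conj_im]
  ring

theorem integral_discRe_mul_discRe {ν : Measure ℂ} [IsFiniteMeasure ν] (hν : ∀ᵐ ζ ∂ν, ‖ζ‖ ≤ 1)
    (a b : ℕ × ℕ) : ∫ ζ, discRe ζ a.1 a.2 * discRe ζ b.1 b.2 ∂ν =
      1 / 2 * (corr ν a b + corr ν a b.swap) := by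
  simp_rw [discRe_mul_discRe]
  rw [integral_const_mul,
    integral_add (integrable_of_continuous_of_disc hν (continuous_corrFun _ _))
    (integrable_of_continuous_of_disc hν (continuous_corrFun _ _)), corr, corr]

/-- Multiplication by `ζ` is adjoint to multiplication by its conjugate. -/
theorem corr_rel {ν : Measure ℂ} [IsFiniteMeasure ν] (hν : ∀ᵐ ζ ∂ν, ‖ζ‖ ≤ 1) (i j k l : ℕ) :
    ((k + l + 1 : ℕ) : ℝ) * ((j + 1) * corr ν (i, j + 1) (k, l) + i * corr ν (i - 1, j) (k, l)) =
      ((i + j + 1 : ℕ) : ℝ) *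
        ((k + 1) * corr ν (i, j) (k + 1, l) + l * corr ν (i, j) (k, l - 1)) := by
  have hi : ∀ a b, Integrable (corrFun a b) ν := fun a b =>
    integrable_of_continuous_of_disc hν (continuous_corrFun a b)
  simp only [corr, ← integral_const_mul]
  rw [← integral_add ((hi _ _).const_mul _) ((hi _ _).const_mul _),
    ← integral_add ((hi _ _).const_mul _) ((hi _ _).const_mul _), ← integral_const_mul,
    ← integral_const_mul]
  refine integral_congr_ae (Eventually.of_forall fun ζ => ?_)
  have h1 := mul_disc ζ (conj ζ) i j
  have h2 := congrArg conj (mul_disc' ζ (conj ζ) k l)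
  simp only [map_add, map_mul, map_natCast, Complex.conj_conj] at h2
  have h3 : ((k + l + 1 : ℕ) : ℂ) * (((j + 1 : ℕ) : ℂ) * (disc ζ (conj ζ) i (j + 1) *
      conj (disc ζ (conj ζ) k l)) + (i : ℂ) * (disc ζ (conj ζ) (i - 1) j *
      conj (disc ζ (conj ζ) k l))) = ((i + j + 1 : ℕ) : ℂ) * (((k + 1 : ℕ) : ℂ) *
      (disc ζ (conj ζ) i j * conj (disc ζ (conj ζ) (k + 1) l)) + (l : ℂ) *
      (disc ζ (conj ζ) i j * conj (disc ζ (conj ζ) k (l - 1)))) := by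
    linear_combination (-((k + l + 1 : ℕ) : ℂ) * conj (disc ζ (conj ζ) k l)) * h1 +
      ((i + j + 1 : ℕ) : ℂ) * disc ζ (conj ζ) i j * h2
  have h4 := congrArg Complex.re h3
  have hn : ∀ (n : ℕ) (x : ℂ), ((n : ℂ) * x).re = n * x.re := fun n x => by
    rw [← Complex.ofReal_natCast, Complex.re_ofReal_mul]
  simp only [hn, Complex.add_re] at h4
  simp only [corrFun]
  rw [← Nat.cast_succ, ← Nat.cast_succ]
  exact h4

/-- The correlations under the uniform measure of the disc. -/
def corrStd (a b : ℕ × ℕ) : ℝ := if a = b then 1 / ((a.1 + a.2 + 1 : ℕ) : ℝ) else 0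

theorem corrStd_comm (a b : ℕ × ℕ) : corrStd a b = corrStd b a := by
  unfold corrStd
  by_cases h : a = b
  · subst h; rfl
  · rw [if_neg h, if_neg (Ne.symm h)]

theorem corrStd_swap (a b : ℕ × ℕ) : corrStd a.swap b.swap = corrStd a b := by
  unfold corrStd
  simp only [Prod.swap_inj, Prod.fst_swap, Prod.snd_swap, add_comm a.2 a.1]

theorem corrStd_rel (i j k l : ℕ) :
    ((k + l + 1 : ℕ) : ℝ) * ((j + 1) * corrStd (i, j + 1) (k, l) + i * corrStd (i - 1, j) (k, l)) =
      ((i + j + 1 : ℕ) : ℝ) *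
        ((k + 1) * corrStd (i, j) (k + 1, l) + l * corrStd (i, j) (k, l - 1)) := by
  simp only [corrStd, Prod.mk.injEq]
  by_cases h1 : i = k ∧ j + 1 = l
  · obtain ⟨rfl, rfl⟩ := h1
    have h2 : ¬ (i - 1 = i ∧ j = j + 1) := by omega
    have h3 : ¬ (i = i + 1 ∧ j = j + 1) := by omega
    have h4 : i = i ∧ j = j + 1 - 1 := by omega
    rw [if_pos ⟨rfl, rfl⟩, if_neg h2, if_neg h3, if_pos h4]
    push_cast; field_simp; ring
  · rw [if_neg h1]
    by_cases h2 : i = k + 1 ∧ j = l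
    · obtain ⟨rfl, rfl⟩ := h2
      have h3 : k + 1 - 1 = k ∧ j = j := by omega
      have h4 : ¬ (k + 1 = k ∧ j = j - 1) := by omega
      rw [if_pos h3, if_pos ⟨rfl, rfl⟩, if_neg h4]
      push_cast; field_simp; ring
    · rw [if_neg h2]
      have h3 : (i : ℝ) * (if i - 1 = k ∧ j = l then 1 / ((i - 1 + j + 1 : ℕ) : ℝ) else 0) = 0 := by
        rcases Nat.eq_zero_or_pos i with rfl | hi
        · simp
        · rw [if_neg (by omega), mul_zero]
      have h4 : (l : ℝ) * (if i = k ∧ j = l - 1 then 1 / ((i + j + 1 : ℕ) : ℝ) else 0) = 0 := by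
        rcases Nat.eq_zero_or_pos l with rfl | hi
        · simp
        · rw [if_neg (by omega), mul_zero]
      rw [h3, h4]; ring

variable {ν}

/-- One step of the reduction of a correlation of total degree `n + 1`. -/
theorem corr_eq_move [IsFiniteMeasure ν] (hν : ∀ᵐ ζ ∂ν, ‖ζ‖ ≤ 1) {n : ℕ}
    (ih : ∀ a b : ℕ × ℕ, a.1 + a.2 + (b.1 + b.2) ≤ n → corr ν a b = corrStd a b) {i j k l : ℕ}
    (hn : i + j + (k + l) = n) (h : corr ν (i, j + 1) (k, l) = corrStd (i, j + 1) (k, l)) :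
    corr ν (i, j) (k + 1, l) = corrStd (i, j) (k + 1, l) := by
  have h1 := corr_rel hν i j k l
  rw [h, ih (i - 1, j) (k, l) (by simp only; omega), ih (i, j) (k, l - 1) (by simp only; omega),
    corrStd_rel] at h1
  have hw : ((i + j + 1 : ℕ) : ℝ) ≠ 0 := by positivity
  have h2 := add_right_cancel (mul_left_cancel₀ hw h1)
  exact (mul_left_cancel₀ (by positivity) h2).symm

/-- All correlations of total degree `n + 1` are determined by those of powers of `ζ`. -/
theorem corr_eq_of_pow [IsFiniteMeasure ν] (hν : ∀ᵐ ζ ∂ν, ‖ζ‖ ≤ 1) {n : ℕ}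
    (ih : ∀ a b : ℕ × ℕ, a.1 + a.2 + (b.1 + b.2) ≤ n → corr ν a b = corrStd a b) (i j k l : ℕ)
    (hn : i + j + (k + l) = n + 1)
    (h : corr ν (0, j + k) (0, i + l) = corrStd (0, j + k) (0, i + l)) :
    corr ν (i, j) (k, l) = corrStd (i, j) (k, l) := by
  induction i generalizing j k l with
  | zero =>
    induction k generalizing j l with
    | zero => simpa using h
    | succ k ihk =>
      refine corr_eq_move hν ih (by omega) (ihk (j + 1) l (by omega) ?_)
      rw [add_assoc, add_comm 1 k]; exact h
  | succ i ihi =>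
    rw [corr_comm, corrStd_comm]
    refine corr_eq_move hν ih (by omega) ?_
    rw [corr_comm, corrStd_comm]
    refine ihi j k (l + 1) (by omega) ?_
    rw [show i + (l + 1) = i + 1 + l by omega]; exact h

theorem level_swap (c : ℕ × ℕ) : level c.swap = level c := by
  simp only [level, Prod.fst_swap, Prod.snd_swap]; ring

/-- The orthogonality of the spectral projections, in terms of correlations. -/
theorem sum_corr_sub_corrStd [IsFiniteMeasure ν] (hν : ∀ᵐ ζ ∂ν, ‖ζ‖ ≤ 1)
    (horth : ∀ N N', ∫ ζ, psi N ζ * psi N' ζ ∂ν = if N = N' then psi N 1 else 0) (N N' : ℕ) :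
    ∑ c ∈ modes N, ∑ c' ∈ modes N', ((c.1 + c.2 + 1 : ℕ) : ℝ) * ((c'.1 + c'.2 + 1 : ℕ) : ℝ) *
      (1 / 2 * ((corr ν c c' - corrStd c c') + (corr ν c c'.swap - corrStd c c'.swap))) = 0 := by
  have hi : ∀ a b : ℕ × ℕ, Integrable (fun ζ => discRe ζ a.1 a.2 * discRe ζ b.1 b.2) ν := fun a b =>
    integrable_of_continuous_of_disc hν
      ((continuous_discRe a.1 a.2).mul (continuous_discRe b.1 b.2))
  have h1 : ∫ ζ, psi N ζ * psi N' ζ ∂ν = ∑ c ∈ modes N, ∑ c' ∈ modes N',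
      ((c.1 + c.2 + 1 : ℕ) : ℝ) * ((c'.1 + c'.2 + 1 : ℕ) : ℝ) *
        (1 / 2 * (corr ν c c' + corr ν c c'.swap)) := by
    have e : ∀ ζ, psi N ζ * psi N' ζ = ∑ c ∈ modes N, ∑ c' ∈ modes N',
      ((c.1 + c.2 + 1 : ℕ) : ℝ) * ((c'.1 + c'.2 + 1 : ℕ) : ℝ) *
        (discRe ζ c.1 c.2 * discRe ζ c'.1 c'.2) := fun ζ => by
      rw [psi, psi, Finset.sum_mul_sum]
      exact Finset.sum_congr rfl fun c _ => Finset.sum_congr rfl fun c' _ => by ring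
    simp_rw [e]
    rw [integral_finsetSum _ fun c _ => integrable_finsetSum _ fun c' _ => (hi c c').const_mul _]
    refine Finset.sum_congr rfl fun c _ => ?_
    rw [integral_finsetSum _ fun c' _ => (hi c c').const_mul _]
    refine Finset.sum_congr rfl fun c' _ => ?_
    rw [integral_const_mul, integral_discRe_mul_discRe hν]
  have h2 : ∑ c ∈ modes N, ∑ c' ∈ modes N', ((c.1 + c.2 + 1 : ℕ) : ℝ) *
      ((c'.1 + c'.2 + 1 : ℕ) : ℝ) * (1 / 2 * (corrStd c c' + corrStd c c'.swap)) =
      if N = N' then psi N 1 else 0 := by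
    have h3 : ∀ c ∈ modes N, ∑ c' ∈ modes N', ((c.1 + c.2 + 1 : ℕ) : ℝ) *
        ((c'.1 + c'.2 + 1 : ℕ) : ℝ) * (1 / 2 * (corrStd c c' + corrStd c c'.swap)) =
        if N = N' then ((c.1 + c.2 + 1 : ℕ) : ℝ) else 0 := by
      intro c hc
      have hw : ((c.1 + c.2 + 1 : ℕ) : ℝ) ≠ 0 := by positivity
      have e : ∀ c' : ℕ × ℕ, ((c.1 + c.2 + 1 : ℕ) : ℝ) *
          ((c'.1 + c'.2 + 1 : ℕ) : ℝ) * (1 / 2 * (corrStd c c' + corrStd c c'.swap)) =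
          (if c = c' then 1 / 2 * ((c.1 + c.2 + 1 : ℕ) : ℝ) else 0) +
          (if c.swap = c' then 1 / 2 * ((c.1 + c.2 + 1 : ℕ) : ℝ) else 0) := by
        intro c'
        have e1 : ((c.1 + c.2 + 1 : ℕ) : ℝ) * ((c'.1 + c'.2 + 1 : ℕ) : ℝ) * (1 / 2 * corrStd c c') =
            if c = c' then 1 / 2 * ((c.1 + c.2 + 1 : ℕ) : ℝ) else 0 := by
          rw [corrStd]
          split_ifs with h
          · subst h; field_simp
          · ring
        have e2 : ((c.1 + c.2 + 1 : ℕ) : ℝ) * ((c'.1 + c'.2 + 1 : ℕ) : ℝ) *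
            (1 / 2 * corrStd c c'.swap) =
            if c.swap = c' then 1 / 2 * ((c.1 + c.2 + 1 : ℕ) : ℝ) else 0 := by
          rw [corrStd]
          by_cases h : c.swap = c'
          · subst h
            rw [Prod.swap_swap, if_pos rfl, if_pos rfl, Prod.fst_swap, Prod.snd_swap,
              add_comm c.2 c.1]
            field_simp
          · rw [if_neg h, if_neg (fun h' => h (by rw [h', Prod.swap_swap]))]; ring
        rw [← e1, ← e2]; ring
      simp_rw [e]
      rw [Finset.sum_add_distrib, Finset.sum_ite_eq, Finset.sum_ite_eq]
      simp only [mem_modes, level_swap, mem_modes.1 hc]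
      split_ifs <;> ring
    rw [Finset.sum_congr rfl h3]
    split_ifs with h
    · rw [psi]; simp only [discRe_one, mul_one]
    · simp
  rw [horth N N', ← h2] at h1
  rw [← sub_eq_zero, ← Finset.sum_sub_distrib] at h1
  rw [← neg_eq_zero, ← h1, ← Finset.sum_neg_distrib]
  refine Finset.sum_congr rfl fun c _ => ?_
  rw [← Finset.sum_sub_distrib, ← Finset.sum_neg_distrib]
  exact Finset.sum_congr rfl fun c' _ => by ring

/-- A probability measure on the disc for which the spectral projections have the same inner
products as for the uniform measure has the moments of the uniform measure. -/
theorem corr_eq_corrStd [IsProbabilityMeasure ν] (hν : ∀ᵐ ζ ∂ν, ‖ζ‖ ≤ 1)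
    (horth : ∀ N N', ∫ ζ, psi N ζ * psi N' ζ ∂ν = if N = N' then psi N 1 else 0) (a b : ℕ × ℕ) :
    corr ν a b = corrStd a b := by
  suffices H : ∀ n, ∀ a b : ℕ × ℕ, a.1 + a.2 + (b.1 + b.2) ≤ n → corr ν a b = corrStd a b from
    H _ a b le_rfl
  intro n
  induction n with
  | zero =>
    rintro ⟨i, j⟩ ⟨k, l⟩ h
    simp only at h
    obtain ⟨rfl, rfl, rfl, rfl⟩ : i = 0 ∧ j = 0 ∧ k = 0 ∧ l = 0 := by omega
    simp [corr, corrFun, corrStd]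
  | succ n ih =>
    -- in the relation for levels `N + N' = n + 1`, only the powers of `ζ` are not yet known
    have top : ∀ N N', N + N' = n + 1 → corr ν (0, N) (0, N') - corrStd (0, N) (0, N') +
        (corr ν (0, N) (N', 0) - corrStd (0, N) (N', 0)) = 0 := by
      intro N N' hN
      set X := corr ν (0, N) (0, N') - corrStd (0, N) (0, N') with hX
      set Y := corr ν (0, N) (N', 0) - corrStd (0, N) (N', 0) with hY
      have hX' : corr ν (N, 0) (N', 0) - corrStd (N, 0) (N', 0) = X := by
        rw [hX, ← corr_swap, ← corrStd_swap]; rfl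
      have hY' : corr ν (N, 0) (0, N') - corrStd (N, 0) (0, N') = Y := by
        rw [hY, ← corr_swap, ← corrStd_swap]; rfl
      have ax : ∀ K, ∀ c ∈ modes K, (c.1 = 0 ∨ c.2 = 0) → c = (0, K) ∨ c = (K, 0) := by
        rintro K ⟨i, j⟩ hc h
        rw [mem_modes, level] at hc
        simp only [Prod.mk.injEq] at hc h ⊢
        rcases h with rfl | rfl <;> simp at hc <;> omega
      have off : ∀ K, ∀ c ∈ modes K, ¬ (c.1 = 0 ∨ c.2 = 0) → c.1 + c.2 + 1 ≤ K := by
        rintro K ⟨i, j⟩ hc h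
        rw [mem_modes, level] at hc
        simp only [not_or] at hc h ⊢
        have : 0 < 2 * i * j := Nat.mul_pos (by omega) (by omega)
        omega
      have le : ∀ K, ∀ c ∈ modes K, c.1 + c.2 ≤ K := fun K c hc => by
        have := degree_le_level c
        rwa [mem_modes.1 hc] at this
      have h := sum_corr_sub_corrStd hν horth N N'
      set g : ℕ × ℕ → ℝ := fun c => if c.1 = 0 ∨ c.2 = 0 then 1 else 0 with hg
      have hterm : ∀ c ∈ modes N, ∀ c' ∈ modes N', ((c.1 + c.2 + 1 : ℕ) : ℝ) *
          ((c'.1 + c'.2 + 1 : ℕ) : ℝ) * (1 / 2 * ((corr ν c c' - corrStd c c') +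
          (corr ν c c'.swap - corrStd c c'.swap))) =
          g c * g c' * (((N + 1 : ℕ) : ℝ) * ((N' + 1 : ℕ) : ℝ) * (1 / 2 * (X + Y))) := by
        intro c hc c' hc'
        by_cases h1 : c.1 = 0 ∨ c.2 = 0
        · by_cases h2 : c'.1 = 0 ∨ c'.2 = 0
          · simp only [hg, if_pos h1, if_pos h2]
            rcases ax N c hc h1 with rfl | rfl <;> rcases ax N' c' hc' h2 with rfl | rfl <;>
              simp only [Prod.swap_prod_mk, ← hX, ← hY, hX', hY', zero_add, add_zero] <;> ring
          · have e := off N' c' hc' h2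
            have e' := le N c hc
            rw [ih c c' (by omega), ih c c'.swap (by rw [Prod.fst_swap, Prod.snd_swap]; omega)]
            simp [hg, h2]
        · have e := off N c hc h1
          have e' := le N' c' hc'
          rw [ih c c' (by omega), ih c c'.swap (by rw [Prod.fst_swap, Prod.snd_swap]; omega)]
          simp [hg, h1]
      rw [Finset.sum_congr rfl fun c hc =>
        Finset.sum_congr rfl fun c' hc' => hterm c hc c' hc'] at h
      simp_rw [← Finset.sum_mul, ← Finset.sum_mul_sum] at h
      have gpos : ∀ K, 0 < ∑ c ∈ modes K, g c := by
        intro K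
        have hmem : (0, K) ∈ modes K := by rw [mem_modes]; simp [level]
        refine Finset.sum_pos' (fun c _ => ?_) ⟨_, hmem, ?_⟩
        · simp only [hg]; split_ifs <;> norm_num
        · simp [hg]
      rcases mul_eq_zero.1 h with h | h
      · rcases mul_eq_zero.1 h with h | h
        · exact absurd h (gpos N).ne'
        · exact absurd h (gpos N').ne'
      · have hp : (0 : ℝ) < ((N + 1 : ℕ) : ℝ) * ((N' + 1 : ℕ) : ℝ) := by positivity
        have := (mul_eq_zero.1 h).resolve_left hp.ne'
        linarith
    have Z : corr ν (0, n + 1) (0, 0) = corrStd (0, n + 1) (0, 0) := by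
      have := top (n + 1) 0 rfl
      linarith
    have Y : ∀ N N', N + N' = n + 1 → corr ν (0, N) (N', 0) = corrStd (0, N) (N', 0) := by
      intro N N' hN
      refine corr_eq_of_pow hν ih 0 N N' 0 (by omega) ?_
      rw [hN]; exact Z
    rintro ⟨i, j⟩ ⟨k, l⟩ h
    simp only at h
    rcases Nat.lt_or_ge (i + j + (k + l)) (n + 1) with hlt | hge
    · exact ih _ _ (by simp only; omega)
    · refine corr_eq_of_pow hν ih i j k l (by omega) ?_
      have h1 := top (j + k) (i + l) (by omega)
      have h2 := Y (j + k) (i + l) (by omega)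
      linarith

/-- Under a measure with the moments of the uniform measure of the disc, the real part of `ζ`
follows the semicircle law: its Chebyshev polynomials are orthonormal. -/
theorem integral_chebyshevU_mul [IsFiniteMeasure ν] (hν : ∀ᵐ ζ ∂ν, ‖ζ‖ ≤ 1)
    (h : ∀ a b, corr ν a b = corrStd a b) (m l : ℕ) :
    ∫ ζ, (Chebyshev.U ℝ m).eval ζ.re * (Chebyshev.U ℝ l).eval ζ.re ∂ν = if m = l then 1 else 0 := by
  have hi : ∀ a b : ℕ × ℕ, Integrable (fun ζ => discRe ζ a.1 a.2 * discRe ζ b.1 b.2) ν := fun a b =>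
    integrable_of_continuous_of_disc hν
      ((continuous_discRe a.1 a.2).mul (continuous_discRe b.1 b.2))
  simp_rw [← sum_discRe, Finset.sum_mul_sum]
  rw [integral_finsetSum _ fun c _ => integrable_finsetSum _ fun c' _ => (hi c c')]
  have h3 : ∀ c ∈ Finset.HasAntidiagonal.antidiagonal m,
      ∫ ζ, ∑ c' ∈ Finset.HasAntidiagonal.antidiagonal l, discRe ζ c.1 c.2 * discRe ζ c'.1 c'.2 ∂ν =
      if m = l then 1 / ((m + 1 : ℕ) : ℝ) else 0 := by
    intro c hc
    rw [integral_finsetSum _ fun c' _ => hi c c']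
    rw [Finset.HasAntidiagonal.mem_antidiagonal] at hc
    have e : ∀ c' : ℕ × ℕ, ∫ ζ, discRe ζ c.1 c.2 * discRe ζ c'.1 c'.2 ∂ν =
        (if c = c' then 1 / 2 * (1 / ((m + 1 : ℕ) : ℝ)) else 0) +
        (if c.swap = c' then 1 / 2 * (1 / ((m + 1 : ℕ) : ℝ)) else 0) := by
      intro c'
      have e2 : (c = c'.swap) = (c.swap = c') := by
        apply propext; constructor
        · rintro rfl; exact Prod.swap_swap _
        · rintro rfl; exact (Prod.swap_swap _).symm
      rw [integral_discRe_mul_discRe hν, h, h, corrStd, corrStd, hc]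
      simp only [e2]
      split_ifs <;> ring
    simp_rw [e]
    rw [Finset.sum_add_distrib, Finset.sum_ite_eq, Finset.sum_ite_eq]
    simp only [Finset.HasAntidiagonal.mem_antidiagonal, Prod.fst_swap, Prod.snd_swap,
      add_comm c.2 c.1, hc]
    split_ifs <;> ring
  rw [Finset.sum_congr rfl h3, Finset.sum_const, Finset.Nat.card_antidiagonal]
  split_ifs
  · rw [nsmul_eq_mul]; field_simp
  · simp

end Moments

/-! ### Bounded measurable functions -/

section BoundedMeasurable

variable {X Y : Type*} [MeasurableSpace X] [MeasurableSpace Y]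

/-- Bounded measurable real functions. -/
structure BddMeas (f : X → ℝ) : Prop where
  measurable : Measurable f
  bounded : ∃ C, ∀ x, |f x| ≤ C

namespace BddMeas

variable {f g : X → ℝ}

theorem const (c : ℝ) : BddMeas fun _ : X => c := ⟨measurable_const, |c|, fun _ => le_rfl⟩

theorem mul (hf : BddMeas f) (hg : BddMeas g) : BddMeas fun x => f x * g x := by
  obtain ⟨C, hC⟩ := hf.bounded
  obtain ⟨D, hD⟩ := hg.bounded
  refine ⟨hf.measurable.mul hg.measurable, C * D, fun x => ?_⟩
  rw [abs_mul]
  exact mul_le_mul (hC x) (hD x) (abs_nonneg _) ((abs_nonneg _).trans (hC x))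

theorem add (hf : BddMeas f) (hg : BddMeas g) : BddMeas fun x => f x + g x := by
  obtain ⟨C, hC⟩ := hf.bounded
  obtain ⟨D, hD⟩ := hg.bounded
  exact ⟨hf.measurable.add hg.measurable, C + D,
    fun x => (abs_add_le _ _).trans (add_le_add (hC x) (hD x))⟩

theorem const_mul (c : ℝ) (hf : BddMeas f) : BddMeas fun x => c * f x := (const c).mul hf

theorem sub (hf : BddMeas f) (hg : BddMeas g) : BddMeas fun x => f x - g x := by
  have := hf.add (hg.const_mul (-1))
  convert this using 2; ring

theorem pow (hf : BddMeas f) (n : ℕ) : BddMeas fun x => f x ^ n := by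
  induction n with
  | zero => simpa using const 1
  | succ n ih => simpa only [pow_succ] using ih.mul hf

theorem sum {ι : Type*} {s : Finset ι} {F : ι → X → ℝ} (h : ∀ i ∈ s, BddMeas (F i)) :
    BddMeas fun x => ∑ i ∈ s, F i x := by
  classical
  induction s using Finset.induction_on with
  | empty => simpa using const 0
  | insert a s ha ih =>
    simp only [Finset.sum_insert ha]
    exact (h a (Finset.mem_insert_self a s)).add
      (ih fun i hi => h i (Finset.mem_insert_of_mem hi))

theorem comp (hf : BddMeas f) {φ : Y → X} (hφ : Measurable φ) : BddMeas fun y => f (φ y) := by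
  obtain ⟨C, hC⟩ := hf.bounded
  exact ⟨hf.measurable.comp hφ, C, fun y => hC _⟩

theorem integrable (hf : BddMeas f) (μ : Measure X) [IsFiniteMeasure μ] : Integrable f μ := by
  obtain ⟨C, hC⟩ := hf.bounded
  exact Integrable.of_bound hf.measurable.aestronglyMeasurable C (Eventually.of_forall hC)

theorem memLp (hf : BddMeas f) (μ : Measure X) [IsFiniteMeasure μ] (p : ENNReal) : MemLp f p μ := by
  obtain ⟨C, hC⟩ := hf.bounded
  exact MemLp.of_bound hf.measurable.aestronglyMeasurable C (Eventually.of_forall hC)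

theorem integral {k : X → Y → ℝ} (hk : BddMeas fun w : X × Y => k w.1 w.2) (μ : Measure Y)
    [IsProbabilityMeasure μ] : BddMeas fun x => ∫ y, k x y ∂μ := by
  obtain ⟨C, hC⟩ := hk.bounded
  refine ⟨(hk.measurable.stronglyMeasurable.integral_prod_right (ν := μ)).measurable, C,
    fun x => ?_⟩
  have := norm_integral_le_of_norm_le_const (μ := μ) (f := fun y => k x y) (C := C)
    (Eventually.of_forall fun y => hC (x, y))
  simpa using this

theorem of_continuous_of_disc {z : X → ℂ} (hzm : Measurable z) (hz : ∀ x, ‖z x‖ ≤ 1) {h : ℂ → ℝ}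
    (hh : Continuous h) : BddMeas fun x => h (z x) := by
  obtain ⟨B, hB⟩ := (isCompact_closedBall (0 : ℂ) 1).exists_bound_of_continuousOn hh.continuousOn
  exact ⟨hh.measurable.comp hzm, B, fun x => hB _ (by simpa using hz x)⟩

variable {k : X → Y → ℝ}

theorem left (hk : BddMeas fun w : X × Y => k w.1 w.2) (x : X) : BddMeas fun y => k x y :=
  hk.comp measurable_prodMk_left

theorem right (hk : BddMeas fun w : X × Y => k w.1 w.2) (y : Y) : BddMeas fun x => k x y :=
  hk.comp measurable_prodMk_right

end BddMeas

/-- Associativity of the composition of kernels, under the trace. -/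
theorem integral_comp_mul {μ : Measure X} [IsProbabilityMeasure μ] {a b c : X → X → ℝ}
    (ha : BddMeas fun w : X × X => a w.1 w.2) (hb : BddMeas fun w : X × X => b w.1 w.2)
    (hc : BddMeas fun w : X × X => c w.1 w.2) :
    ∫ x, ∫ y, (∫ w, a x w * b w y ∂μ) * c y x ∂μ ∂μ =
      ∫ x, ∫ w, a x w * (∫ y, b w y * c y x ∂μ) ∂μ ∂μ := by
  refine integral_congr_ae (Eventually.of_forall fun x => ?_)
  simp only [← integral_mul_const, ← integral_const_mul]
  rw [integral_integral_swap]
  · simp only [mul_assoc]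
  · refine BddMeas.integrable ?_ _
    exact ((ha.comp (by fun_prop : Measurable fun p : X × X => (x, p.2))).mul
      (hb.comp (by fun_prop : Measurable fun p : X × X => (p.2, p.1)))).mul
      (hc.comp (by fun_prop : Measurable fun p : X × X => (p.1, x)))

end BoundedMeasurable

/-! ### Spectral theory of a heat kernel on the disc -/

section Spectral

variable {X : Type*} [MeasurableSpace X]

theorem exists_abs_heatDisc_le {t : ℝ} (ht : 0 < t) :
    ∃ C : ℝ, ∀ ζ : ℂ, ‖ζ‖ ≤ 1 → |heatDisc t ζ| ≤ C := by
  obtain ⟨B, hB⟩ := (isCompact_closedBall (0 : ℂ) 1).exists_bound_of_continuousOn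
    (continuousOn_heatDisc ht)
  exact ⟨B, fun ζ hζ => hB ζ (by simpa using hζ)⟩

theorem hasSum_integral_psi_mul {μ : Measure X} [IsProbabilityMeasure μ] {z : X → ℂ}
    (hzm : Measurable z) (hz : ∀ x, ‖z x‖ ≤ 1) {g : X → ℝ} (hg : BddMeas g) {t : ℝ} (ht : 0 < t) :
    HasSum (fun N : ℕ => (∫ x, psi N (z x) * g x ∂μ) * rexp (-(2 * N) * t))
      (∫ x, heatDisc t (z x) * g x ∂μ) := by
  obtain ⟨C, hC⟩ := hg.bounded
  have hb : ∀ N, BddMeas fun x => psi N (z x) * g x * rexp (-(2 * N) * t) := fun N =>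
    ((BddMeas.of_continuous_of_disc hzm hz (continuous_psi N)).mul hg).mul (BddMeas.const _)
  have h1 := hasSum_integral_of_summable_integral_norm (μ := μ)
    (F := fun N x => psi N (z x) * g x * rexp (-(2 * N) * t)) (fun N => (hb N).integrable μ) ?_
  · simp only [integral_mul_const] at h1
    have e : ∫ x, heatDisc t (z x) * g x ∂μ =
        ∫ x, ∑' N : ℕ, psi N (z x) * g x * rexp (-(2 * N) * t) ∂μ := by
      refine integral_congr_ae (Eventually.of_forall fun x => ?_)
      have h2 := (hasSum_psi ht (hz x)).mul_right (g x)
      simp only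
      rw [← h2.tsum_eq]
      exact tsum_congr fun N => by ring
    rw [e]
    exact h1
  · refine Summable.of_nonneg_of_le (fun N => integral_nonneg fun x => norm_nonneg _) (fun N => ?_)
      ((summable_succ_pow_mul_exp 4 (by linarith : 0 < 2 * t)).mul_left |C|)
    have := norm_integral_le_of_norm_le_const (μ := μ)
      (f := fun x => ‖psi N (z x) * g x * rexp (-(2 * N) * t)‖)
      (C := |C| * (((N : ℝ) + 1) ^ 4 * rexp (-(2 * t) * N))) (Eventually.of_forall fun x => by
        rw [norm_norm, norm_mul, norm_mul, Real.norm_of_nonneg (exp_pos _).le,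
          show -(2 * (N : ℝ)) * t = -(2 * t) * N by ring]
        have h3 := abs_psi_le (hz x) N
        have h4 := (hC x).trans (le_abs_self C)
        calc ‖psi N (z x)‖ * ‖g x‖ * rexp (-(2 * t) * N)
            ≤ ((N : ℝ) + 1) ^ 4 * |C| * rexp (-(2 * t) * N) := by
              refine mul_le_mul_of_nonneg_right ?_ (exp_pos _).le
              exact mul_le_mul h3 h4 (norm_nonneg _) (by positivity)
          _ = _ := by ring)
    rw [probReal_univ, mul_one] at this
    exact (le_abs_self _).trans this

/-- If the heat kernel of the disc is integrable against a measure with integral `1` for all times,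
then this is a probability measure, because the kernel tends to `1` uniformly for large times. -/
theorem measure_univ_eq_one {μ : Measure X} {z : X → ℂ} (hz : ∀ x, ‖z x‖ ≤ 1)
    (h : ∀ t, 0 < t → Integrable (fun x => heatDisc t (z x)) μ ∧ ∫ x, heatDisc t (z x) ∂μ = 1) :
    IsProbabilityMeasure μ := by
  have hlim : Tendsto (fun n : ℕ => (∑' N : ℕ, ((N : ℝ) + 1) ^ 4 * rexp (-(2 * N) * n)) - 1) atTop
      (𝓝 0) := by
    have := (tendsto_exp_series (a := fun N => ((N : ℝ) + 1) ^ 4) (B := 1) (k := 4) fun N => by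
      rw [abs_of_nonneg (by positivity), one_mul]).sub_const 1
    simpa using this
  have hsum : ∀ n : ℕ, 0 < n → Summable fun N : ℕ => ((N : ℝ) + 1) ^ 4 * rexp (-(2 * N) * n) :=
    fun n hn => summable_exp_series (a := fun N => ((N : ℝ) + 1) ^ 4) (B := 1) (k := 4)
      (fun N => by rw [abs_of_nonneg (by positivity), one_mul]) (by exact_mod_cast hn)
  have hclose : ∀ n : ℕ, 0 < n → ∀ ζ : ℂ, ‖ζ‖ ≤ 1 → |heatDisc n ζ - 1| ≤
      (∑' N : ℕ, ((N : ℝ) + 1) ^ 4 * rexp (-(2 * N) * n)) - 1 := by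
    intro n hn ζ hζ
    have h1 := (hasSum_nat_add_iff' 1).2 (hasSum_psi (t := n) (by exact_mod_cast hn) hζ)
    have h2 := (hasSum_nat_add_iff' 1).2 (hsum n hn).hasSum
    simp only [Finset.range_one, Finset.sum_singleton, psi_zero, Nat.cast_zero, mul_zero, neg_zero,
      zero_mul, exp_zero, mul_one, zero_add, one_pow] at h1 h2
    rw [← h1.tsum_eq, ← Real.norm_eq_abs]
    refine tsum_of_norm_bounded h2 fun N => ?_
    rw [norm_mul, Real.norm_of_nonneg (exp_pos _).le]
    exact mul_le_mul_of_nonneg_right (abs_psi_le hζ _) (exp_pos _).le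
  have hfin : IsFiniteMeasure μ := by
    obtain ⟨n, hn, hn0⟩ := ((hlim.eventually (gt_mem_nhds (by norm_num : (0 : ℝ) < 1 / 2))).and
      (eventually_gt_atTop 0)).exists
    have hI := (h n (by exact_mod_cast hn0)).1
    have : Integrable (fun _ : X => (1 / 2 : ℝ)) μ := by
      refine hI.mono aestronglyMeasurable_const (Eventually.of_forall fun x => ?_)
      have h1 := (abs_le.1 ((hclose n hn0 (z x) (hz x)).trans hn.le)).1
      rw [Real.norm_of_nonneg (by norm_num), Real.norm_of_nonneg (by linarith)]
      linarith
    exact (integrable_const_iff_isFiniteMeasure (by norm_num)).1 this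
  have hlim2 : Tendsto (fun n : ℕ => ((∑' N : ℕ, ((N : ℝ) + 1) ^ 4 * rexp (-(2 * N) * n)) - 1) *
      μ.real univ) atTop (𝓝 0) := by simpa using hlim.mul_const (μ.real univ)
  have hle : |1 - μ.real univ| ≤ 0 := by
    refine ge_of_tendsto hlim2 ?_
    filter_upwards [eventually_gt_atTop 0] with n hn
    obtain ⟨hI, h1⟩ := h n (by exact_mod_cast hn)
    have e : 1 - μ.real univ = ∫ x, (heatDisc n (z x) - 1) ∂μ := by
      rw [integral_sub hI (integrable_const _), h1, integral_const, smul_eq_mul, mul_one]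
    rw [e, ← Real.norm_eq_abs]
    exact norm_integral_le_of_norm_le_const (Eventually.of_forall fun x => hclose n hn _ (hz x))
  have h1 : μ.real univ = 1 := by
    have := abs_nonpos_iff.1 hle
    linarith
  refine ⟨?_⟩
  rw [← ENNReal.toReal_eq_one_iff]
  exact h1

/-- A symmetric function `z` into the unit disc for which the heat kernel of the disc is a heat
kernel on the probability space `(X, μ)`. -/
structure IsDiscHeat (μ : Measure X) (z : X → X → ℂ) : Prop where
  measurable : Measurable fun w : X × X => z w.1 w.2
  norm_le : ∀ x y, ‖z x y‖ ≤ 1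
  symm : ∀ x y, z x y = z y x
  heat : IsHeatKernel μ fun t x y => heatDisc t (z x y)

namespace IsDiscHeat

variable {μ : Measure X} {z : X → X → ℂ}

theorem bddMeas (hz : IsDiscHeat μ z) {h : ℂ → ℝ} (hh : Continuous h) :
    BddMeas fun w : X × X => h (z w.1 w.2) :=
  BddMeas.of_continuous_of_disc hz.measurable (fun w => hz.norm_le w.1 w.2) hh

theorem bddMeas_heat (hz : IsDiscHeat μ z) {t : ℝ} (ht : 0 < t) :
    BddMeas fun w : X × X => heatDisc t (z w.1 w.2) := by
  obtain ⟨C, hC⟩ := exists_abs_heatDisc_le ht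
  exact ⟨hz.heat.measurable t ht, C, fun w => hC _ (hz.norm_le _ _)⟩

variable [IsProbabilityMeasure μ]

/-- The spectral projection kernels are idempotent and mutually orthogonal. -/
theorem psi_comp (hz : IsDiscHeat μ z) : ∀ᵐ w ∂(μ.prod μ), ∀ N N' : ℕ,
    ∫ v, psi N (z w.1 v) * psi N' (z v w.2) ∂μ = if N = N' then psi N (z w.1 w.2) else 0 := by
  filter_upwards [hz.heat.semigroup] with ⟨x, y⟩ hxy N N'
  simp only at hxy ⊢
  have hx : Measurable fun v => z x v := hz.measurable.comp measurable_prodMk_left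
  have hy : Measurable fun v => z v y := hz.measurable.comp measurable_prodMk_right
  have hnx := hz.norm_le x
  have hny := fun v => hz.norm_le v y
  have first : ∀ m : ℕ, 0 < m → ∫ v, psi N (z x v) * heatDisc m (z v y) ∂μ =
      psi N (z x y) * rexp (-(2 * N) * m) := by
    intro m hm
    have hm' : (0 : ℝ) < m := by exact_mod_cast hm
    have hb := BddMeas.right (k := fun x y => heatDisc m (z x y)) (hz.bddMeas_heat hm') y
    obtain ⟨C, hC⟩ := hb.bounded
    have hC0 : 0 ≤ C := (abs_nonneg _).trans (hC y)
    refine exp_series_unique (a := fun N => ∫ v, psi N (z x v) * heatDisc m (z v y) ∂μ)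
      (b := fun N => psi N (z x y) * rexp (-(2 * N) * m)) (B := C + 1) (k := 4) (fun N => ?_)
      (fun N => ?_) (F := fun n => heatDisc (n + m) (z x y)) (fun n hn => ?_) (fun n hn => ?_) N
    · have := norm_integral_le_of_norm_le_const (μ := μ)
        (f := fun v => psi N (z x v) * heatDisc m (z v y)) (C := ((N : ℝ) + 1) ^ 4 * C)
        (Eventually.of_forall fun v => by
          rw [norm_mul]
          exact mul_le_mul (abs_psi_le (hnx v) N) (hC v) (norm_nonneg _) (by positivity))
      rw [probReal_univ, mul_one, Real.norm_eq_abs] at this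
      refine this.trans ?_
      rw [mul_comm]
      exact mul_le_mul_of_nonneg_right (by linarith) (by positivity)
    · rw [abs_mul, abs_of_pos (exp_pos _), mul_comm]
      have : rexp (-(2 * N) * m) ≤ 1 := Real.exp_le_one_iff.2 (by
        have := mul_nonneg (Nat.cast_nonneg (α := ℝ) N) hm'.le
        linarith)
      exact mul_le_mul (by linarith) (abs_psi_le (hnx y) N) (abs_nonneg _) (by linarith)
    · have hn' : (0 : ℝ) < n := by exact_mod_cast hn
      have := hasSum_integral_psi_mul (μ := μ) hx hnx hb hn'
      rw [(hxy n m hn' hm').2]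
      exact this
    · have hn' : (0 : ℝ) < n := by exact_mod_cast hn
      refine (hasSum_psi (by positivity : (0 : ℝ) < n + m) (hnx y)).congr_fun fun N => ?_
      rw [mul_add, Real.exp_add]; ring
  have hb := BddMeas.left (k := fun x y => psi N (z x y)) (hz.bddMeas (continuous_psi N)) x
  have h2 := exp_series_unique (a := fun N' => ∫ v, psi N (z x v) * psi N' (z v y) ∂μ)
    (b := fun N' => if N' = N then psi N (z x y) else 0) (B := ((N : ℝ) + 1) ^ 4) (k := 4)
    (fun N' => ?_) (fun N' => ?_) (F := fun m => psi N (z x y) * rexp (-(2 * N) * m))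
    (fun m hm => ?_) (fun m hm => ?_) N'
  · rw [h2]; simp only [eq_comm]
  · have := norm_integral_le_of_norm_le_const (μ := μ)
      (f := fun v => psi N (z x v) * psi N' (z v y))
      (C := ((N : ℝ) + 1) ^ 4 * ((N' : ℝ) + 1) ^ 4)
      (Eventually.of_forall fun v => by
        rw [norm_mul]
        exact mul_le_mul (abs_psi_le (hnx v) N) (abs_psi_le (hny v) N') (norm_nonneg _)
          (by positivity))
    simpa using this
  · split_ifs with h
    · refine (abs_psi_le (hnx y) N).trans (le_mul_of_one_le_right (by positivity) ?_)
      exact one_le_pow₀ (by linarith [Nat.cast_nonneg (α := ℝ) N'])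
    · rw [abs_zero]; positivity
  · have hm' : (0 : ℝ) < m := by exact_mod_cast hm
    rw [← first m hm]
    have := hasSum_integral_psi_mul (μ := μ) hy hny hb hm'
    simpa only [mul_comm (psi N (z x _))] using this
  · convert hasSum_ite_eq N (psi N (z x y) * rexp (-(2 * N) * m)) using 2 with N'
    split_ifs with h
    · rw [h]
    · rw [zero_mul]

theorem integral_heat (hz : IsDiscHeat μ z) {t : ℝ} (ht : 0 < t) :
    ∫ w : X × X, heatDisc t (z w.1 w.2) ∂(μ.prod μ) = 1 := by
  rw [integral_prod _ ((hz.bddMeas_heat ht).integrable _)]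
  have : ∀ᵐ x ∂μ, ∫ y, heatDisc t (z x y) ∂μ = 1 := by
    filter_upwards [hz.heat.conservative] with x hx using (hx t ht).2
  rw [integral_congr_ae this]; simp

/-- For small times, the heat kernel concentrates where `z = 1`. -/
theorem tendsto_integral_heat (hz : IsDiscHeat μ z) {h : ℂ → ℝ} (hh : Continuous h) :
    Tendsto (fun t : ℝ => ∫ w : X × X, heatDisc t (z w.1 w.2) * h (z w.1 w.2) ∂(μ.prod μ))
      (𝓝[>] 0) (𝓝 (h 1)) := by
  obtain ⟨K, hK⟩ := exists_one_sub_re_pow_mul_heatDisc_le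
  have hK0 : 0 ≤ K := by
    have := hK 1 one_pos le_rfl 0 (by simp)
    have h2 := abs_nonneg (heatDisc 1 0)
    simp at this; linarith
  rw [Metric.tendsto_nhds]
  intro ε hε
  obtain ⟨B, hB⟩ := (isCompact_closedBall (0 : ℂ) 1).exists_bound_of_continuousOn
    (f := fun ζ => h ζ - h 1) (hh.sub continuous_const).continuousOn
  have hB0 : 0 ≤ B := (norm_nonneg _).trans (hB 0 (by simp))
  obtain ⟨η, hη, hη'⟩ := Metric.continuous_iff.1 hh 1 (ε / 2) (by linarith)
  set A : ℝ := B / (η ^ 2 / 2) ^ 22 with hA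
  have hA0 : 0 ≤ A := by positivity
  have hbound : ∀ ζ : ℂ, ‖ζ‖ ≤ 1 → |h ζ - h 1| ≤ ε / 2 + A * (1 - ζ.re) ^ 22 := by
    intro ζ hζ
    have hre : 0 ≤ 1 - ζ.re := by linarith [(abs_le.1 ((Complex.abs_re_le_norm ζ).trans hζ)).2]
    rcases lt_or_ge (dist ζ 1) η with hd | hd
    · have := hη' ζ hd
      rw [Real.dist_eq] at this
      have := mul_nonneg hA0 (pow_nonneg hre 22)
      linarith
    · have h1 : η ^ 2 / 2 ≤ 1 - ζ.re := by
        have h2 : dist ζ 1 ^ 2 = ‖ζ‖ ^ 2 - 2 * ζ.re + 1 := by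
          rw [Complex.dist_eq, ← Complex.normSq_eq_norm_sq, ← Complex.normSq_eq_norm_sq,
            Complex.normSq_apply, Complex.normSq_apply]
          simp; ring
        have h3 : η ^ 2 ≤ dist ζ 1 ^ 2 := pow_le_pow_left₀ hη.le hd 2
        nlinarith [norm_nonneg ζ]
      have h4 : (η ^ 2 / 2) ^ 22 ≤ (1 - ζ.re) ^ 22 := pow_le_pow_left₀ (by positivity) h1 22
      have h5 : B ≤ A * (1 - ζ.re) ^ 22 := by
        calc B = A * (η ^ 2 / 2) ^ 22 := by rw [hA]; field_simp
          _ ≤ _ := mul_le_mul_of_nonneg_left h4 hA0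
      have h6 : |h ζ - h 1| ≤ B := hB ζ (by simpa using hζ)
      linarith
  have hev : ∀ᶠ t : ℝ in 𝓝[>] 0, A * (K * t) < ε / 2 ∧ t ≤ 1 := by
    refine Filter.Eventually.and ?_ ?_
    · have : Tendsto (fun t : ℝ => A * (K * t)) (𝓝[>] 0) (𝓝 (A * (K * 0))) :=
        ((continuous_const.mul (continuous_const.mul continuous_id)).tendsto 0).mono_left
          nhdsWithin_le_nhds
      rw [mul_zero, mul_zero] at this
      exact this.eventually (gt_mem_nhds (by linarith))
    · exact nhdsWithin_le_nhds (Iic_mem_nhds one_pos)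
  filter_upwards [hev, self_mem_nhdsWithin] with t ht ht0
  have ht0 : 0 < t := ht0
  have hbp := hz.bddMeas_heat ht0
  have hbh := hz.bddMeas hh
  have e : ∫ w : X × X, heatDisc t (z w.1 w.2) * h (z w.1 w.2) ∂(μ.prod μ) - h 1 =
      ∫ w : X × X, heatDisc t (z w.1 w.2) * (h (z w.1 w.2) - h 1) ∂(μ.prod μ) := by
    simp_rw [mul_sub]
    rw [integral_sub ((hbp.mul hbh).integrable _) ((hbp.mul (BddMeas.const _)).integrable _),
      integral_mul_const, hz.integral_heat ht0, one_mul]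
  rw [Real.dist_eq, e]
  have hle : ∫ w : X × X, |heatDisc t (z w.1 w.2) * (h (z w.1 w.2) - h 1)| ∂(μ.prod μ) ≤
      ∫ w : X × X, (heatDisc t (z w.1 w.2) * (ε / 2) + A * (K * t)) ∂(μ.prod μ) := by
    refine integral_mono_ae (((hbp.mul (hbh.sub (BddMeas.const _))).integrable _).abs)
      (((hbp.mul (BddMeas.const _)).add (BddMeas.const _)).integrable _) ?_
    filter_upwards [hz.heat.nonneg] with w hw
    have hw0 := hw t ht0
    have h1 := hbound _ (hz.norm_le w.1 w.2)
    have h2 := hK t ht0 ht.2 _ (hz.norm_le w.1 w.2)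
    rw [abs_of_nonneg hw0] at h2
    rw [abs_mul, abs_of_nonneg hw0]
    calc heatDisc t (z w.1 w.2) * |h (z w.1 w.2) - h 1|
        ≤ heatDisc t (z w.1 w.2) * (ε / 2 + A * (1 - (z w.1 w.2).re) ^ 22) := by gcongr
      _ = heatDisc t (z w.1 w.2) * (ε / 2) +
          A * ((1 - (z w.1 w.2).re) ^ 22 * heatDisc t (z w.1 w.2)) := by ring
      _ ≤ _ := by gcongr
  rw [integral_add ((hbp.mul (BddMeas.const _)).integrable _) (integrable_const _),
    integral_mul_const, hz.integral_heat ht0, integral_const, probReal_univ, one_smul,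
    one_mul] at hle
  calc |∫ w : X × X, heatDisc t (z w.1 w.2) * (h (z w.1 w.2) - h 1) ∂(μ.prod μ)|
      ≤ ε / 2 + A * (K * t) := (abs_integral_le_integral_abs).trans hle
    _ < ε := by linarith [ht.1]

/-- The spectral projection kernels are orthogonal, with the norms of the disc. -/
theorem integral_psi_mul_psi (hz : IsDiscHeat μ z) (N N' : ℕ) :
    ∫ w : X × X, psi N (z w.1 w.2) * psi N' (z w.1 w.2) ∂(μ.prod μ) =
      if N = N' then psi N 1 else 0 := by
  have orth : ∀ N N', N ≠ N' →
      ∫ w : X × X, psi N (z w.1 w.2) * psi N' (z w.1 w.2) ∂(μ.prod μ) = 0 := by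
    intro N N' hne
    have hb := fun N => hz.bddMeas (continuous_psi N)
    have e : ∫ w : X × X, psi N (z w.1 w.2) * psi N' (z w.1 w.2) ∂(μ.prod μ) =
        ∫ w : X × X, (∫ v, psi N (z w.1 v) * psi N (z v w.2) ∂μ) * psi N' (z w.2 w.1)
          ∂(μ.prod μ) := by
      refine integral_congr_ae ?_
      filter_upwards [hz.psi_comp] with w hw
      rw [hw N N, if_pos rfl, hz.symm w.2 w.1]
    have hI : BddMeas fun w : X × X => (∫ v, psi N (z w.1 v) * psi N (z v w.2) ∂μ) *
        psi N' (z w.2 w.1) := by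
      refine BddMeas.mul ?_ ((hb N').comp measurable_swap)
      refine BddMeas.integral (k := fun (w : X × X) v => psi N (z w.1 v) * psi N (z v w.2)) ?_ μ
      exact ((hb N).comp (by fun_prop : Measurable fun p : (X × X) × X => (p.1.1, p.2))).mul
        ((hb N).comp (by fun_prop : Measurable fun p : (X × X) × X => (p.2, p.1.2)))
    rw [e, integral_prod _ (hI.integrable _)]
    simp only
    rw [integral_comp_mul (hb N) (hb N) (hb N')]
    have h0 := Measure.ae_ae_of_ae_prod
      ((Measure.measurePreserving_swap (μ := μ) (ν := μ)).quasiMeasurePreserving.ae hz.psi_comp)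
    refine integral_eq_zero_of_ae ?_
    filter_upwards [h0] with x hx
    refine integral_eq_zero_of_ae ?_
    filter_upwards [hx] with v hv
    have := hv N N'
    simp only [Prod.fst_swap, Prod.snd_swap] at this
    rw [this, if_neg hne, mul_zero]; rfl
  split_ifs with h
  · subst h
    set R := ∫ w : X × X, psi N (z w.1 w.2) * psi N (z w.1 w.2) ∂(μ.prod μ) with hR
    have h1 : ∀ t : ℝ, 0 < t →
        ∫ w : X × X, heatDisc t (z w.1 w.2) * psi N (z w.1 w.2) ∂(μ.prod μ) =
        R * rexp (-(2 * N) * t) := by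
      intro t ht
      have hs := hasSum_integral_psi_mul (μ := μ.prod μ) hz.measurable
        (fun w => hz.norm_le w.1 w.2) (hz.bddMeas (continuous_psi N)) ht
      refine hs.unique ?_
      convert hasSum_ite_eq N (R * rexp (-(2 * N) * t)) using 2 with N'
      split_ifs with h
      · subst h; rfl
      · rw [orth N' N h, zero_mul]
    have h2 := hz.tendsto_integral_heat (continuous_psi N)
    have h3 : Tendsto (fun t : ℝ => R * rexp (-(2 * N) * t)) (𝓝[>] 0) (𝓝 R) := by
      have : Continuous fun t : ℝ => R * rexp (-(2 * N) * t) := by fun_prop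
      simpa using (this.tendsto 0).mono_left (nhdsWithin_le_nhds (s := Ioi 0))
    refine tendsto_nhds_unique (h3.congr' ?_) h2
    filter_upwards [self_mem_nhdsWithin] with t ht using (h1 t ht).symm
  · exact orth N N' h

/-- The Chebyshev polynomials of `Re z` are orthonormal. -/
theorem integral_chebyshevU (hz : IsDiscHeat μ z) (m l : ℕ) :
    ∫ w : X × X, (Chebyshev.U ℝ m).eval (z w.1 w.2).re * (Chebyshev.U ℝ l).eval (z w.1 w.2).re
      ∂(μ.prod μ) = if m = l then 1 else 0 := by
  set ν := (μ.prod μ).map fun w : X × X => z w.1 w.2 with hν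
  have : IsProbabilityMeasure ν := Measure.isProbabilityMeasure_map hz.measurable.aemeasurable
  have hint : ∀ h : ℂ → ℝ, Continuous h → ∫ ζ, h ζ ∂ν = ∫ w : X × X, h (z w.1 w.2) ∂(μ.prod μ) :=
    fun h hh => integral_map hz.measurable.aemeasurable hh.aestronglyMeasurable
  have hν1 : ∀ᵐ ζ ∂ν, ‖ζ‖ ≤ 1 := by
    rw [hν, ae_map_iff hz.measurable.aemeasurable
      (measurableSet_le continuous_norm.measurable measurable_const)]
    exact Eventually.of_forall fun w => hz.norm_le w.1 w.2
  rw [← integral_chebyshevU_mul hν1 (corr_eq_corrStd hν1 fun N N' => ?_) m l, hint]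
  · fun_prop
  · rw [hint (fun ζ => psi N ζ * psi N' ζ) ((continuous_psi N).mul (continuous_psi N'))]
    exact hz.integral_psi_mul_psi N N'

end IsDiscHeat
end Spectral

/-! ### Idempotent kernels of finite rank -/

section FiniteRank

variable {X : Type*} [MeasurableSpace X] {μ : Measure X} [IsProbabilityMeasure μ]

/-- A symmetric idempotent kernel of squared norm `n` is a sum of `n` squares. -/
theorem exists_eq_sum_of_idempotent (n : ℕ) {k : X → X → ℝ}
    (hk : BddMeas fun w : X × X => k w.1 w.2) (hsymm : ∀ x y, k x y = k y x)
    (hidem : ∀ᵐ w ∂(μ.prod μ), ∫ v, k w.1 v * k v w.2 ∂μ = k w.1 w.2)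
    (hn : ∫ w : X × X, k w.1 w.2 ^ 2 ∂(μ.prod μ) = n) :
    ∃ e : Fin n → X → ℝ, (∀ i, BddMeas (e i)) ∧ (∀ i, ∫ x, e i x ^ 2 ∂μ = 1) ∧
      ∀ᵐ w ∂(μ.prod μ), k w.1 w.2 = ∑ i, e i w.1 * e i w.2 := by
  induction n generalizing k with
  | zero =>
    refine ⟨fun _ _ => 0, fun i => i.elim0, fun i => i.elim0, ?_⟩
    have := (integral_eq_zero_iff_of_nonneg (fun w => sq_nonneg _) ((hk.pow 2).integrable _)).1
      (by simpa using hn)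
    filter_upwards [this] with w hw
    have : k w.1 w.2 ^ 2 = 0 := hw
    simpa using this
  | succ n ih =>
    -- a section of the kernel is fixed by it; split off its contribution
    obtain ⟨y, hy, hc⟩ : ∃ y, (∀ᵐ x ∂μ, ∫ v, k x v * k v y ∂μ = k x y) ∧
        ∫ x, k x y ^ 2 ∂μ ≠ 0 := by
      have h0 := Measure.ae_ae_of_ae_prod
        ((Measure.measurePreserving_swap (μ := μ) (ν := μ)).quasiMeasurePreserving.ae hidem)
      simp only [Prod.fst_swap, Prod.snd_swap] at h0
      have h1 : ∃ᵐ y ∂μ, ∫ x, k x y ^ 2 ∂μ ≠ 0 := by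
        intro h
        rw [integral_prod _ ((hk.pow 2).integrable _)] at hn
        have : ∫ x, ∫ y, k x y ^ 2 ∂μ ∂μ = 0 := by
          refine integral_eq_zero_of_ae ?_
          filter_upwards [h] with x hx
          rw [not_not] at hx
          simp only [hsymm x]; exact hx
        simp only [this] at hn
        exact absurd hn.symm (by positivity)
      obtain ⟨y, h2, h3⟩ := (h1.and_eventually h0).exists
      exact ⟨y, h3, h2⟩
    set c := ∫ x, k x y ^ 2 ∂μ with hcdef
    have hc0 : 0 < c := lt_of_le_of_ne (integral_nonneg fun x => sq_nonneg _) (Ne.symm hc)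
    have hs : √c ^ 2 = c := sq_sqrt hc0.le
    have hs0 : √c ≠ 0 := (sqrt_pos.2 hc0).ne'
    set e : X → ℝ := fun x => (√c)⁻¹ * k x y with he
    have heb : BddMeas e := (BddMeas.right hk y).const_mul _
    have he1 : ∫ x, e x ^ 2 ∂μ = 1 := by
      simp only [he, mul_pow, integral_const_mul]
      rw [← hcdef, inv_pow, hs, inv_mul_cancel₀ hc]
    have hTe : ∀ᵐ x ∂μ, ∫ v, k x v * e v ∂μ = e x := by
      filter_upwards [hy] with x hx
      simp only [he]
      rw [← hx, ← integral_const_mul]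
      exact integral_congr_ae (Eventually.of_forall fun v => by simp only; ring)
    have hee : BddMeas fun w : X × X => e w.1 * e w.2 :=
      (heb.comp measurable_fst).mul (heb.comp measurable_snd)
    have hk' : BddMeas fun w : X × X => k w.1 w.2 - e w.1 * e w.2 := hk.sub hee
    have hidem' : ∀ᵐ w ∂(μ.prod μ), ∫ v, (k w.1 v - e w.1 * e v) * (k v w.2 - e v * e w.2) ∂μ =
        k w.1 w.2 - e w.1 * e w.2 := by
      filter_upwards [hidem, Measure.quasiMeasurePreserving_fst.ae hTe,
        Measure.quasiMeasurePreserving_snd.ae hTe] with w h1 h2 h3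
      have i1 := BddMeas.left (k := k) hk w.1
      have i2 := BddMeas.right (k := k) hk w.2
      have e1 : ∀ v, (k w.1 v - e w.1 * e v) * (k v w.2 - e v * e w.2) =
          (k w.1 v * k v w.2 - e w.2 * (k w.1 v * e v)) -
            (e w.1 * (k w.2 v * e v) - e w.1 * e w.2 * e v ^ 2) := fun v => by
        rw [hsymm w.2 v]; ring
      simp only [e1]
      have hkw2 : BddMeas fun v => k w.2 v := BddMeas.left (k := k) hk w.2
      rw [integral_sub (((i1.mul i2).sub ((i1.mul heb).const_mul _)).integrable _)
        ((((hkw2.mul heb).const_mul _).sub ((heb.pow 2).const_mul _)).integrable _),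
        integral_sub ((i1.mul i2).integrable _) (((i1.mul heb).const_mul _).integrable _),
        integral_sub (((hkw2.mul heb).const_mul _).integrable _)
          (((heb.pow 2).const_mul _).integrable _), integral_const_mul, integral_const_mul,
        integral_const_mul, h1, h2, h3, he1]
      ring
    have hn' : ∫ w : X × X, (k w.1 w.2 - e w.1 * e w.2) ^ 2 ∂(μ.prod μ) = n := by
      have e1 : ∀ w : X × X, (k w.1 w.2 - e w.1 * e w.2) ^ 2 =
          k w.1 w.2 ^ 2 - 2 * (k w.1 w.2 * (e w.1 * e w.2)) + e w.1 ^ 2 * e w.2 ^ 2 :=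
        fun w => by ring
      simp only [e1]
      rw [integral_add (((hk.pow 2).sub ((hk.mul hee).const_mul 2)).integrable _)
        ((((heb.pow 2).comp measurable_fst).mul ((heb.pow 2).comp measurable_snd)).integrable _),
        integral_sub ((hk.pow 2).integrable _) (((hk.mul hee).const_mul 2).integrable _),
        integral_const_mul, hn, integral_prod_mul (fun x => e x ^ 2) (fun y => e y ^ 2), he1,
        integral_prod _ ((hk.mul hee).integrable _)]
      have : ∫ x, ∫ y, k x y * (e x * e y) ∂μ ∂μ = 1 := by
        rw [← he1]
        refine integral_congr_ae ?_
        filter_upwards [hTe] with x hx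
        rw [sq, ← hx, ← integral_const_mul, hx]
        exact integral_congr_ae (Eventually.of_forall fun v => by simp only; ring)
      rw [this]; push_cast; ring
    obtain ⟨f, hf, hf1, hfk⟩ := ih (k := fun x y => k x y - e x * e y) hk'
      (fun x y => by rw [hsymm, mul_comm]) hidem' hn'
    refine ⟨Fin.cons e f, Fin.cases heb hf, Fin.cases he1 hf1, ?_⟩
    filter_upwards [hfk] with w hw
    rw [Fin.sum_univ_succ]
    simp only [Fin.cons_zero, Fin.cons_succ]
    rw [← hw]; ring

end FiniteRank

/-! ### The map to the sphere -/

namespace IsDiscHeat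

variable {X : Type*} [MeasurableSpace X] {μ : Measure X} [IsProbabilityMeasure μ] {z : X → X → ℂ}

theorem integral_heat_mul_fst (hz : IsDiscHeat μ z) {t : ℝ} (ht : 0 < t) {g : X → ℝ}
    (hg : BddMeas g) :
    ∫ w : X × X, heatDisc t (z w.1 w.2) * g w.1 ∂(μ.prod μ) = ∫ x, g x ∂μ := by
  rw [integral_prod _ (((hz.bddMeas_heat ht).mul (hg.comp measurable_fst)).integrable _)]
  refine integral_congr_ae ?_
  filter_upwards [hz.heat.conservative] with x hx
  rw [integral_mul_const, (hx t ht).2, one_mul]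

theorem integral_heat_mul_snd (hz : IsDiscHeat μ z) {t : ℝ} (ht : 0 < t) {g : X → ℝ}
    (hg : BddMeas g) :
    ∫ w : X × X, heatDisc t (z w.1 w.2) * g w.2 ∂(μ.prod μ) = ∫ x, g x ∂μ := by
  rw [← hz.integral_heat_mul_fst ht hg, ← integral_prod_swap]
  refine integral_congr_ae (Eventually.of_forall fun w => ?_)
  simp only [Prod.fst_swap, Prod.snd_swap]
  rw [hz.symm w.2 w.1]

/-- The real part of `z` is the Gram kernel of a map to the unit sphere of `ℝ⁴`. -/
theorem exists_sphere_map (hz : IsDiscHeat μ z) : ∃ f : Fin 4 → X → ℝ, (∀ i, BddMeas (f i)) ∧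
    (∀ x, ∑ i, f i x ^ 2 = 1) ∧
    ∀ᵐ w ∂(μ.prod μ), (z w.1 w.2).re = ∑ i, f i w.1 * f i w.2 := by
  obtain ⟨e, heb, he1, hek⟩ := exists_eq_sum_of_idempotent (μ := μ) 4
    (k := fun x y => psi 1 (z x y)) (hz.bddMeas (continuous_psi 1))
    (fun x y => by rw [hz.symm]) (by
      filter_upwards [hz.psi_comp] with w hw
      rw [hw 1 1, if_pos rfl]) (by
      have := hz.integral_psi_mul_psi 1 1
      rw [if_pos rfl, psi_one] at this
      simp only [sq, this]; norm_num)
  set F : X → ℝ := fun x => ∑ i, (1 / 2 * e i x) ^ 2 with hF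
  have hfb : ∀ i, BddMeas fun x => 1 / 2 * e i x := fun i => (heb i).const_mul _
  have hFb : BddMeas F := BddMeas.sum fun i _ => (hfb i).pow 2
  have hu : ∀ᵐ w ∂(μ.prod μ), (z w.1 w.2).re = ∑ i, (1 / 2 * e i w.1) * (1 / 2 * e i w.2) := by
    filter_upwards [hek] with w hw
    rw [psi_one] at hw
    have : ∑ i, (1 / 2 * e i w.1) * (1 / 2 * e i w.2) = 1 / 4 * ∑ i, e i w.1 * e i w.2 := by
      rw [Finset.mul_sum]; exact Finset.sum_congr rfl fun i _ => by ring
    rw [this, ← hw]; ring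
  have hFint : ∫ x, F x ∂μ = 1 := by
    simp only [hF]
    rw [integral_finsetSum _ fun i _ => ((hfb i).pow 2).integrable _]
    simp only [mul_pow, integral_const_mul, he1]
    norm_num
  obtain ⟨B, hB⟩ := hFb.bounded
  have hre := hz.bddMeas (h := fun ζ => ζ.re) Complex.continuous_re
  -- the map has unit length, since the heat kernel concentrates both where `f x = f y` and where
  -- the Gram kernel is `1`
  have hle : ∀ t, 0 < t → ∫ x, (F x - 1) ^ 2 ∂μ ≤
      (4 * B + 4) * (1 - ∫ w : X × X, heatDisc t (z w.1 w.2) * (z w.1 w.2).re ∂(μ.prod μ)) := by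
    intro t ht
    have hp := hz.bddMeas_heat ht
    have hF1 : BddMeas fun x => (F x - 1) ^ 2 := (hFb.sub (BddMeas.const 1)).pow 2
    rw [← hz.integral_heat_mul_fst ht hF1]
    have e1 : (4 * B + 4) * (1 - ∫ w : X × X, heatDisc t (z w.1 w.2) * (z w.1 w.2).re
        ∂(μ.prod μ)) = ∫ w : X × X, (2 * B * (heatDisc t (z w.1 w.2) * F w.1) +
        2 * B * (heatDisc t (z w.1 w.2) * F w.2)) +
        (4 * heatDisc t (z w.1 w.2) - (4 * B + 4) *
          (heatDisc t (z w.1 w.2) * (z w.1 w.2).re)) ∂(μ.prod μ) := by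
      have i1 := ((hp.mul (hFb.comp measurable_fst)).const_mul (2 * B))
      have i2 := ((hp.mul (hFb.comp measurable_snd)).const_mul (2 * B))
      have i3 := hp.const_mul 4
      have i4 := (hp.mul hre).const_mul (4 * B + 4)
      rw [integral_add ((i1.add i2).integrable _) ((i3.sub i4).integrable _),
        integral_add (i1.integrable _) (i2.integrable _),
        integral_sub (i3.integrable _) (i4.integrable _),
        integral_const_mul, integral_const_mul, integral_const_mul, integral_const_mul,
        hz.integral_heat_mul_fst ht hFb, hz.integral_heat_mul_snd ht hFb, hFint,
        hz.integral_heat ht]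
      ring
    rw [e1]
    refine integral_mono_ae ((hp.mul (hF1.comp measurable_fst)).integrable _)
      (((((hp.mul (hFb.comp measurable_fst)).const_mul (2 * B)).add
        ((hp.mul (hFb.comp measurable_snd)).const_mul (2 * B))).add
        ((hp.const_mul 4).sub ((hp.mul hre).const_mul (4 * B + 4)))).integrable _) ?_
    filter_upwards [hz.heat.nonneg, hu] with w hw huw
    have hp0 := hw t ht
    have hur := (abs_le.1 ((Complex.abs_re_le_norm _).trans (hz.norm_le w.1 w.2)))
    set u := (z w.1 w.2).re with hudef
    have hcs : (F w.1 - u) ^ 2 ≤ F w.1 * (F w.1 + F w.2 - 2 * u) := by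
      have h1 := Finset.sum_mul_sq_le_sq_mul_sq Finset.univ (fun i => 1 / 2 * e i w.1)
        (fun i => 1 / 2 * e i w.1 - 1 / 2 * e i w.2)
      have h2 : ∑ i, (1 / 2 * e i w.1) * (1 / 2 * e i w.1 - 1 / 2 * e i w.2) = F w.1 - u := by
        rw [huw, hF, ← Finset.sum_sub_distrib]
        exact Finset.sum_congr rfl fun i _ => by ring
      have h3 : ∑ i, (1 / 2 * e i w.1 - 1 / 2 * e i w.2) ^ 2 = F w.1 + F w.2 - 2 * u := by
        rw [huw, hF, Finset.mul_sum, ← Finset.sum_add_distrib, ← Finset.sum_sub_distrib]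
        exact Finset.sum_congr rfl fun i _ => by ring
      rw [h2, h3] at h1
      exact h1
    have hG : 0 ≤ F w.1 + F w.2 - 2 * u := by
      have h3 : ∑ i, (1 / 2 * e i w.1 - 1 / 2 * e i w.2) ^ 2 = F w.1 + F w.2 - 2 * u := by
        rw [huw, hF, Finset.mul_sum, ← Finset.sum_add_distrib, ← Finset.sum_sub_distrib]
        exact Finset.sum_congr rfl fun i _ => by ring
      rw [← h3]; exact Finset.sum_nonneg fun i _ => sq_nonneg _
    have hFB : F w.1 ≤ B := (le_abs_self _).trans (hB _)
    have h4 : (F w.1 - 1) ^ 2 ≤ 2 * B * (F w.1 + F w.2 - 2 * u) + 4 * (1 - u) := by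
      have h5 := mul_le_mul_of_nonneg_right hFB hG
      nlinarith [sq_nonneg (F w.1 - u - (u - 1)), hur.1, hur.2]
    have h6 := mul_le_mul_of_nonneg_left h4 hp0
    linarith
  have hF0 : ∫ x, (F x - 1) ^ 2 ∂μ ≤ 0 := by
    have h1 := (hz.tendsto_integral_heat (h := fun ζ => ζ.re) Complex.continuous_re).const_sub 1
    have h2 := h1.const_mul (4 * B + 4)
    simp only [Complex.one_re, sub_self, mul_zero] at h2
    refine ge_of_tendsto h2 ?_
    filter_upwards [self_mem_nhdsWithin] with t ht using hle t ht
  have hFae : ∀ᵐ x ∂μ, F x = 1 := by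
    have h1 := (integral_eq_zero_iff_of_nonneg (fun x => sq_nonneg (F x - 1))
      (((hFb.sub (BddMeas.const 1)).pow 2).integrable μ)).1
      (le_antisymm hF0 (integral_nonneg fun x => sq_nonneg _))
    filter_upwards [h1] with x hx
    have : (F x - 1) ^ 2 = 0 := hx
    have := pow_eq_zero_iff (two_ne_zero) |>.1 this
    linarith
  -- change the map on a null set
  have hset : MeasurableSet {x | F x = 1} := measurableSet_eq_fun hFb.measurable measurable_const
  classical
  refine ⟨fun i x => if F x = 1 then 1 / 2 * e i x else if i = 0 then 1 else 0, fun i => ?_,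
    fun x => ?_, ?_⟩
  · refine ⟨Measurable.ite hset (hfb i).measurable measurable_const, ?_⟩
    obtain ⟨C, hC⟩ := (hfb i).bounded
    refine ⟨max C 1, fun x => ?_⟩
    simp only
    split_ifs
    · exact (hC x).trans (le_max_left _ _)
    · rw [abs_one]; exact le_max_right _ _
    · rw [abs_zero]; exact zero_le_one.trans (le_max_right _ _)
  · by_cases h : F x = 1
    · simp only [if_pos h]; exact h
    · simp [if_neg h]
  · filter_upwards [hu, Measure.quasiMeasurePreserving_fst.ae hFae,
      Measure.quasiMeasurePreserving_snd.ae hFae] with w h1 h2 h3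
    rw [h1]
    simp only [if_pos h2, if_pos h3]

end IsDiscHeat

/-! ### Orthonormalization -/

section GramSchmidt

variable {X : Type*} [MeasurableSpace X] {μ : Measure X}

/-- The function `φ` is almost everywhere a linear combination of the `b i`. -/
def AESpan (μ : Measure X) {d : ℕ} (b : Fin d → X → ℝ) (φ : X → ℝ) : Prop :=
  ∃ c : Fin d → ℝ, ∀ᵐ x ∂μ, φ x = ∑ i, c i * b i x

theorem AESpan.sum {d : ℕ} {b : Fin d → X → ℝ} {ι : Type*} {s : Finset ι} {F : ι → X → ℝ}
    (h : ∀ i ∈ s, AESpan μ b (F i)) : AESpan μ b fun x => ∑ i ∈ s, F i x := by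
  classical
  induction s using Finset.induction_on with
  | empty => exact ⟨0, by simp⟩
  | insert a s ha ih =>
    obtain ⟨c, hc⟩ := h a (Finset.mem_insert_self a s)
    obtain ⟨c', hc'⟩ := ih fun i hi => h i (Finset.mem_insert_of_mem hi)
    refine ⟨c + c', ?_⟩
    filter_upwards [hc, hc'] with x h1 h2
    rw [Finset.sum_insert ha, h1, h2, ← Finset.sum_add_distrib]
    exact Finset.sum_congr rfl fun i _ => by simp only [Pi.add_apply]; ring

variable [IsProbabilityMeasure μ]

/-- Gram–Schmidt for bounded measurable functions, modulo null sets. -/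
theorem exists_orthonormal {ι : Type*} (φ : ι → X → ℝ) (hφ : ∀ i, BddMeas (φ i)) (s : Finset ι) :
    ∃ d ≤ s.card, ∃ b : Fin d → X → ℝ, (∀ i, BddMeas (b i)) ∧
      (∀ i j, ∫ x, b i x * b j x ∂μ = if i = j then 1 else 0) ∧ ∀ i ∈ s, AESpan μ b (φ i) := by
  classical
  induction s using Finset.induction_on with
  | empty => exact ⟨0, by simp, fun i => i.elim0, fun i => i.elim0, fun i => i.elim0, by simp⟩
  | insert a s ha ih =>
    obtain ⟨d, hd, b, hb, hbo, hsp⟩ := ih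
    set c : Fin d → ℝ := fun i => ∫ x, φ a x * b i x ∂μ with hc
    set ψ : X → ℝ := fun x => φ a x - ∑ i, c i * b i x with hψ
    have hψb : BddMeas ψ := (hφ a).sub (BddMeas.sum fun i _ => (hb i).const_mul _)
    have hψo : ∀ j, ∫ x, ψ x * b j x ∂μ = 0 := by
      intro j
      have e : ∀ x, ψ x * b j x = φ a x * b j x - ∑ i, c i * (b i x * b j x) := fun x => by
        simp only [hψ, sub_mul, Finset.sum_mul, mul_assoc]
      simp only [e]
      rw [integral_sub (((hφ a).mul (hb j)).integrable _)
        ((BddMeas.sum fun i _ => ((hb i).mul (hb j)).const_mul _).integrable _),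
        integral_finsetSum _ fun i _ => (((hb i).mul (hb j)).const_mul _).integrable _]
      simp [integral_const_mul, hbo, hc]
    set n := ∫ x, ψ x ^ 2 ∂μ with hn
    rcases (integral_nonneg fun x => sq_nonneg (ψ x) : 0 ≤ n).eq_or_lt with h0 | h0
    · refine ⟨d, hd.trans (Finset.card_le_card (Finset.subset_insert _ _)), b, hb, hbo, ?_⟩
      intro i hi
      rcases Finset.mem_insert.1 hi with rfl | hi
      · refine ⟨c, ?_⟩
        have := (integral_eq_zero_iff_of_nonneg (fun x => sq_nonneg (ψ x))
          ((hψb.pow 2).integrable μ)).1 h0.symm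
        filter_upwards [this] with x hx
        have h1 : ψ x ^ 2 = 0 := hx
        have h2 : ψ x = 0 := by simpa using h1
        simp only [hψ] at h2; linarith
      · exact hsp i hi
    · have hs0 : √n ≠ 0 := (sqrt_pos.2 h0).ne'
      have hs : √n ^ 2 = n := sq_sqrt h0.le
      set e : X → ℝ := fun x => (√n)⁻¹ * ψ x with he
      have heb : BddMeas e := hψb.const_mul _
      have hee : ∫ x, e x * e x ∂μ = 1 := by
        have e1 : ∀ x, e x * e x = (√n ^ 2)⁻¹ * ψ x ^ 2 := fun x => by simp only [he]; ring
        simp only [e1]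
        rw [integral_const_mul, hs, ← hn, inv_mul_cancel₀ h0.ne']
      have heo : ∀ j, ∫ x, e x * b j x ∂μ = 0 := fun j => by
        simp only [he, mul_assoc, integral_const_mul, hψo j, mul_zero]
      refine ⟨d + 1, by rw [Finset.card_insert_of_notMem ha]; omega, Fin.cons e b,
        Fin.cases heb hb, ?_, ?_⟩
      · refine Fin.cases (Fin.cases ?_ fun j => ?_) fun i => Fin.cases ?_ fun j => ?_
        · simpa using hee
        · simpa [(Fin.succ_ne_zero j).symm] using heo j
        · simpa [mul_comm] using heo i
        · simpa using hbo i j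
      · intro i hi
        rcases Finset.mem_insert.1 hi with rfl | hi
        · refine ⟨Fin.cons (√n) c, Eventually.of_forall fun x => ?_⟩
          rw [Fin.sum_univ_succ]
          simp only [Fin.cons_zero, Fin.cons_succ, he, hψ]
          rw [← mul_assoc, mul_inv_cancel₀ hs0]; ring
        · obtain ⟨c', hc'⟩ := hsp i hi
          refine ⟨Fin.cons 0 c', ?_⟩
          filter_upwards [hc'] with x hx
          rw [Fin.sum_univ_succ]
          simp only [Fin.cons_zero, Fin.cons_succ]
          rw [hx]; ring

end GramSchmidt

/-! ### Zonal kernels -/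

section Zonal

variable {X : Type*}

/-- The Gram kernel of a map to `ℝ⁴`. -/
def gram (f : Fin 4 → X → ℝ) (x y : X) : ℝ := ∑ i, f i x * f i y

/-- The monomials in the coordinates of a map to `ℝ⁴`. -/
def mono (f : Fin 4 → X → ℝ) (s : Multiset (Fin 4)) (x : X) : ℝ := (s.map fun i => f i x).prod

theorem gram_comm (f : Fin 4 → X → ℝ) (x y : X) : gram f x y = gram f y x :=
  Finset.sum_congr rfl fun _ _ => mul_comm _ _

theorem gram_self {f : Fin 4 → X → ℝ} (h1 : ∀ x, ∑ i, f i x ^ 2 = 1) (x : X) : gram f x x = 1 := by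
  rw [gram, ← h1 x]; exact Finset.sum_congr rfl fun _ _ => (sq _).symm

theorem gram_pow (f : Fin 4 → X → ℝ) (n : ℕ) (x y : X) : gram f x y ^ n =
    ∑ p : Fin n → Fin 4, mono f (Finset.univ.val.map p) x * mono f (Finset.univ.val.map p) y := by
  rw [gram, Fintype.sum_pow]
  refine Finset.sum_congr rfl fun p _ => ?_
  rw [Finset.prod_mul_distrib]
  simp only [mono, Multiset.map_map, Function.comp_def]
  rfl

/-- The monomials of degree `M`. -/
def degMonomials (M : ℕ) : Finset (Multiset (Fin 4)) :=
  (Finset.univ : Finset (Sym (Fin 4) M)).image fun s : Sym (Fin 4) M => (s : Multiset (Fin 4))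

theorem mem_degMonomials (s : Multiset (Fin 4)) : s ∈ degMonomials s.card :=
  Finset.mem_image.2 ⟨⟨s, rfl⟩, Finset.mem_univ _, rfl⟩

theorem card_degMonomials_le (M : ℕ) : (degMonomials M).card ≤ (M + 3).choose 3 := by
  refine Finset.card_image_le.trans (le_of_eq ?_)
  rw [Finset.card_univ, Sym.card_sym_eq_choose, Fintype.card_fin,
    show 4 + M - 1 = M + 3 by omega, Nat.choose_symm_add]

/-- The monomials of the two highest degrees at most `M`: on the unit sphere they span the
polynomials of degree at most `M`. -/
def topMonomials : ℕ → Finset (Multiset (Fin 4))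
  | 0 => degMonomials 0
  | M + 1 => degMonomials (M + 1) ∪ degMonomials M

theorem mem_topMonomials {M : ℕ} {s : Multiset (Fin 4)}
    (h : s.card = M ∨ s.card + 1 = M) : s ∈ topMonomials M := by
  rcases M with _ | M
  · have : s.card = 0 := by omega
    exact (this ▸ mem_degMonomials s : s ∈ degMonomials 0)
  · refine Finset.mem_union.2 ?_
    rcases h with h | h
    · exact Or.inl (h ▸ mem_degMonomials s)
    · have : s.card = M := by omega
      exact Or.inr (this ▸ mem_degMonomials s)

/-- The number of monomials spanning the polynomials of degree at most `M` on `S³` is the squared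
Hilbert–Schmidt norm of the kernel `∑_{j ≤ M} (j + 1) U_j`. -/
theorem choose_three_add (M : ℕ) :
    (M + 3).choose 3 + (M + 2).choose 3 = ∑ j ∈ Finset.range (M + 1), (j + 1) ^ 2 := by
  induction M with
  | zero => simp [Nat.choose]
  | succ M ih =>
    rw [Finset.sum_range_succ, ← ih]
    have h1 : (M + 1 + 3).choose 3 = (M + 3).choose 2 + (M + 3).choose 3 :=
      Nat.choose_succ_succ' _ _
    have h2 : (M + 1 + 2).choose 3 = (M + 2).choose 2 + (M + 2).choose 3 :=
      Nat.choose_succ_succ' _ _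
    have h3 : (M + 3).choose 2 = (M + 2) + (M + 2).choose 2 := by
      rw [Nat.choose_succ_succ', Nat.choose_one_right]
    have h4 : (M + 2).choose 2 * 2 = (M + 2) * (M + 1) := by
      rw [Nat.choose_two_right, Nat.div_mul_cancel (Nat.even_mul_pred_self _).two_dvd]; rfl
    rw [h1, h2, h3]
    linarith [h4]

theorem card_topMonomials_le (M : ℕ) :
    (topMonomials M).card ≤ ∑ j ∈ Finset.range (M + 1), (j + 1) ^ 2 := by
  rw [← choose_three_add]
  rcases M with _ | M
  · exact (card_degMonomials_le 0).trans (Nat.le_add_right _ _)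
  · exact (Finset.card_union_le _ _).trans
      (add_le_add (card_degMonomials_le (M + 1)) (card_degMonomials_le M))

variable [MeasurableSpace X] {μ : Measure X} {f : Fin 4 → X → ℝ}

theorem bddMeas_mono (hf : ∀ i, BddMeas (f i)) (s : Multiset (Fin 4)) : BddMeas (mono f s) := by
  induction s using Multiset.induction with
  | empty =>
    have : mono f 0 = fun _ => 1 := by funext x; simp [mono]
    rw [this]; exact BddMeas.const 1
  | cons a s ih =>
    have : mono f (a ::ₘ s) = fun x => f a x * mono f s x := by
      funext x; simp [mono]
    rw [this]; exact (hf a).mul ih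

theorem bddMeas_eval_gram (hf : ∀ i, BddMeas (f i)) (Q : ℝ[X]) :
    BddMeas fun w : X × X => Q.eval (gram f w.1 w.2) := by
  have hg : BddMeas fun w : X × X => gram f w.1 w.2 :=
    BddMeas.sum fun i _ => ((hf i).comp measurable_fst).mul ((hf i).comp measurable_snd)
  simp only [Polynomial.eval_eq_sum_range]
  exact BddMeas.sum fun i _ => (hg.pow i).const_mul _

theorem aeSpan_mono (h1 : ∀ x, ∑ i, f i x ^ 2 = 1) {M d : ℕ} {b : Fin d → X → ℝ}
    (hb : ∀ s ∈ topMonomials M, AESpan μ b (mono f s)) {s : Multiset (Fin 4)} (hs : s.card ≤ M) :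
    AESpan μ b (mono f s) := by
  obtain ⟨k, hk⟩ := Nat.exists_eq_add_of_le hs
  clear hs
  induction k using Nat.twoStepInduction generalizing s with
  | zero => exact hb s (mem_topMonomials (Or.inl (by omega)))
  | one => exact hb s (mem_topMonomials (Or.inr (by omega)))
  | more k ih _ =>
    have e : mono f s = fun x => ∑ i : Fin 4, mono f (i ::ₘ i ::ₘ s) x := by
      funext x
      simp only [mono, Multiset.map_cons, Multiset.prod_cons, ← mul_assoc, ← Finset.sum_mul, ← sq]
      rw [h1, one_mul]
    rw [e]
    exact AESpan.sum fun i _ => ih (by simp only [Multiset.card_cons]; omega)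

/-- The kernel of the projection to the polynomials of degree less than `n`, as a function of the
inner product. -/
def zonal (n : ℕ) : ℝ[X] := ∑ j ∈ Finset.range n, C ((j : ℝ) + 1) * Chebyshev.U ℝ j

theorem natDegree_zonal_le (n : ℕ) : (zonal (n + 1)).natDegree ≤ n := by
  refine Polynomial.natDegree_sum_le_of_forall_le _ _ fun j hj => ?_
  refine (Polynomial.natDegree_C_mul_le _ _).trans ?_
  rw [Chebyshev.natDegree_U_natCast]
  exact Nat.lt_succ_iff.1 (Finset.mem_range.1 hj)

theorem zonal_eval_one (n : ℕ) : (zonal n).eval 1 = ∑ j ∈ Finset.range n, ((j : ℝ) + 1) ^ 2 := by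
  simp only [zonal, eval_finsetSum, eval_mul, eval_C]
  refine Finset.sum_congr rfl fun j _ => ?_
  rw [Chebyshev.U_eval_one]; push_cast; ring

variable [IsProbabilityMeasure μ]

/-- The kernel `zonal (M + 1)` reproduces the polynomials of degree at most `M`: it has rank, trace
and squared Hilbert–Schmidt norm equal to (respectively at most) `∑ (j+1)²`. -/
theorem zonal_comp (hf : ∀ i, BddMeas (f i)) (h1 : ∀ x, ∑ i, f i x ^ 2 = 1)
    (horth : ∀ m l : ℕ, ∫ w : X × X, (Chebyshev.U ℝ m).eval (gram f w.1 w.2) *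
      (Chebyshev.U ℝ l).eval (gram f w.1 w.2) ∂(μ.prod μ) = if m = l then 1 else 0)
    {M : ℕ} {Q : ℝ[X]} (hQ : Q.natDegree ≤ M) :
    ∀ᵐ w ∂(μ.prod μ), ∫ v, (zonal (M + 1)).eval (gram f w.1 v) * Q.eval (gram f v w.2) ∂μ =
      Q.eval (gram f w.1 w.2) := by
  obtain ⟨d, hd, b, hb, hbo, hsp⟩ := exists_orthonormal (μ := μ) (mono f) (bddMeas_mono hf)
    (topMonomials M)
  have hd' : (d : ℝ) ≤ ∑ j ∈ Finset.range (M + 1), ((j : ℝ) + 1) ^ 2 := by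
    have := hd.trans (card_topMonomials_le M)
    exact_mod_cast this
  set D := ∑ j ∈ Finset.range (M + 1), ((j : ℝ) + 1) ^ 2 with hD
  have hsp' : ∀ s : Multiset (Fin 4), ∃ c : Fin d → ℝ, s.card ≤ M →
      ∀ᵐ x ∂μ, mono f s x = ∑ i, c i * b i x := by
    intro s
    by_cases hs : s.card ≤ M
    · obtain ⟨c, hc⟩ := aeSpan_mono h1 hsp hs
      exact ⟨c, fun _ => hc⟩
    · exact ⟨0, fun h => absurd h hs⟩
  choose c hc using hsp'
  -- off a null set, polynomials in the Gram kernel are bilinear in the orthonormal functions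
  have hX : ∀ᵐ x ∂μ, ∀ s : Multiset (Fin 4), s.card ≤ M → mono f s x = ∑ i, c s i * b i x := by
    rw [ae_all_iff]; intro s
    by_cases hs : s.card ≤ M
    · filter_upwards [hc s hs] with x hx _ using hx
    · exact Eventually.of_forall fun x h => absurd h hs
  set X₀ := {x | ∀ s : Multiset (Fin 4), s.card ≤ M → mono f s x = ∑ i, c s i * b i x}
  have hbil : ∀ R : ℝ[X], R.natDegree ≤ M → ∃ A : Fin d → Fin d → ℝ, ∀ x ∈ X₀, ∀ y ∈ X₀,
      R.eval (gram f x y) = ∑ i, ∑ j, A i j * (b i x * b j y) := by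
    intro R hR
    refine ⟨fun i j => ∑ n ∈ Finset.range (M + 1), R.coeff n * ∑ p : Fin n → Fin 4,
      c (Finset.univ.val.map p) i * c (Finset.univ.val.map p) j, fun x hx y hy => ?_⟩
    rw [Polynomial.eval_eq_sum_range' (Nat.lt_succ_of_le hR)]
    simp only [Finset.sum_mul]
    rw [Finset.sum_congr rfl fun i _ => Finset.sum_comm, Finset.sum_comm]
    refine Finset.sum_congr rfl fun n hn => ?_
    have hn' : n ≤ M := Nat.lt_succ_iff.1 (Finset.mem_range.1 hn)
    rw [gram_pow]
    have e : ∀ p : Fin n → Fin 4, mono f (Finset.univ.val.map p) x *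
        mono f (Finset.univ.val.map p) y = ∑ i, ∑ j, c (Finset.univ.val.map p) i *
        c (Finset.univ.val.map p) j * (b i x * b j y) := by
      intro p
      have hcard : (Finset.univ.val.map p).card ≤ M := by simpa using hn'
      rw [hx _ hcard, hy _ hcard, Finset.sum_mul_sum]
      exact Finset.sum_congr rfl fun i _ => Finset.sum_congr rfl fun j _ => by ring
    simp only [e]
    rw [Finset.sum_comm, Finset.mul_sum]
    refine Finset.sum_congr rfl fun i _ => ?_
    rw [Finset.sum_comm, Finset.mul_sum]
    refine Finset.sum_congr rfl fun j _ => ?_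
    rw [mul_assoc, Finset.sum_mul]
  obtain ⟨A, hA⟩ := hbil (zonal (M + 1)) (natDegree_zonal_le M)
  have hXp : ∀ᵐ w ∂(μ.prod μ), w.1 ∈ X₀ ∧ w.2 ∈ X₀ :=
    (Measure.quasiMeasurePreserving_fst.ae hX).and (Measure.quasiMeasurePreserving_snd.ae hX)
  have htrace : ∑ i, A i i = D := by
    have h2 : ∫ x, (zonal (M + 1)).eval (gram f x x) ∂μ = D := by
      simp only [gram_self h1, zonal_eval_one]; simp [hD]
    have h3 : ∫ x, (zonal (M + 1)).eval (gram f x x) ∂μ =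
        ∫ x, ∑ i, ∑ j, A i j * (b i x * b j x) ∂μ := by
      refine integral_congr_ae ?_
      filter_upwards [hX] with x hx using hA x hx x hx
    rw [h3, integral_finsetSum _ fun i _ => (BddMeas.sum fun j _ =>
      ((hb i).mul (hb j)).const_mul _).integrable _] at h2
    rw [← h2]
    refine Finset.sum_congr rfl fun i _ => ?_
    rw [integral_finsetSum _ fun j _ => (((hb i).mul (hb j)).const_mul _).integrable _]
    simp [integral_const_mul, hbo]
  have hnorm : ∑ i, ∑ j, A i j ^ 2 = D := by
    have h2 : ∫ w : X × X, (zonal (M + 1)).eval (gram f w.1 w.2) *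
        (zonal (M + 1)).eval (gram f w.1 w.2) ∂(μ.prod μ) = D := by
      simp only [zonal, eval_finsetSum, eval_mul, eval_C, Finset.sum_mul_sum]
      have hUU : ∀ j k : ℕ, BddMeas fun w : X × X => ((j : ℝ) + 1) *
          (Chebyshev.U ℝ j).eval (gram f w.1 w.2) *
          (((k : ℝ) + 1) * (Chebyshev.U ℝ k).eval (gram f w.1 w.2)) := fun j k =>
        ((bddMeas_eval_gram hf _).const_mul _).mul ((bddMeas_eval_gram hf _).const_mul _)
      rw [integral_finsetSum _ fun j _ => (BddMeas.sum fun k _ => hUU j k).integrable _]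
      refine Finset.sum_congr rfl fun j hj => ?_
      rw [integral_finsetSum _ fun k _ => (hUU j k).integrable _]
      have e : ∀ k : ℕ, ∫ w : X × X, ((j : ℝ) + 1) * (Chebyshev.U ℝ j).eval (gram f w.1 w.2) *
          (((k : ℝ) + 1) * (Chebyshev.U ℝ k).eval (gram f w.1 w.2)) ∂(μ.prod μ) =
          if j = k then ((j : ℝ) + 1) ^ 2 else 0 := by
        intro k
        have e1 : ∀ w : X × X, ((j : ℝ) + 1) * (Chebyshev.U ℝ j).eval (gram f w.1 w.2) *
          (((k : ℝ) + 1) * (Chebyshev.U ℝ k).eval (gram f w.1 w.2)) = ((j : ℝ) + 1) * (k + 1) *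
          ((Chebyshev.U ℝ j).eval (gram f w.1 w.2) * (Chebyshev.U ℝ k).eval (gram f w.1 w.2)) :=
          fun w => by ring
        simp only [e1]
        rw [integral_const_mul, horth]
        split_ifs with h
        · rw [h]; ring
        · ring
      simp only [e]
      rw [Finset.sum_ite_eq, if_pos hj]
    have hBB : ∀ i j k l, BddMeas fun w : X × X => A i j * (b i w.1 * b j w.2) *
        (A k l * (b k w.1 * b l w.2)) := fun i j k l =>
      ((((hb i).comp measurable_fst).mul ((hb j).comp measurable_snd)).const_mul _).mul
      ((((hb k).comp measurable_fst).mul ((hb l).comp measurable_snd)).const_mul _)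
    have h3 : ∫ w : X × X, (zonal (M + 1)).eval (gram f w.1 w.2) *
        (zonal (M + 1)).eval (gram f w.1 w.2) ∂(μ.prod μ) = ∫ w : X × X, ∑ i, ∑ k, ∑ j, ∑ l,
          A i j * (b i w.1 * b j w.2) * (A k l * (b k w.1 * b l w.2)) ∂(μ.prod μ) := by
      refine integral_congr_ae ?_
      filter_upwards [hXp] with w hw
      rw [hA _ hw.1 _ hw.2, Finset.sum_mul_sum]
      exact Finset.sum_congr rfl fun i _ => Finset.sum_congr rfl fun k _ => Finset.sum_mul_sum ..
    rw [← h2, h3, integral_finsetSum _ fun i _ => (BddMeas.sum fun k _ => BddMeas.sum fun j _ =>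
      BddMeas.sum fun l _ => hBB i j k l).integrable _]
    refine Finset.sum_congr rfl fun i _ => ?_
    rw [integral_finsetSum _ fun k _ => (BddMeas.sum fun j _ =>
      BddMeas.sum fun l _ => hBB i j k l).integrable _]
    have e : ∀ k, ∫ w : X × X, ∑ j, ∑ l, A i j * (b i w.1 * b j w.2) *
        (A k l * (b k w.1 * b l w.2)) ∂(μ.prod μ) = if i = k then ∑ j, A i j ^ 2 else 0 := by
      intro k
      rw [integral_finsetSum _ fun j _ => (BddMeas.sum fun l _ => hBB i j k l).integrable _]
      have e2 : ∀ j, ∫ w : X × X, ∑ l, A i j * (b i w.1 * b j w.2) *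
        (A k l * (b k w.1 * b l w.2)) ∂(μ.prod μ) = if i = k then A i j ^ 2 else 0 := by
        intro j
        rw [integral_finsetSum _ fun l _ => (hBB i j k l).integrable _]
        have e3 : ∀ l, ∫ w : X × X, A i j * (b i w.1 * b j w.2) *
            (A k l * (b k w.1 * b l w.2)) ∂(μ.prod μ) =
            if j = l then (if i = k then A i j * A k l else 0) else 0 := by
          intro l
          have e4 : ∀ w : X × X, A i j * (b i w.1 * b j w.2) * (A k l * (b k w.1 * b l w.2)) =
            A i j * A k l * ((b i w.1 * b k w.1) * (b j w.2 * b l w.2)) := fun w => by ring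
          simp only [e4]
          rw [integral_const_mul, integral_prod_mul (fun x => b i x * b k x)
            (fun y => b j y * b l y), hbo, hbo]
          split_ifs <;> ring
        simp only [e3]
        rw [Finset.sum_ite_eq, if_pos (Finset.mem_univ _)]
        split_ifs with h
        · rw [h]; ring
        · rfl
      simp only [e2]
      split_ifs <;> simp
    simp only [e]
    rw [Finset.sum_ite_eq, if_pos (Finset.mem_univ _)]
  have hone : ∀ i j, A i j = if i = j then 1 else 0 := by
    have h2 : ∑ i, ∑ j, (A i j - if i = j then 1 else 0) ^ 2 ≤ 0 := by
      have e : ∀ i j, (A i j - if i = j then 1 else 0) ^ 2 =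
          A i j ^ 2 + (if i = j then 1 - 2 * A i j else 0) := fun i j => by split_ifs <;> ring
      simp only [e, Finset.sum_add_distrib, Finset.sum_ite_eq, Finset.mem_univ, if_true]
      rw [hnorm, Finset.sum_sub_distrib, ← Finset.mul_sum, htrace]
      simp only [Finset.sum_const, Finset.card_univ, Fintype.card_fin, nsmul_eq_mul, mul_one]
      linarith
    intro i j
    have h3 := (Finset.sum_eq_zero_iff_of_nonneg fun i _ => Finset.sum_nonneg fun j _ =>
      sq_nonneg (A i j - if i = j then 1 else 0)).1 (le_antisymm h2 (Finset.sum_nonneg fun i _ =>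
      Finset.sum_nonneg fun j _ => sq_nonneg _)) i (Finset.mem_univ _)
    have h4 := (Finset.sum_eq_zero_iff_of_nonneg fun j _ => sq_nonneg _).1 h3 j (Finset.mem_univ _)
    have h5 := pow_eq_zero_iff two_ne_zero |>.1 h4
    linarith
  obtain ⟨A', hA'⟩ := hbil Q hQ
  filter_upwards [hXp] with w hw
  have e : ∫ v, (zonal (M + 1)).eval (gram f w.1 v) * Q.eval (gram f v w.2) ∂μ =
      ∫ v, ∑ k, ∑ i, ∑ j, b i w.1 * A' k j * b j w.2 * (b i v * b k v) ∂μ := by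
    refine integral_congr_ae ?_
    filter_upwards [hX] with v hv
    rw [hA _ hw.1 v hv, hA' v hv _ hw.2]
    simp only [hone, ite_mul, one_mul, zero_mul, Finset.sum_ite_eq, Finset.mem_univ, if_true]
    rw [Finset.sum_mul_sum, Finset.sum_comm]
    refine Finset.sum_congr rfl fun k _ => Finset.sum_congr rfl fun i _ => ?_
    rw [Finset.mul_sum]
    exact Finset.sum_congr rfl fun j _ => by ring
  have hBB : ∀ i j k, BddMeas fun v => b i w.1 * A' k j * b j w.2 * (b i v * b k v) :=
    fun i j k => ((hb i).mul (hb k)).const_mul _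
  rw [e, hA' _ hw.1 _ hw.2, integral_finsetSum _ fun k _ => (BddMeas.sum fun i _ =>
    BddMeas.sum fun j _ => hBB i j k).integrable _]
  refine Finset.sum_congr rfl fun k _ => ?_
  rw [integral_finsetSum _ fun i _ => (BddMeas.sum fun j _ => hBB i j k).integrable _]
  have e2 : ∀ i, ∫ v, ∑ j, b i w.1 * A' k j * b j w.2 * (b i v * b k v) ∂μ =
      if i = k then ∑ j, A' k j * (b k w.1 * b j w.2) else 0 := by
    intro i
    rw [integral_finsetSum _ fun j _ => (hBB i j k).integrable _]
    simp only [integral_const_mul, hbo]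
    split_ifs with h
    · rw [h]; exact Finset.sum_congr rfl fun j _ => by ring
    · simp
  simp only [e2]
  rw [Finset.sum_ite_eq', if_pos (Finset.mem_univ _)]

/-- The kernels `(m+1) U_m` are idempotent and mutually orthogonal. -/
theorem chebyshevU_comp (hf : ∀ i, BddMeas (f i)) (h1 : ∀ x, ∑ i, f i x ^ 2 = 1)
    (horth : ∀ m l : ℕ, ∫ w : X × X, (Chebyshev.U ℝ m).eval (gram f w.1 w.2) *
      (Chebyshev.U ℝ l).eval (gram f w.1 w.2) ∂(μ.prod μ) = if m = l then 1 else 0) :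
    ∀ᵐ w ∂(μ.prod μ), ∀ m l : ℕ, ∫ v, (((m : ℝ) + 1) * (Chebyshev.U ℝ m).eval (gram f w.1 v)) *
      (((l : ℝ) + 1) * (Chebyshev.U ℝ l).eval (gram f v w.2)) ∂μ =
      if m = l then ((m : ℝ) + 1) * (Chebyshev.U ℝ m).eval (gram f w.1 w.2) else 0 := by
  set K : ℕ → ℝ[X] := fun m => C ((m : ℝ) + 1) * Chebyshev.U ℝ m with hK
  have hKe : ∀ (m : ℕ) (x : ℝ), ((m : ℝ) + 1) * (Chebyshev.U ℝ m).eval x = (K m).eval x :=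
      fun m x => by
    simp [hK]
  simp only [hKe]
  have hKd : ∀ m, (K m).natDegree ≤ m := fun m => by
    refine (Polynomial.natDegree_C_mul_le _ _).trans ?_
    rw [Chebyshev.natDegree_U_natCast]
  have hKs : ∀ m, zonal (m + 1) = zonal m + K m := fun m => Finset.sum_range_succ _ _
  have hbd : ∀ (P Q : ℝ[X]) (x y : X), BddMeas fun v => P.eval (gram f x v) * Q.eval (gram f v y) :=
    fun P Q x y => ((bddMeas_eval_gram hf P).comp measurable_prodMk_left).mul
      ((bddMeas_eval_gram hf Q).comp measurable_prodMk_right)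
  have hlt : ∀ᵐ w ∂(μ.prod μ), ∀ m l : ℕ, l < m →
      ∫ v, (K m).eval (gram f w.1 v) * (K l).eval (gram f v w.2) ∂μ = 0 := by
    rw [ae_all_iff]; intro m
    rw [ae_all_iff]; intro l
    rcases m with _ | m
    · simp
    by_cases hl : l < m + 1
    swap
    · exact Eventually.of_forall fun w h => absurd h hl
    filter_upwards [zonal_comp hf h1 horth (M := m) ((hKd l).trans (Nat.lt_succ_iff.1 hl)),
      zonal_comp hf h1 horth (M := m + 1) ((hKd l).trans hl.le)] with w h2 h3 _
    rw [hKs (m + 1)] at h3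
    simp only [eval_add, add_mul] at h3
    rw [integral_add ((hbd _ _ _ _).integrable _) ((hbd _ _ _ _).integrable _), h2] at h3
    linarith
  have hgt := (Measure.measurePreserving_swap (μ := μ) (ν := μ)).quasiMeasurePreserving.ae hlt
  have hne : ∀ᵐ w ∂(μ.prod μ), ∀ m l : ℕ, m ≠ l →
      ∫ v, (K m).eval (gram f w.1 v) * (K l).eval (gram f v w.2) ∂μ = 0 := by
    filter_upwards [hlt, hgt] with w h2 h3 m l hml
    rcases lt_or_gt_of_ne hml with h | h
    · rw [← h3 l m h]
      refine integral_congr_ae (Eventually.of_forall fun v => ?_)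
      simp only [Prod.fst_swap, Prod.snd_swap]
      rw [gram_comm f w.2 v, gram_comm f v w.1, mul_comm]
    · exact h2 m l h
  have hrep : ∀ᵐ w ∂(μ.prod μ), ∀ m : ℕ,
      ∫ v, (zonal (m + 1)).eval (gram f w.1 v) * (K m).eval (gram f v w.2) ∂μ =
        (K m).eval (gram f w.1 w.2) := by
    rw [ae_all_iff]; intro m
    exact zonal_comp hf h1 horth (hKd m)
  filter_upwards [hne, hrep] with w h2 h3 m l
  split_ifs with h
  · subst h
    have h4 := h3 m
    rw [zonal] at h4
    simp only [eval_finsetSum, Finset.sum_mul] at h4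
    rw [integral_finsetSum _ fun j _ => (hbd (K j) (K m) _ _).integrable _,
      Finset.sum_range_succ, Finset.sum_eq_zero fun j hj =>
        h2 j m (Finset.mem_range.1 hj).ne, zero_add] at h4
    exact h4
  · exact h2 m l h

end Zonal

/-! ### The spherical heat kernel on a space with zonal projections -/

section SphereKernel

variable {X Y : Type*} [MeasurableSpace X] [MeasurableSpace Y]

/-- A kernel `u` with values in `[-1, 1]` for which the kernels `(m+1) U_m(u)` behave like
those of the spectral projections of the unit sphere of `ℝ⁴`. -/
structure IsSphereKernel (μ : Measure X) (u : X → X → ℝ) : Prop where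
  measurable : Measurable fun w : X × X => u w.1 w.2
  abs_le_one : ∀ x y, |u x y| ≤ 1
  orth : ∀ m l : ℕ, ∫ w : X × X, (Chebyshev.U ℝ m).eval (u w.1 w.2) *
    (Chebyshev.U ℝ l).eval (u w.1 w.2) ∂(μ.prod μ) = if m = l then 1 else 0
  comp : ∀ᵐ w ∂(μ.prod μ), ∀ m l : ℕ, ∫ v, (((m : ℝ) + 1) * (Chebyshev.U ℝ m).eval (u w.1 v)) *
    (((l : ℝ) + 1) * (Chebyshev.U ℝ l).eval (u v w.2)) ∂μ =
    if m = l then ((m : ℝ) + 1) * (Chebyshev.U ℝ m).eval (u w.1 w.2) else 0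

/-- The map to the sphere transports the zonal kernels of `S³`. -/
theorem IsDiscHeat.isSphereKernel {μ : Measure X} [IsProbabilityMeasure μ] {z : X → X → ℂ}
    (hz : IsDiscHeat μ z) : IsSphereKernel μ fun x y => (z x y).re := by
  obtain ⟨f, hf, h1, hzf⟩ := hz.exists_sphere_map
  have hg : ∀ᵐ w ∂(μ.prod μ), (z w.1 w.2).re = gram f w.1 w.2 := hzf
  have horth : ∀ m l : ℕ, ∫ w : X × X, (Chebyshev.U ℝ m).eval (gram f w.1 w.2) *
      (Chebyshev.U ℝ l).eval (gram f w.1 w.2) ∂(μ.prod μ) = if m = l then 1 else 0 := by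
    intro m l
    rw [← hz.integral_chebyshevU m l]
    refine integral_congr_ae ?_
    filter_upwards [hg] with w hw
    rw [hw]
  refine ⟨Complex.measurable_re.comp hz.measurable,
    fun x y => (Complex.abs_re_le_norm _).trans (hz.norm_le x y),
    hz.integral_chebyshevU, ?_⟩
  have hsec := Measure.ae_ae_of_ae_prod hg
  have h2 := Measure.quasiMeasurePreserving_fst (μ := μ) (ν := μ) |>.ae hsec
  have h3 := Measure.quasiMeasurePreserving_snd (μ := μ) (ν := μ) |>.ae hsec
  filter_upwards [chebyshevU_comp hf h1 horth, hg, h2, h3] with w hw h0 h2 h3 m l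
  simp only [h0]
  rw [← hw m l]
  refine integral_congr_ae ?_
  filter_upwards [h2, h3] with v hv1 hv2
  rw [hv1, hz.symm v w.2, hv2, gram_comm f w.2 v]

theorem exists_continuous_eqOn_heatSphere {t : ℝ} (ht : 0 < t) :
    ∃ h : ℝ → ℝ, Continuous h ∧ ∀ x, |x| ≤ 1 → heatSphere t x = h x := by
  refine ⟨IccExtend (by norm_num : (-1 : ℝ) ≤ 1) ((Icc (-1 : ℝ) 1).domRestrict (heatSphere t)),
    (continuousOn_iff_continuous_domRestrict.1 (continuousOn_heatSphere ht)).Icc_extend', ?_⟩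
  intro x hx
  rw [IccExtend_of_mem _ _ (abs_le.1 hx)]
  rfl

theorem BddMeas.of_continuous_of_abs_le_one {u : X → ℝ} (hum : Measurable u)
    (hu : ∀ x, |u x| ≤ 1) {h : ℝ → ℝ} (hh : Continuous h) : BddMeas fun x => h (u x) := by
  obtain ⟨B, hB⟩ := (isCompact_Icc (a := (-1 : ℝ)) (b := 1)).exists_bound_of_continuousOn
    hh.continuousOn
  exact ⟨hh.measurable.comp hum, B, fun x => hB _ (abs_le.1 (hu x))⟩

theorem BddMeas.heatSphere {u : X → ℝ} (hum : Measurable u) (hu : ∀ x, |u x| ≤ 1) {t : ℝ}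
    (ht : 0 < t) : BddMeas fun x => heatSphere t (u x) := by
  obtain ⟨h, hh, he⟩ := exists_continuous_eqOn_heatSphere ht
  simp only [fun x => he _ (hu x)]
  exact BddMeas.of_continuous_of_abs_le_one hum hu hh

theorem hasSum_integral_heatSphere_mul {μ : Measure X} [IsProbabilityMeasure μ] {u : X → ℝ}
    (hum : Measurable u) (hu : ∀ x, |u x| ≤ 1) {g : X → ℝ} (hg : BddMeas g) {t : ℝ} (ht : 0 < t) :
    HasSum (fun m : ℕ => rexp (-(m * (m + 2)) * t) *
      ∫ x, ((m : ℝ) + 1) * (Chebyshev.U ℝ m).eval (u x) * g x ∂μ)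
      (∫ x, heatSphere t (u x) * g x ∂μ) := by
  obtain ⟨C, hC⟩ := hg.bounded
  have hb : ∀ m : ℕ, BddMeas fun x => rexp (-((m : ℝ) * (m + 2)) * t) *
      (((m : ℝ) + 1) * (Chebyshev.U ℝ m).eval (u x) * g x) := fun m =>
    ((((BddMeas.of_continuous_of_abs_le_one hum hu
      (Polynomial.continuous (Chebyshev.U ℝ m))).const_mul _).mul hg).const_mul _)
  have h1 := hasSum_integral_of_summable_integral_norm (μ := μ)
    (F := fun (m : ℕ) x => rexp (-((m : ℝ) * (m + 2)) * t) *
      (((m : ℝ) + 1) * (Chebyshev.U ℝ m).eval (u x) * g x)) (fun m => (hb m).integrable μ) ?_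
  · simp only [integral_const_mul] at h1
    have e : ∫ x, heatSphere t (u x) * g x ∂μ = ∫ x, ∑' m : ℕ, rexp (-((m : ℝ) * (m + 2)) * t) *
        (((m : ℝ) + 1) * (Chebyshev.U ℝ m).eval (u x) * g x) ∂μ := by
      refine integral_congr_ae (Eventually.of_forall fun x => ?_)
      have h2 := (hasSum_heatSphere ht (hu x)).mul_right (g x)
      simp only
      rw [← h2.tsum_eq]
      exact tsum_congr fun m => by ring
    rw [e]
    exact h1
  · refine Summable.of_nonneg_of_le (fun m => integral_nonneg fun x => norm_nonneg _) (fun m => ?_)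
      ((summable_succ_pow_mul_exp 2 (by linarith : 0 < 2 * t)).mul_right |C|)
    have := norm_integral_le_of_norm_le_const (μ := μ)
      (f := fun x => ‖rexp (-((m : ℝ) * (m + 2)) * t) *
        (((m : ℝ) + 1) * (Chebyshev.U ℝ m).eval (u x) * g x)‖)
      (C := ((m : ℝ) + 1) ^ 2 * rexp (-(2 * t) * m) * |C|) (Eventually.of_forall fun x => by
        rw [norm_norm, show rexp (-((m : ℝ) * (m + 2)) * t) *
          (((m : ℝ) + 1) * (Chebyshev.U ℝ m).eval (u x) * g x) = (((m : ℝ) + 1) *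
          rexp (-(m * (m + 2)) * t) * (Chebyshev.U ℝ m).eval (u x)) * g x by ring, norm_mul]
        exact mul_le_mul (heatSphere_term_le ht.le m (hu x)) ((hC x).trans (le_abs_self C))
          (norm_nonneg _) (by positivity))
    rw [probReal_univ, mul_one] at this
    exact (le_abs_self _).trans this

theorem exists_eq_sum_chebyshevU (g : ℝ[X]) : ∃ (s : Finset ℕ) (c : ℕ → ℝ),
    g = ∑ m ∈ s, C (c m) * Chebyshev.U ℝ m := by
  let S : Polynomial.Sequence ℝ :=
    ⟨fun m => Chebyshev.U ℝ m, fun m => Chebyshev.degree_U_natCast ℝ m⟩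
  have hS : Submodule.span ℝ (Set.range S) = ⊤ := S.span fun m =>
    isUnit_iff_ne_zero.2 (Polynomial.leadingCoeff_ne_zero.2 (S.ne_zero m))
  have hg : g ∈ Submodule.span ℝ (Set.range S) := hS ▸ Submodule.mem_top
  obtain ⟨c, hc⟩ := Finsupp.mem_span_range_iff_exists_finsupp.1 hg
  refine ⟨c.support, c, hc.symm.trans ?_⟩
  rw [Finsupp.sum]
  exact Finset.sum_congr rfl fun m _ => Polynomial.smul_eq_C_mul _

theorem continuousOn_heatSphere_time {x : ℝ} (hx : |x| ≤ 1) :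
    ContinuousOn (fun t => heatSphere t x) (Ioi 0) := by
  intro t₀ ht₀
  have ht₀ : 0 < t₀ := ht₀
  have h : ContinuousOn (fun t => heatSphere t x) (Ici (t₀ / 2)) := by
    unfold heatSphere
    refine continuousOn_tsum (fun m => by fun_prop)
      (summable_succ_pow_mul_exp 2 ht₀) fun m t ht => ?_
    have ht : t₀ / 2 ≤ t := ht
    refine (heatSphere_term_le (by linarith) m hx).trans ?_
    have : -(2 * t) * (m : ℝ) ≤ -t₀ * m :=
      mul_le_mul_of_nonneg_right (by linarith) (Nat.cast_nonneg m)
    gcongr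
  exact (h.continuousAt (Ici_mem_nhds (by linarith))).continuousWithinAt

namespace IsSphereKernel

variable {μ : Measure X} {u : X → X → ℝ}

theorem bddMeas (hu : IsSphereKernel μ u) {h : ℝ → ℝ} (hh : Continuous h) :
    BddMeas fun w : X × X => h (u w.1 w.2) :=
  BddMeas.of_continuous_of_abs_le_one hu.measurable (fun _ => hu.abs_le_one _ _) hh

theorem bddMeas_heat (hu : IsSphereKernel μ u) {t : ℝ} (ht : 0 < t) :
    BddMeas fun w : X × X => heatSphere t (u w.1 w.2) :=
  BddMeas.heatSphere hu.measurable (fun _ => hu.abs_le_one _ _) ht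

variable [IsProbabilityMeasure μ]

theorem integral_heat_mul_chebyshevU (hu : IsSphereKernel μ u) {t : ℝ} (ht : 0 < t) (l : ℕ) :
    ∫ w : X × X, heatSphere t (u w.1 w.2) * (Chebyshev.U ℝ l).eval (u w.1 w.2) ∂(μ.prod μ) =
      (l + 1) * rexp (-(l * (l + 2)) * t) := by
  have h := hasSum_integral_heatSphere_mul (μ := μ.prod μ) hu.measurable
    (fun w => hu.abs_le_one w.1 w.2) (hu.bddMeas (Polynomial.continuous (Chebyshev.U ℝ l))) ht
  simp only [mul_assoc ((_ : ℝ) + 1), integral_const_mul, hu.orth] at h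
  rw [← h.tsum_eq, tsum_eq_single l fun m hm => by rw [if_neg hm, mul_zero, mul_zero], if_pos rfl]
  ring

/-- The mean of the heat kernel against a nonnegative polynomial is the value at the pole of its
evolution under the heat semigroup of the sphere. -/
theorem integral_heat_mul_poly_nonneg (hu : IsSphereKernel μ u) {t : ℝ} (ht : 0 < t) (g : ℝ[X])
    (hg : ∀ x ∈ Icc (-1 : ℝ) 1, 0 ≤ g.eval x) :
    0 ≤ ∫ w : X × X, heatSphere t (u w.1 w.2) * g.eval (u w.1 w.2) ∂(μ.prod μ) := by
  obtain ⟨s, c, rfl⟩ := exists_eq_sum_chebyshevU g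
  simp only [eval_finsetSum, eval_mul, eval_C] at hg ⊢
  refine (sphere_heat_nonneg s c hg ht.le (x := 1) (by norm_num)).trans (le_of_eq ?_)
  simp only [Finset.mul_sum]
  have hb : ∀ m, BddMeas fun w : X × X => heatSphere t (u w.1 w.2) *
      (c m * (Chebyshev.U ℝ m).eval (u w.1 w.2)) := fun m =>
    (hu.bddMeas_heat ht).mul ((hu.bddMeas (Polynomial.continuous (Chebyshev.U ℝ m))).const_mul _)
  rw [integral_finsetSum _ fun m _ => (hb m).integrable _]
  refine Finset.sum_congr rfl fun m _ => ?_
  simp only [mul_left_comm _ (c m)]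
  rw [integral_const_mul, hu.integral_heat_mul_chebyshevU ht, Chebyshev.U_eval_one]
  push_cast; ring

theorem integral_heat_mul_nonneg (hu : IsSphereKernel μ u) {t : ℝ} (ht : 0 < t) {h : ℝ → ℝ}
    (hh : Continuous h) (h0 : ∀ x, 0 ≤ h x) :
    0 ≤ ∫ w : X × X, heatSphere t (u w.1 w.2) * h (u w.1 w.2) ∂(μ.prod μ) := by
  obtain ⟨B, hB⟩ := (hu.bddMeas_heat ht).bounded
  refine le_of_forall_pos_le_add fun ε hε => ?_
  have hB0 : 0 < 2 * (|B| + 1) := by positivity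
  obtain ⟨p, hp⟩ := exists_polynomial_near_of_continuousOn (-1) 1 h hh.continuousOn
    (ε / (2 * (|B| + 1))) (by positivity)
  set δ := ε / (2 * (|B| + 1)) with hδ
  have h1 := hu.integral_heat_mul_poly_nonneg ht (p + C δ) fun x hx => by
    have := (abs_lt.1 (hp x hx)).1
    rw [eval_add, eval_C]; linarith [h0 x]
  refine h1.trans ?_
  have h2 : ∀ w : X × X, heatSphere t (u w.1 w.2) * (p + C δ).eval (u w.1 w.2) ≤
      heatSphere t (u w.1 w.2) * h (u w.1 w.2) + ε := by
    intro w
    have h3 := abs_lt.1 (hp _ (abs_le.1 (hu.abs_le_one w.1 w.2)))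
    have h4 : |p.eval (u w.1 w.2) + δ - h (u w.1 w.2)| ≤ 2 * δ :=
      abs_le.2 ⟨by linarith [h3.1, h3.2], by linarith [h3.1, h3.2]⟩
    have h5 : |heatSphere t (u w.1 w.2)| ≤ |B| + 1 := (hB w).trans (by linarith [le_abs_self B])
    have h6 : (|B| + 1) * (2 * δ) = ε := by rw [hδ]; field_simp
    have h7 := (le_abs_self _).trans ((abs_mul _ _).le.trans
      (mul_le_mul h5 h4 (abs_nonneg _) (by positivity)))
    rw [eval_add, eval_C]
    linarith [mul_sub (heatSphere t (u w.1 w.2)) (p.eval (u w.1 w.2) + δ) (h (u w.1 w.2))]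
  have hb := (hu.bddMeas_heat ht).mul (hu.bddMeas hh)
  calc _ ≤ ∫ w : X × X, heatSphere t (u w.1 w.2) * h (u w.1 w.2) + ε ∂(μ.prod μ) :=
        integral_mono
          (((hu.bddMeas_heat ht).mul (hu.bddMeas (Polynomial.continuous _))).integrable _)
          ((hb.add (BddMeas.const ε)).integrable _) h2
    _ = _ := by rw [integral_add (hb.integrable _) (integrable_const _)]; simp

/-- The heat kernel is non-negative because its integral against the function `max (-q_t) 0`
of `u` is. -/
theorem ae_heat_nonneg (hu : IsSphereKernel μ u) :
    ∀ᵐ w ∂(μ.prod μ), ∀ t, 0 < t → 0 ≤ heatSphere t (u w.1 w.2) := by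
  have h1 : ∀ t, 0 < t → ∀ᵐ w ∂(μ.prod μ), 0 ≤ heatSphere t (u w.1 w.2) := by
    intro t ht
    obtain ⟨h, hh, he⟩ := exists_continuous_eqOn_heatSphere ht
    have he' : ∀ w : X × X, heatSphere t (u w.1 w.2) = h (u w.1 w.2) :=
      fun w => he _ (hu.abs_le_one _ _)
    have hn : Continuous fun x => max (-h x) 0 := hh.neg.max continuous_const
    have h2 := hu.integral_heat_mul_nonneg ht hn fun x => le_max_right _ _
    -- the heat kernel times its negative part is minus the square of the negative part
    have h3 : ∀ w : X × X, heatSphere t (u w.1 w.2) * max (-h (u w.1 w.2)) 0 =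
        -(max (-h (u w.1 w.2)) 0 ^ 2) := by
      intro w
      rw [he' w]
      rcases le_total (-h (u w.1 w.2)) 0 with h4 | h4
      · rw [max_eq_right h4]; ring
      · rw [max_eq_left h4]; ring
    simp only [h3] at h2
    rw [integral_neg] at h2
    have h4 := (integral_eq_zero_iff_of_nonneg (fun w => sq_nonneg _)
      (((hu.bddMeas hn).pow 2).integrable (μ.prod μ))).1
      (le_antisymm (by linarith) (integral_nonneg fun w => sq_nonneg _))
    filter_upwards [h4] with w hw
    have h5 : max (-h (u w.1 w.2)) 0 ^ 2 = 0 := hw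
    have h6 : max (-h (u w.1 w.2)) 0 = 0 := by simpa using h5
    rw [he' w]
    linarith [le_max_left (-h (u w.1 w.2)) 0]
  have h2 : ∀ᵐ w ∂(μ.prod μ), ∀ q : ℚ, 0 < (q : ℝ) → 0 ≤ heatSphere q (u w.1 w.2) := by
    rw [ae_all_iff]; intro q
    by_cases hq : 0 < (q : ℝ)
    · filter_upwards [h1 q hq] with w hw _ using hw
    · exact Eventually.of_forall fun w h => absurd h hq
  filter_upwards [h2] with w hw t ht
  by_contra! hneg
  have ho := (continuousOn_heatSphere_time (hu.abs_le_one w.1 w.2)).isOpen_inter_preimage isOpen_Ioi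
    (isOpen_Iio (a := (0 : ℝ)))
  obtain ⟨q, hq1, hq2⟩ := Rat.denseRange_cast.exists_mem_open ho ⟨t, ht, hneg⟩
  exact absurd (hw q hq1) (not_le.2 hq2)

theorem ae_integral_heat (hu : IsSphereKernel μ u) :
    ∀ᵐ x ∂μ, ∀ t, 0 < t → ∫ y, heatSphere t (u x y) ∂μ = 1 := by
  filter_upwards [Measure.ae_ae_of_ae_prod hu.comp] with x hx t ht
  obtain ⟨y, hy⟩ := hx.exists
  have h := hasSum_integral_heatSphere_mul (μ := μ) (u := u x)
    (hu.measurable.comp measurable_prodMk_left) (hu.abs_le_one x) (BddMeas.const 1) ht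
  have e : ∀ m : ℕ, ∫ v, ((m : ℝ) + 1) * (Chebyshev.U ℝ m).eval (u x v) * 1 ∂μ =
      if m = 0 then 1 else 0 := fun m => by
    have := hy m 0
    simp only [Nat.cast_zero, zero_add, Chebyshev.U_zero, eval_one, mul_one] at this ⊢
    rw [this]
    split_ifs with h
    · simp [h]
    · rfl
  simp only [e] at h
  simp only [mul_one] at h
  rw [← h.tsum_eq, tsum_eq_single 0 fun m hm => by rw [if_neg hm, mul_zero]]
  simp

theorem ae_heat_comp (hu : IsSphereKernel μ u) : ∀ᵐ w ∂(μ.prod μ), ∀ s t, 0 < s → 0 < t →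
    heatSphere (s + t) (u w.1 w.2) = ∫ v, heatSphere s (u w.1 v) * heatSphere t (u v w.2) ∂μ := by
  filter_upwards [hu.comp] with w hw s t hs ht
  have hl : Measurable fun v => u w.1 v := hu.measurable.comp measurable_prodMk_left
  have hr : Measurable fun v => u v w.2 := hu.measurable.comp measurable_prodMk_right
  have hl1 := fun v => hu.abs_le_one w.1 v
  have hr1 := fun v => hu.abs_le_one v w.2
  have h1 := hasSum_integral_heatSphere_mul (μ := μ) hl hl1 (BddMeas.heatSphere hr hr1 ht) hs
  have h2 : ∀ m : ℕ, ∫ v, ((m : ℝ) + 1) * (Chebyshev.U ℝ m).eval (u w.1 v) *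
      heatSphere t (u v w.2) ∂μ =
      rexp (-(m * (m + 2)) * t) * (((m : ℝ) + 1) * (Chebyshev.U ℝ m).eval (u w.1 w.2)) := by
    intro m
    have h3 := hasSum_integral_heatSphere_mul (μ := μ) hr hr1
      ((BddMeas.of_continuous_of_abs_le_one hl hl1
        (Polynomial.continuous (Chebyshev.U ℝ m))).const_mul ((m : ℝ) + 1)) ht
    have h4 : ∀ l : ℕ, ∫ v, ((l : ℝ) + 1) * (Chebyshev.U ℝ l).eval (u v w.2) *
        (((m : ℝ) + 1) * (Chebyshev.U ℝ m).eval (u w.1 v)) ∂μ =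
        if m = l then ((m : ℝ) + 1) * (Chebyshev.U ℝ m).eval (u w.1 w.2) else 0 := fun l => by
      rw [← hw m l]
      exact integral_congr_ae (Eventually.of_forall fun v => mul_comm _ _)
    simp only [h4] at h3
    rw [show ∫ v, ((m : ℝ) + 1) * (Chebyshev.U ℝ m).eval (u w.1 v) * heatSphere t (u v w.2) ∂μ =
      ∫ v, heatSphere t (u v w.2) * (((m : ℝ) + 1) * (Chebyshev.U ℝ m).eval (u w.1 v)) ∂μ from
      integral_congr_ae (Eventually.of_forall fun v => mul_comm _ _), ← h3.tsum_eq,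
      tsum_eq_single m fun l hl => by rw [if_neg (Ne.symm hl), mul_zero], if_pos rfl]
  simp only [h2] at h1
  rw [← h1.tsum_eq, ← (hasSum_heatSphere (add_pos hs ht) (hu.abs_le_one w.1 w.2)).tsum_eq]
  refine tsum_congr fun m => ?_
  rw [mul_add, Real.exp_add]; ring

end IsSphereKernel

end SphereKernel

/-! ### Strong continuity at time zero -/

section StrongContinuity

variable {X : Type*} [MeasurableSpace X] {μ : Measure X}

theorem eLpNorm_two_le_of_sq_le {F G : X → ℝ} (hF : AEStronglyMeasurable F μ)
    (hG : Integrable G μ) (hFG : ∀ᵐ x ∂μ, F x ^ 2 ≤ G x) :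
    eLpNorm F 2 μ ≤ ENNReal.ofReal √(∫ x, G x ∂μ) := by
  have h1 : Integrable (fun x => F x ^ 2) μ := hG.mono' (hF.pow 2) (by
    filter_upwards [hFG] with x hx
    rwa [Real.norm_of_nonneg (sq_nonneg _)])
  rw [((memLp_two_iff_integrable_sq hF).2 h1).eLpNorm_eq_integral_rpow_norm two_ne_zero
    ENNReal.ofNat_ne_top]
  refine ENNReal.ofReal_le_ofReal ?_
  rw [sqrt_eq_rpow]
  simp only [ENNReal.toReal_ofNat, Real.rpow_two, Real.norm_eq_abs, sq_abs]
  rw [one_div]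
  exact Real.rpow_le_rpow (integral_nonneg fun x => sq_nonneg _) (integral_mono_ae h1 hG hFG)
    (by norm_num)

theorem eLpNorm_two_eq {F : X → ℝ} (hF : MemLp F 2 μ) :
    eLpNorm F 2 μ = ENNReal.ofReal √(∫ x, F x ^ 2 ∂μ) := by
  rw [hF.eLpNorm_eq_integral_rpow_norm two_ne_zero ENNReal.ofNat_ne_top, sqrt_eq_rpow]
  simp only [ENNReal.toReal_ofNat, Real.rpow_two, Real.norm_eq_abs, sq_abs, one_div]

theorem BddMeas.integrable_mul {k f : X → ℝ} (hk : BddMeas k) (hf : Integrable f μ) :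
    Integrable (fun x => k x * f x) μ := by
  obtain ⟨C, hC⟩ := hk.bounded
  exact hf.bdd_mul hk.measurable.aestronglyMeasurable (Eventually.of_forall hC)

variable [IsProbabilityMeasure μ]

/-- Jensen's inequality for the square and a probability density. -/
theorem sq_integral_mul_le {k h : X → ℝ} (hk : BddMeas k) (hk0 : ∀ᵐ x ∂μ, 0 ≤ k x)
    (hk1 : ∫ x, k x ∂μ = 1) (hh : MemLp h 2 μ) :
    (∫ x, k x * h x ∂μ) ^ 2 ≤ ∫ x, k x * h x ^ 2 ∂μ := by
  set c := ∫ x, k x * h x ∂μ with hc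
  have i1 := hk.integrable_mul (hh.integrable one_le_two)
  have i2 := hk.integrable_mul hh.integrable_sq
  have h0 : 0 ≤ ∫ x, k x * (h x - c) ^ 2 ∂μ := by
    refine integral_nonneg_of_ae ?_
    filter_upwards [hk0] with x hx using mul_nonneg hx (sq_nonneg _)
  have i3 : Integrable (fun x => k x * h x ^ 2 - 2 * c * (k x * h x)) μ :=
    i2.sub (i1.const_mul _)
  have e : ∀ x, k x * (h x - c) ^ 2 = k x * h x ^ 2 - (2 * c) * (k x * h x) + c ^ 2 * k x :=
    fun x => by ring
  simp only [e] at h0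
  rw [integral_add i3 ((hk.integrable μ).const_mul _),
    integral_sub i2 (i1.const_mul _), integral_const_mul, integral_const_mul, hk1, ← hc] at h0
  nlinarith

theorem aestronglyMeasurable_integral_mul {k : X → X → ℝ}
    (hk : BddMeas fun w : X × X => k w.1 w.2) {h : X → ℝ} (hh : AEStronglyMeasurable h μ) :
    AEStronglyMeasurable (fun x => ∫ y, k x y * h y ∂μ) μ :=
  (hk.measurable.aestronglyMeasurable.mul hh.comp_snd).integral_prod_right' (μ := μ) (ν := μ)
    (f := fun w : X × X => k w.1 w.2 * h w.2)

/-- A symmetric Markov kernel is a contraction of `L²`. -/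
theorem eLpNorm_integral_mul_le {k : X → X → ℝ} (hk : BddMeas fun w : X × X => k w.1 w.2)
    (hsymm : ∀ x y, k x y = k y x) (hk0 : ∀ᵐ w ∂(μ.prod μ), 0 ≤ k w.1 w.2)
    (hk1 : ∀ᵐ x ∂μ, ∫ y, k x y ∂μ = 1) {h : X → ℝ} (hh : MemLp h 2 μ) :
    eLpNorm (fun x => ∫ y, k x y * h y ∂μ) 2 μ ≤ eLpNorm h 2 μ := by
  have hi : Integrable (fun w : X × X => k w.1 w.2 * h w.2 ^ 2) (μ.prod μ) :=
    hk.integrable_mul (hh.integrable_sq.comp_snd μ)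
  have hG : ∫ x, ∫ y, k x y * h y ^ 2 ∂μ ∂μ = ∫ y, h y ^ 2 ∂μ := by
    rw [integral_integral_swap hi]
    refine integral_congr_ae ?_
    filter_upwards [hk1] with y hy
    simp only [hsymm _ y]
    rw [integral_mul_const, hy, one_mul]
  rw [eLpNorm_two_eq hh, ← hG]
  refine eLpNorm_two_le_of_sq_le (aestronglyMeasurable_integral_mul hk hh.1)
    hi.integral_prod_left ?_
  filter_upwards [hk1, Measure.ae_ae_of_ae_prod hk0] with x h1 h0
  exact sq_integral_mul_le (hk.left (k := k) x) h0 h1 hh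

/-- Smoothing by a kernel that is equicontinuous in its first variable makes an integrable function
bounded and uniformly continuous, with respect to closeness of `u` to `1`. -/
theorem integral_mul_uniform {u k : X → X → ℝ} (hk : BddMeas fun w : X × X => k w.1 w.2)
    (hcont : ∀ ε > 0, ∃ η > 0, ∀ x y, 1 - η < u x y → ∀ v, |k x v - k y v| ≤ ε)
    {f : X → ℝ} (hf : Integrable f μ) :
    BddMeas (fun x => ∫ y, k x y * f y ∂μ) ∧ ∀ ε > 0, ∃ η > 0, ∀ x y, 1 - η < u x y →
      |(∫ v, k x v * f v ∂μ) - ∫ v, k y v * f v ∂μ| ≤ ε := by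
  have hbound : ∀ (a : X → ℝ) (C : ℝ), (∀ v, |a v| ≤ C) → |∫ v, a v * f v ∂μ| ≤
      C * ∫ v, |f v| ∂μ := by
    intro a C ha
    rw [← integral_const_mul C, ← Real.norm_eq_abs]
    refine norm_integral_le_of_norm_le (hf.abs.const_mul C) (Eventually.of_forall fun v => ?_)
    rw [norm_mul]
    exact mul_le_mul_of_nonneg_right (ha v) (norm_nonneg _)
  refine ⟨⟨?_, ?_⟩, fun ε hε => ?_⟩
  · have e : (fun x => ∫ y, k x y * f y ∂μ) = fun x => ∫ y, k x y * hf.1.mk f y ∂μ := by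
      funext x
      refine integral_congr_ae ?_
      filter_upwards [hf.1.ae_eq_mk] with y hy
      rw [← hy]
    rw [e]
    exact (StronglyMeasurable.integral_prod_right (ν := μ) (f := fun x y => k x y * hf.1.mk f y)
      (hk.measurable.stronglyMeasurable.mul
        (hf.1.stronglyMeasurable_mk.comp_measurable measurable_snd))).measurable
  · obtain ⟨C, hC⟩ := hk.bounded
    exact ⟨_, fun x => hbound _ C fun v => hC (x, v)⟩
  · set I := ∫ v, |f v| ∂μ with hI
    have hI0 : 0 ≤ I := integral_nonneg fun v => abs_nonneg _
    obtain ⟨η, hη, h⟩ := hcont (ε / (I + 1)) (by positivity)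
    refine ⟨η, hη, fun x y hxy => ?_⟩
    rw [← integral_sub ((hk.left (k := k) x).integrable_mul hf)
      ((hk.left (k := k) y).integrable_mul hf)]
    simp only [← sub_mul]
    refine (hbound _ _ (h x y hxy)).trans ?_
    rw [div_mul_eq_mul_div, div_le_iff₀ (by positivity)]
    nlinarith

namespace IsSphereKernel

variable {u : X → X → ℝ}

theorem integral_heat (hu : IsSphereKernel μ u) {t : ℝ} (ht : 0 < t) :
    ∫ w : X × X, heatSphere t (u w.1 w.2) ∂(μ.prod μ) = 1 := by
  simpa using hu.integral_heat_mul_chebyshevU ht 0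

theorem integral_heat_mul (hu : IsSphereKernel μ u) {t : ℝ} (ht : 0 < t) :
    ∫ w : X × X, heatSphere t (u w.1 w.2) * u w.1 w.2 ∂(μ.prod μ) = rexp (-3 * t) := by
  have h := hu.integral_heat_mul_chebyshevU ht 1
  have e : ∀ w : X × X, heatSphere t (u w.1 w.2) * (Chebyshev.U ℝ (1 : ℕ)).eval (u w.1 w.2) =
      2 * (heatSphere t (u w.1 w.2) * u w.1 w.2) := fun w => by
    simp [Chebyshev.U_one]; ring
  simp only [e] at h
  rw [integral_const_mul] at h
  norm_num at h
  rw [h, neg_mul]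

/-- Strong continuity on functions that vary little where `u` is close to `1`; the mass of the heat
kernel elsewhere is controlled by `∫ q_t (1 - u) = 1 - e^{-3t}`. -/
theorem tendsto_of_uniform (hu : IsSphereKernel μ u) {g : X → ℝ} (hg : BddMeas g)
    (hcont : ∀ ε > 0, ∃ η > 0, ∀ x y, 1 - η < u x y → |g x - g y| ≤ ε) :
    Tendsto (fun t => eLpNorm (fun x => (∫ y, heatSphere t (u x y) * g y ∂μ) - g x) 2 μ)
      (𝓝[>] 0) (𝓝 0) := by
  obtain ⟨B, hB⟩ := hg.bounded
  have key : ∀ ε > 0, ∃ A : ℝ, ∀ t, 0 < t →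
      eLpNorm (fun x => (∫ y, heatSphere t (u x y) * g y ∂μ) - g x) 2 μ ≤
        ENNReal.ofReal √(ε ^ 2 + A * (1 - rexp (-3 * t))) := by
    intro ε hε
    obtain ⟨η, hη, hc⟩ := hcont ε hε
    set A := (2 * B) ^ 2 / η with hA
    have hA0 : 0 ≤ A := by positivity
    refine ⟨A, fun t ht => ?_⟩
    have hq := hu.bddMeas_heat ht
    have hd : BddMeas fun w : X × X => g w.2 - g w.1 :=
      (hg.comp measurable_snd).sub (hg.comp measurable_fst)
    have hub : BddMeas fun w : X × X => u w.1 w.2 := hu.bddMeas continuous_id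
    have hqd := hq.mul (hd.pow 2)
    -- the oscillation is small where `u` is close to `1`, and bounded elsewhere
    have hpt : ∀ w : X × X, (g w.2 - g w.1) ^ 2 ≤ ε ^ 2 + A * (1 - u w.1 w.2) := by
      intro w
      have h1 := (le_abs_self _).trans (hu.abs_le_one w.1 w.2)
      rcases lt_or_ge (1 - η) (u w.1 w.2) with h | h
      · have h2 := abs_le.1 (hc _ _ h)
        have := mul_nonneg hA0 (sub_nonneg.2 h1)
        nlinarith
      · have h2 := abs_le.1 (hB w.1)
        have h3 := abs_le.1 (hB w.2)
        have h4 : A * η = (2 * B) ^ 2 := by rw [hA]; field_simp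
        have h5 : A * η ≤ A * (1 - u w.1 w.2) := mul_le_mul_of_nonneg_left (by linarith) hA0
        nlinarith
    have hle : ∫ x, ∫ y, heatSphere t (u x y) * (g y - g x) ^ 2 ∂μ ∂μ ≤
        ε ^ 2 + A * (1 - rexp (-3 * t)) := by
      rw [← integral_prod (fun w : X × X => heatSphere t (u w.1 w.2) * (g w.2 - g w.1) ^ 2)
        (hqd.integrable _)]
      have i1 := hq.const_mul (ε ^ 2 + A)
      have i2 := (hq.mul hub).const_mul A
      calc _ ≤ ∫ w : X × X, (ε ^ 2 + A) * heatSphere t (u w.1 w.2) -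
            A * (heatSphere t (u w.1 w.2) * u w.1 w.2) ∂(μ.prod μ) := by
            refine integral_mono_ae (hqd.integrable _) ((i1.sub i2).integrable _) ?_
            filter_upwards [hu.ae_heat_nonneg] with w hw
            have := mul_le_mul_of_nonneg_left (hpt w) (hw t ht)
            linarith
        _ = _ := by
            rw [integral_sub (i1.integrable _) (i2.integrable _), integral_const_mul,
              integral_const_mul, hu.integral_heat ht, hu.integral_heat_mul ht]
            ring
    refine le_trans ?_ (ENNReal.ofReal_le_ofReal (sqrt_le_sqrt hle))
    refine eLpNorm_two_le_of_sq_le ((aestronglyMeasurable_integral_mul hq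
      hg.measurable.aestronglyMeasurable).sub hg.measurable.aestronglyMeasurable)
      (hqd.integrable _).integral_prod_left ?_
    filter_upwards [hu.ae_integral_heat, Measure.ae_ae_of_ae_prod hu.ae_heat_nonneg] with x h1 h0
    have hqx := hq.left (k := fun x y => heatSphere t (u x y)) x
    have e : (∫ y, heatSphere t (u x y) * g y ∂μ) - g x =
        ∫ y, heatSphere t (u x y) * (g y - g x) ∂μ := by
      simp only [mul_sub]
      rw [integral_sub ((hqx.mul hg).integrable _) ((hqx.mul (BddMeas.const _)).integrable _),
        integral_mul_const, h1 t ht, one_mul]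
    rw [e]
    exact sq_integral_mul_le hqx (h0.mono fun y hy => hy t ht) (h1 t ht)
      ((hg.sub (BddMeas.const _)).memLp μ 2)
  rw [ENNReal.tendsto_nhds_zero]
  intro e he
  rcases eq_or_ne e ⊤ with rfl | htop
  · exact Eventually.of_forall fun t => le_top
  have he' : 0 < e.toReal := ENNReal.toReal_pos he.ne' htop
  obtain ⟨A, hA⟩ := key (e.toReal / 2) (by positivity)
  have hlim : Tendsto (fun t : ℝ => (e.toReal / 2) ^ 2 + A * (1 - rexp (-3 * t))) (𝓝[>] 0)
      (𝓝 ((e.toReal / 2) ^ 2)) := by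
    have : Continuous fun t : ℝ => (e.toReal / 2) ^ 2 + A * (1 - rexp (-3 * t)) := by fun_prop
    have := (this.tendsto 0).mono_left (nhdsWithin_le_nhds (s := Ioi 0))
    simpa using this
  filter_upwards [hlim.eventually_le_const (show (e.toReal / 2) ^ 2 < e.toReal ^ 2 by nlinarith),
    self_mem_nhdsWithin] with t h1 ht
  refine (hA t ht).trans ?_
  refine (ENNReal.ofReal_le_iff_le_toReal htop).2 ((sqrt_le_sqrt h1).trans (sqrt_sq he'.le).le)

end IsSphereKernel

/-- The spherical heat kernel in `Re z` is a heat kernel if the heat kernel of the disc in `z` is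
one. -/
theorem IsDiscHeat.isHeatKernel_heatSphere {z : X → X → ℂ} (hz : IsDiscHeat μ z)
    (hcont : ∀ s > 0, ∀ ε > 0, ∃ η > 0, ∀ x y, 1 - η < (z x y).re → ∀ v,
      |heatDisc s (z x v) - heatDisc s (z y v)| ≤ ε) :
    IsHeatKernel μ fun t x y => heatSphere t (z x y).re := by
  have hu := hz.isSphereKernel
  refine ⟨fun t ht => (hu.bddMeas_heat ht).measurable, hu.ae_heat_nonneg,
    Eventually.of_forall fun w t _ => by rw [hz.symm], ?_, ?_, fun f hf => ?_⟩
  · filter_upwards [hu.ae_integral_heat] with x hx t ht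
    exact ⟨((hu.bddMeas_heat ht).left (k := fun x y => heatSphere t (z x y).re) x).integrable μ,
      hx t ht⟩
  · filter_upwards [hu.ae_heat_comp] with w hw s t hs ht
    exact ⟨(((hu.bddMeas_heat hs).left (k := fun x y => heatSphere s (z x y).re) w.1).mul
      ((hu.bddMeas_heat ht).right (k := fun x y => heatSphere t (z x y).re) w.2)).integrable μ,
      hw s t hs ht⟩
  rw [ENNReal.tendsto_nhds_zero]
  intro e he
  have he3 : 0 < e / 3 := ENNReal.div_pos he.ne' ENNReal.ofNat_ne_top
  have hfi := hf.integrable one_le_two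
  -- approximate `f` by the uniformly continuous function `g`
  obtain ⟨s, hs3, hs⟩ := ((ENNReal.tendsto_nhds_zero.1 (hz.heat.approx f hf) _ he3).and
    self_mem_nhdsWithin).exists
  have hs : 0 < s := hs
  obtain ⟨hg, hgc⟩ := integral_mul_uniform (hz.bddMeas_heat hs) (hcont s hs) hfi
  set g : X → ℝ := fun x => ∫ y, heatDisc s (z x y) * f y ∂μ with hgdef
  have hgm := hg.memLp μ 2
  have hfg : MemLp (fun x => f x - g x) 2 μ := hf.sub hgm
  filter_upwards [ENNReal.tendsto_nhds_zero.1 (hu.tendsto_of_uniform hg hgc) _ he3,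
    self_mem_nhdsWithin] with t h1 ht
  have ht : 0 < t := ht
  have hq := hu.bddMeas_heat ht
  have hqx := fun x => hq.left (k := fun x y => heatSphere t (z x y).re) x
  have e1 : (fun x => (∫ y, heatSphere t (z x y).re * f y ∂μ) - f x) =
      (fun x => ∫ y, heatSphere t (z x y).re * (f y - g y) ∂μ) +
      ((fun x => (∫ y, heatSphere t (z x y).re * g y ∂μ) - g x) + fun x => g x - f x) := by
    funext x
    simp only [Pi.add_apply, mul_sub]
    rw [integral_sub ((hqx x).integrable_mul hfi) (((hqx x).mul hg).integrable _)]
    ring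
  have m1 := aestronglyMeasurable_integral_mul (k := fun x y => heatSphere t (z x y).re) hq hfg.1
  have m2 := (aestronglyMeasurable_integral_mul
    (k := fun x y => heatSphere t (z x y).re) hq hgm.1).sub hgm.1
  have m3 := hgm.1.sub hf.1
  have c1 : eLpNorm (fun x => ∫ y, heatSphere t (z x y).re * (f y - g y) ∂μ) 2 μ ≤ e / 3 := by
    refine (eLpNorm_integral_mul_le
      (k := fun x y => heatSphere t (z x y).re) hq (fun x y => by rw [hz.symm])
      (hu.ae_heat_nonneg.mono fun w hw => hw t ht)
      (hu.ae_integral_heat.mono fun x hx => hx t ht) hfg).trans ?_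
    exact (eLpNorm_sub_comm f g 2 μ).le.trans hs3
  rw [e1]
  calc _ ≤ _ := eLpNorm_add_le m1 (m2.add m3) one_le_two
    _ ≤ e / 3 + (e / 3 + e / 3) := add_le_add c1
        ((eLpNorm_add_le m2 m3 one_le_two).trans (add_le_add h1 hs3))
    _ = e := by rw [← add_assoc, ENNReal.add_thirds]

end StrongContinuity

/-! ### Transfer to the metric space -/

theorem IsHeatKernel.congr {X : Type*} [MeasurableSpace X] {μ : Measure X} {p q : ℝ → X → X → ℝ}
    (hp : IsHeatKernel μ p) (h : ∀ t, 0 < t → p t = q t) : IsHeatKernel μ q where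
  measurable t ht := h t ht ▸ hp.measurable t ht
  nonneg := hp.nonneg.mono fun w hw t ht => h t ht ▸ hw t ht
  symm := hp.symm.mono fun w hw t ht => h t ht ▸ hw t ht
  conservative := hp.conservative.mono fun x hx t ht => h t ht ▸ hx t ht
  semigroup := hp.semigroup.mono fun w hw s t hs ht => by
    rw [← h s hs, ← h t ht, ← h _ (add_pos hs ht)]; exact hw s t hs ht
  approx f hf := (hp.approx f hf).congr' (by
    filter_upwards [self_mem_nhdsWithin] with t ht
    rw [h t ht])

theorem isHeatKernel_zero {X : Type*} [MeasurableSpace X] {p : ℝ → X → X → ℝ}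
    (hp : ∀ t, 0 < t → Measurable fun w : X × X => p t w.1 w.2) :
    IsHeatKernel (0 : Measure X) p :=
  ⟨hp, by simp, by simp, by simp, by simp, fun f _ => by simp⟩

/-- The heat kernel of the disc is a continuous function of `Re ζ` and `‖ζ‖`. -/
theorem exists_abs_heatDisc_sub_le {s : ℝ} (hs : 0 < s) {ε : ℝ} (hε : 0 < ε) :
    ∃ η > 0, ∀ ζ ξ : ℂ, ‖ζ‖ ≤ 1 → ‖ξ‖ ≤ 1 → |ζ.re - ξ.re| < η → |‖ζ‖ - ‖ξ‖| < η →
      |heatDisc s ζ - heatDisc s ξ| < ε := by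
  set K : Set (ℝ × ℝ) := {a | |a.1| ≤ a.2 ∧ a.2 ≤ 1} with hK
  set G : ℝ × ℝ → ℂ := fun a => (a.1 : ℂ) + (√(a.2 ^ 2 - a.1 ^ 2) : ℝ) * Complex.I with hG
  have hKc : IsCompact K := by
    refine (isCompact_Icc (a := ((-1, 0) : ℝ × ℝ)) (b := (1, 1))).of_isClosed_subset ?_ ?_
    · have h1 : IsClosed {a : ℝ × ℝ | |a.1| ≤ a.2} := isClosed_le (by fun_prop) (by fun_prop)
      have h2 : IsClosed {a : ℝ × ℝ | a.2 ≤ 1} := isClosed_le (by fun_prop) (by fun_prop)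
      exact h1.inter h2
    · rintro ⟨a, b⟩ ⟨h1, h2⟩
      simp only at h1 h2
      have := abs_le.1 h1
      exact ⟨⟨by simp only; linarith, by simp only; linarith [abs_nonneg a]⟩,
        ⟨by simp only; linarith, h2⟩⟩
  have hGc : Continuous G := by fun_prop
  have hGK : MapsTo G K (Metric.closedBall 0 1) := by
    rintro ⟨a, b⟩ ⟨h1, h2⟩
    simp only at h1 h2
    have hb : 0 ≤ b := (abs_nonneg a).trans h1
    have h3 : a ^ 2 ≤ b ^ 2 := sq_le_sq.2 (by rwa [abs_of_nonneg hb])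
    rw [mem_closedBall_zero_iff, hG, Complex.norm_add_mul_I, sq_sqrt (by simpa using h3)]
    refine sqrt_le_one.2 ?_
    simp only
    nlinarith
  have hu := hKc.uniformContinuousOn_of_continuous
    ((continuousOn_heatDisc hs).comp hGc.continuousOn hGK)
  obtain ⟨η, hη, h⟩ := Metric.uniformContinuousOn_iff.1 hu ε hε
  have hval : ∀ ζ : ℂ, heatDisc s (G (ζ.re, ‖ζ‖)) = heatDisc s ζ := by
    intro ζ
    rw [← heatDisc_fold s ζ]
    congr 1
    have : ‖ζ‖ ^ 2 - ζ.re ^ 2 = ζ.im ^ 2 := by rw [Complex.sq_norm, Complex.normSq_apply]; ring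
    simp only [hG, this, sqrt_sq_eq_abs]
    apply Complex.ext <;> simp [fold]
  refine ⟨η, hη, fun ζ ξ h1 h2 h3 h4 => ?_⟩
  have := h (ζ.re, ‖ζ‖) ⟨Complex.abs_re_le_norm ζ, h1⟩ (ξ.re, ‖ξ‖) ⟨Complex.abs_re_le_norm ξ, h2⟩
    (by rw [Prod.dist_eq, max_lt_iff]; exact ⟨h3, h4⟩)
  simpa only [Function.comp_apply, hval, Real.dist_eq] using this

theorem cos_delta (r θ : ℝ) : cos (delta r θ) = (zeta r θ).re := by
  have h : |(zeta r θ).re| ≤ 1 := (Complex.abs_re_le_norm _).trans (norm_zeta_le r θ)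
  rw [zeta_re] at h ⊢
  rw [delta, cos_arccos (abs_le.1 h).1 (abs_le.1 h).2]

section MetricSpace

variable {M : Type*} [MetricSpace M] {r θ : M → M → ℝ}

theorem le_dist_of_eq_delta (hr : IsPseudoMetric r) (hr_le : ∀ x y, r x y ≤ π / 2)
    (hδ : ∀ x y, dist x y = delta (r x y) (θ x y)) (x y : M) : r x y ≤ dist x y := by
  have h0 := hr.nonneg x y
  rw [hδ, delta]
  conv_lhs => rw [← arccos_cos h0 ((hr_le x y).trans (by linarith [pi_pos]))]
  refine arccos_le_arccos ?_
  have := cos_nonneg_of_mem_Icc (x := r x y) ⟨by linarith [pi_pos], hr_le x y⟩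
  exact mul_le_of_le_one_right this (cos_le_one _)

/-- Points that are close for `dist` have close distances, and therefore close heat kernels, to any
other point. -/
theorem exists_abs_heatDisc_zeta_sub_le (hr : IsPseudoMetric r) (hr_le : ∀ x y, r x y ≤ π / 2)
    (hδ : ∀ x y, dist x y = delta (r x y) (θ x y)) {s : ℝ} (hs : 0 < s) {ε : ℝ} (hε : 0 < ε) :
    ∃ η > 0, ∀ x y, 1 - η < (zeta (r x y) (θ x y)).re → ∀ v,
      |heatDisc s (zeta (r x v) (θ x v)) - heatDisc s (zeta (r y v) (θ y v))| ≤ ε := by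
  obtain ⟨η, hη, h⟩ := exists_abs_heatDisc_sub_le hs hε
  obtain ⟨κ, hκ, h'⟩ := Metric.continuousAt_iff.1 (continuous_arccos.continuousAt (x := 1)) η hη
  refine ⟨κ, hκ, fun x y hxy v => (h _ _ (norm_zeta_le _ _) (norm_zeta_le _ _) ?_ ?_).le⟩
  all_goals
    have hd : dist x y < η := by
      rw [zeta_re] at hxy
      have h1 : cos (r x y) * cos (θ x y) ≤ 1 := by
        rw [← zeta_re]
        exact (le_abs_self _).trans ((Complex.abs_re_le_norm _).trans (norm_zeta_le _ _))
      have h2 := h' (x := cos (r x y) * cos (θ x y)) (by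
        rw [Real.dist_eq, abs_lt]; constructor <;> linarith)
      rw [arccos_one, Real.dist_eq, sub_zero] at h2
      rw [hδ]
      exact (le_abs_self _).trans_lt h2
  · rw [← cos_delta, ← cos_delta, ← hδ, ← hδ]
    exact ((Real.abs_cos_sub_cos_le _ _).trans (abs_dist_sub_le x y v)).trans_lt hd
  · have hn : ∀ a b, ‖zeta (r a b) (θ a b)‖ = cos (r a b) := fun a b => by
      rw [norm_zeta, abs_of_nonneg (cos_nonneg_of_mem_Icc
        ⟨by linarith [pi_pos, hr.nonneg a b], hr_le a b⟩)]
    rw [hn, hn]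
    refine ((Real.abs_cos_sub_cos_le _ _).trans ?_).trans_lt
      ((le_dist_of_eq_delta hr hr_le hδ x y).trans_lt hd)
    have h1 := hr.triangle x y v
    have h2 := hr.triangle y x v
    rw [hr.symm y x] at h2
    exact abs_le.2 ⟨by linarith, by linarith⟩

/-- For `μ = 0` nothing is to be shown but measurability.  Otherwise `μ` is a probability measure;
only `Re ζ` and `|Im ζ|` are known to be measurable, so `ζ` is replaced by its conjugate in the
closed upper half plane, which changes neither kernel. -/
theorem isHeatKernel_riemKernel [MeasurableSpace M] {μ : Measure M}
    (hr : IsPseudoMetric r) (hr_le : ∀ x y, r x y ≤ π / 2) (hθ_symm : ∀ x y, θ x y = θ y x)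
    (hδ : ∀ x y, dist x y = delta (r x y) (θ x y))
    (hp : IsHeatKernel μ fun t x y => subellipticProfile t (r x y) (θ x y)) :
    IsHeatKernel μ (riemKernel r θ) := by
  set z : M → M → ℂ := fun x y => fold (zeta (r x y) (θ x y)) with hz
  have hz1 : ∀ x y, ‖z x y‖ ≤ 1 := fun x y => (norm_fold _).trans_le (norm_zeta_le _ _)
  have hp' : IsHeatKernel μ fun t x y => heatDisc t (z x y) := hp.congr fun t ht => by
    funext x y
    rw [subellipticProfile_eq ht, hz, heatDisc_fold]
  have hzm : Measurable fun w : M × M => z w.1 w.2 := by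
    refine measurable_fold (z := fun w : M × M => zeta (r w.1 w.2) (θ w.1 w.2))
      (fun w => norm_zeta_le _ _) fun t ht => ?_
    have := hp.measurable t ht
    simpa only [subellipticProfile_eq ht] using this
  have hq : ∀ t, 0 < t → (fun x y => heatSphere t (z x y).re) = riemKernel r θ t := fun t ht => by
    funext x y
    rw [riemKernel, riemProfile_eq ht ⟨neg_one_le_cos _, cos_le_one _⟩, cos_delta]
    rfl
  rcases eq_or_ne μ 0 with rfl | hμ
  · refine (isHeatKernel_zero fun t ht => ?_).congr hq
    exact (BddMeas.heatSphere (Complex.measurable_re.comp hzm)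
      (fun w => (Complex.abs_re_le_norm _).trans (hz1 w.1 w.2)) ht).measurable
  have : NeBot (ae μ) := ae_neBot.2 hμ
  obtain ⟨x, hx⟩ := hp'.conservative.exists
  have : IsProbabilityMeasure μ := measure_univ_eq_one (hz1 x) hx
  have hdisc : IsDiscHeat μ z :=
    ⟨hzm, hz1, fun x y => by simp only [hz, hr.symm x y, hθ_symm x y], hp'⟩
  refine (hdisc.isHeatKernel_heatSphere fun s hs ε hε => ?_).congr hq
  obtain ⟨η, hη, h⟩ := exists_abs_heatDisc_zeta_sub_le hr hr_le hδ hs hε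
  refine ⟨η, hη, fun x y hxy v => ?_⟩
  simp only [hz, heatDisc_fold]
  exact h x y hxy v

end MetricSpace

end HeatRigidity

end

theorem mainTheorem4 {M : Type*} [MetricSpace M] [MeasurableSpace M] [BorelSpace M]
    (μ : Measure M) [SigmaFinite μ] (r θ : M → M → ℝ)
    (hr : HeatRigidity.IsPseudoMetric r) (hr_le : ∀ x y, r x y ≤ π / 2)
    (hθ_nonneg : ∀ x y, 0 ≤ θ x y) (hθ_le : ∀ x y, θ x y ≤ π)
    (hθ_self : ∀ x, θ x x = 0) (hθ_symm : ∀ x y, θ x y = θ y x)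
    (hδ : ∀ x y, dist x y = HeatRigidity.delta (r x y) (θ x y))
    (hp : HeatRigidity.IsHeatKernel μ
      fun t x y => HeatRigidity.subellipticProfile t (r x y) (θ x y)) :
    (∀ t : ℝ, 0 < t → ∀ x y : M,
      HasSum (fun nk : ℤ × ℕ =>
        (rexp (HeatRigidity.riemEigenvalue nk.2 nk.1 * t) : ℂ) *
          Complex.exp (Complex.I * nk.1 * θ x y) * (HeatRigidity.phi nk.2 nk.1 (r x y) : ℂ))
        (HeatRigidity.riemKernel r θ t x y : ℂ)) ∧
    HeatRigidity.IsHeatKernel μ (HeatRigidity.riemKernel r θ) :=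
  ⟨fun _ ht x y => HeatRigidity.hasSum_riemProfile ht (r x y) (θ x y),
    HeatRigidity.isHeatKernel_riemKernel hr hr_le hθ_symm hδ hp⟩
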